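/- **Setting.** Let $f\in C^2(\mathbb R\times\mathbb R,\mathbb R)$ and $\lambda_-<\lambda_+$. Let $\mathcal P(\lambda_-,\lambda_+)$ be the set of $\Lambda\in C^2(\mathbb R,\mathbb R)$ with $\lambda_-<\Lambda(s)<\lambda_+$ for all $s$, $\Lambda(s)\to\lambda_\pm$ and $\Lambda'(s)\to0$ as $s\to\pm\infty$. Assume that for all $\Lambda\in\mathcal P(\lambda_-,\lambda_+)$ and $r>0$ the solution $\Phi_{t,s}(x_0)$ of $$\dot x=f(x,\Lambda(rt)),\qquad x(s)=x_0 \tag{$*$}$$ exists for all $t\ge s$. Let $\mathcal X=\{(x,\lambda): f(x,\lambda)=0,\ \lambda_-\le\lambda\le\lambda_+\}$, let $\mathcal X_{\rm stab}$, $\mathcal X_{\rm bif}$ be its subsets where $\partial_xf<0$, respectively $\partial_xf=0$, and assume that $\mathcal X_{\rm bif}$ has no accumulation point and contains no point with $\lambda=\lambda_\pm$. * A *stable branch* on $[a,b]\subseteq[\lambda_-,\lambda_+]$ is a curve $\lambda\mapsto(B(\lambda),\lambda)$ in $\overline{\mathcal X_{\rm stab}}$, $\lambda\in[a,b]$, with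 $B$ continuous on $[a,b]$ and $C^2$ on $(a,b)$, which does not meet $\mathcal X_{\rm bif}$ except possibly at its end points. * A *stable path* from $(X_-,\lambda_-)$ to $(X_+,\lambda_+)$ for $\Lambda$ is a continuous curve $s\mapsto(X(s),\Lambda(s))$, $s\in\mathbb R$, in $\overline{\mathcal X_{\rm stab}}$ with $X(s)\to X_\pm$ as $s\to\pm\infty$. Points $X_\pm$ with $(X_\pm,\lambda_\pm)\in\mathcal X_{\rm stab}$ are *$\Lambda$-connected* if such a path joins them. The path *traverses a single stable branch* if $X(s)=B(\Lambda(s))$ for all $s$, for a stable branch $B$ on $[\lambda_-,\lambda_+]$. * $\mathcal B(x,\lambda)$ is the set of initial values whose solution of $\dot y=f(y,\lambda)$ exists for all $t\ge 0$ and tends to $x$ as $t\to\infty$. The path is *forward basin-stable* if $\overline{\{X(u):u<v\}}\subset\mathcal B(X(v),\Lambda(v))$ for all $v\in\mathbb R$. * A solution $x$ of $(*)$ on $\mathbb R$ is a *(local) pullback attractor* if there are a bounded open $U$ and $T>0$ with $x(t)\in U$ for $t<-T$ and $|\Phi_{t,t-s}(y)-x(t)|\to0$ as $s\to\infty$, for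 all $y\in U$, $t\in\mathbb R$. For $(X_-,\lambda_-)\in\mathcal X_{\rm stab}$, $\tilde x_{pb}^{[\Lambda,r,X_-]}$ is the pullback attractor that is the unique solution of $(*)$ on $\mathbb R$ tending to $X_-$ as $t\to-\infty$ (its existence is part of each claim below). A solution *end-point tracks* a path from $X_-$ to $X_+$ if it tends to $X_\pm$ as $t\to\pm\infty$. * There is *irreversible R-tipping* from $X_-$ on $\Lambda$ if there are $r_0>0$, an $X_+^*$ that is $\Lambda$-connected to $X_-$, and $Z\in[-\infty,\infty]$, $Z\ne X_+^*$, such that $\tilde x_{pb}^{[\Lambda,r,X_-]}$ end-point tracks a stable path from $X_-$ to $X_+^*$ for $0<r<r_0$, while $\tilde x_{pb}^{[\Lambda,r_0,X_-]}(t)\to Z$ as $t\to\infty$. We call $Z$ the *critical limit*. **Theorem.** Let $\Lambda\in\mathcal P(\lambda_-,\lambda_+)$, $(X_\pm,\lambda_\pm)\in\mathcal X_{\rm stab}$, and let $(X(s),\Lambda(s))$ be a stable path from $(X_-,\lambda_-)$ to $(X_+,\lambda_+)$. 1. If the path is forward basin-stable, then $\tilde x_{pb}^{[\Lambda,r,X_-]}$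 end-point tracks it for every $r>0$; hence there is no irreversible R-tipping from $X_-$ on $\Lambda$. 2. Suppose that the path traverses a single stable branch, that $Y$ is a stable branch on $[\lambda_0,\lambda_+]$, $\lambda_-\le\lambda_0<\lambda_+$, with $Y(\lambda_+)\ne X_+$, and that there are $u<v$ with $\Lambda(v)\ge\lambda_0$, $(Y(\Lambda(v)),\Lambda(v))\in\mathcal X_{\rm stab}$ (automatic if $\Lambda(v)>\lambda_0$) and $X(u)\in\mathcal B(Y(\Lambda(v)),\Lambda(v))$. Then the path is not forward basin-stable, and there is $\tilde\Lambda\in\mathcal P(\lambda_-,\lambda_+)$ with irreversible R-tipping from $X_-$ on $\tilde\Lambda$, with a finite critical limit. 3. Suppose that the path traverses a single stable branch and that there is $(Y_+,\lambda_+)\in\mathcal X_{\rm stab}$ with $X_-$ and $Y_+$ not $\Lambda$-connected and $X_-\in\mathcal B(Y_+,\lambda_+)$. Then the path is not forward basin-stable, and there is irreversible R-tipping from $X_-$ on this $\Lambda$. -/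

import Mathlib

open Set Filter Topology

noncomputable section

namespace RTip

/-- The class of parameter shifts from `lm` to `lp`: `C^2` functions with values strictly between
`lm` and `lp`, tending to `lm` and `lp` at `-∞` and `+∞`, with derivative tending to `0` at both
ends. -/
structure IsParameterShift (lm lp : ℝ) (Λ : ℝ → ℝ) : Prop where
  contDiff : ContDiff ℝ 2 Λ
  mem_Ioo : ∀ s, Λ s ∈ Ioo lm lp
  tendsto_atBot : Tendsto Λ atBot (𝓝 lm)
  tendsto_atTop : Tendsto Λ atTop (𝓝 lp)
  deriv_atBot : Tendsto (deriv Λ) atBot (𝓝 0)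
  deriv_atTop : Tendsto (deriv Λ) atTop (𝓝 0)

/-! ### The bifurcation diagram of the frozen systems `x' = f x λ` -/

/-- All equilibria `(x, λ)` with `lm ≤ λ ≤ lp`. -/
def equilibria (f : ℝ → ℝ → ℝ) (lm lp : ℝ) : Set (ℝ × ℝ) :=
  {p | f p.1 p.2 = 0 ∧ p.2 ∈ Icc lm lp}

/-- Linearly stable equilibria. In one space dimension the spectrum of the linearization
consists of the single number `∂f/∂x`. -/
def stabSet (f : ℝ → ℝ → ℝ) (lm lp : ℝ) : Set (ℝ × ℝ) :=
  {p | p ∈ equilibria f lm lp ∧ deriv (fun y => f y p.2) p.1 < 0}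

/-- Bifurcation (non-hyperbolic) equilibria. -/
def bifSet (f : ℝ → ℝ → ℝ) (lm lp : ℝ) : Set (ℝ × ℝ) :=
  {p | p ∈ equilibria f lm lp ∧ deriv (fun y => f y p.2) p.1 = 0}

/-- Regularity of the bifurcation diagram: the bifurcation set has no accumulation point.
(In one space dimension the other half of regularity, that attractors of the frozen systems are
equilibria, holds automatically.) -/
def IsRegular (f : ℝ → ℝ → ℝ) (lm lp : ℝ) : Prop :=
  ∀ p : ℝ × ℝ, ¬ AccPt p (𝓟 (bifSet f lm lp))

/-- A branch of equilibria over the parameter interval `[a, b]`: a curve `λ ↦ B λ` of equilibria,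
continuous up to the end points, `C^2` and without bifurcation points in between. At an end point
a bifurcation is allowed; the curve need only be continuous there, so that a branch may
end in a fold. -/
structure IsBranch (f : ℝ → ℝ → ℝ) (lm lp a b : ℝ) (B : ℝ → ℝ) : Prop where
  continuousOn : ContinuousOn B (Icc a b)
  contDiffOn : ContDiffOn ℝ 2 B (Ioo a b)
  mem_equilibria : ∀ l ∈ Icc a b, (B l, l) ∈ equilibria f lm lp
  notMem_bifSet : ∀ l ∈ Ioo a b, (B l, l) ∉ bifSet f lm lp

/-- A stable branch: a branch contained in the closure of the linearly stable equilibria. -/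
structure IsStableBranch (f : ℝ → ℝ → ℝ) (lm lp a b : ℝ) (B : ℝ → ℝ) : Prop
    extends IsBranch f lm lp a b B where
  mem_closure : ∀ l ∈ Icc a b, (B l, l) ∈ closure (stabSet f lm lp)

/-- `s ↦ (X s, Λ s)` is a stable path from `(Xm, lm)` to `(Xp, lp)`. -/
structure IsStablePath (f : ℝ → ℝ → ℝ) (lm lp : ℝ) (Λ X : ℝ → ℝ) (Xm Xp : ℝ) : Prop where
  continuous : Continuous X
  tendsto_atBot : Tendsto X atBot (𝓝 Xm)
  tendsto_atTop : Tendsto X atTop (𝓝 Xp)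
  mem_equilibria : ∀ s, (X s, Λ s) ∈ equilibria f lm lp
  mem_closure : ∀ s, (X s, Λ s) ∈ closure (stabSet f lm lp)

/-- The linearly stable equilibria `(Xm, lm)` and `(Xp, lp)` are `Λ`-connected: some stable path
joins them. -/
def LambdaConnected (f : ℝ → ℝ → ℝ) (lm lp : ℝ) (Λ : ℝ → ℝ) (Xm Xp : ℝ) : Prop :=
  (Xm, lm) ∈ stabSet f lm lp ∧ (Xp, lp) ∈ stabSet f lm lp ∧
    ∃ X : ℝ → ℝ, IsStablePath f lm lp Λ X Xm Xp

/-- The stable path traverses the single stable branch `B` over `[lm, lp]`. -/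
def TraversesBranch (f : ℝ → ℝ → ℝ) (lm lp : ℝ) (Λ X B : ℝ → ℝ) : Prop :=
  IsStableBranch f lm lp lm lp B ∧ ∀ s, X s = B (Λ s)

/-- The basin of attraction of the equilibrium `x` of the frozen system `y' = f y l`. -/
def basin (f : ℝ → ℝ → ℝ) (x l : ℝ) : Set ℝ :=
  {x₀ | ∃ y : ℝ → ℝ, y 0 = x₀ ∧
    (∀ t, 0 ≤ t → HasDerivWithinAt y (f (y t) l) (Ici 0) t) ∧ Tendsto y atTop (𝓝 x)}

/-- Forward basin stability of the path `s ↦ (X s, Λ s)`. -/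
def ForwardBasinStable (f : ℝ → ℝ → ℝ) (Λ X : ℝ → ℝ) : Prop :=
  ∀ v : ℝ, closure (X '' Iio v) ⊆ basin f (X v) (Λ v)

/-! ### The nonautonomous system `x' = f x (Λ (r t))` -/

/-- A solution on the whole time axis (a trajectory). -/
def IsSolution (f : ℝ → ℝ → ℝ) (Λ : ℝ → ℝ) (r : ℝ) (x : ℝ → ℝ) : Prop :=
  ∀ t, HasDerivAt x (f (x t) (Λ (r * t))) t

/-- A solution on `[s, ∞)` that starts at `x₀` at time `s`. -/
def IsSolutionFrom (f : ℝ → ℝ → ℝ) (Λ : ℝ → ℝ) (r s x₀ : ℝ) (x : ℝ → ℝ) : Prop :=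
  x s = x₀ ∧ ∀ t, s ≤ t → HasDerivWithinAt x (f (x t) (Λ (r * t))) (Ici s) t

/-- Solutions exist for all forward times, for every initial condition, every parameter shift
and every rate. -/
def ForwardComplete (f : ℝ → ℝ → ℝ) (lm lp : ℝ) : Prop :=
  ∀ Λ : ℝ → ℝ, IsParameterShift lm lp Λ → ∀ r : ℝ, 0 < r → ∀ s x₀ : ℝ,
    ∃ x : ℝ → ℝ, IsSolutionFrom f Λ r s x₀ x

open Classical in
/-- The solution cocycle `Φ_{t,s}(x₀)` (with a default value if there is no forward solution). -/
def cocycle (f : ℝ → ℝ → ℝ) (Λ : ℝ → ℝ) (r t s x₀ : ℝ) : ℝ :=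
  if h : ∃ x : ℝ → ℝ, IsSolutionFrom f Λ r s x₀ x then h.choose t else 0

/-- A (local) pullback attractor. -/
def IsPullbackAttractor (f : ℝ → ℝ → ℝ) (Λ : ℝ → ℝ) (r : ℝ) (x : ℝ → ℝ) : Prop :=
  IsSolution f Λ r x ∧
    ∃ U : Set ℝ, IsOpen U ∧ Bornology.IsBounded U ∧ ∃ T : ℝ, 0 < T ∧
      (∀ t, t < -T → x t ∈ U) ∧
      ∀ y ∈ U, ∀ t : ℝ, Tendsto (fun s => |cocycle f Λ r t (t - s) y - x t|) atTop (𝓝 0)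

/-- `x` is the pullback attractor with past limit `Xm`: it is a pullback attractor, it tends to
`Xm` at `-∞`, and it is the only trajectory that does. -/
structure IsPullbackAttractorFrom (f : ℝ → ℝ → ℝ) (Λ : ℝ → ℝ) (r Xm : ℝ) (x : ℝ → ℝ) : Prop where
  isPullbackAttractor : IsPullbackAttractor f Λ r x
  tendsto_atBot : Tendsto x atBot (𝓝 Xm)
  unique : ∀ z : ℝ → ℝ, IsSolution f Λ r z → Tendsto z atBot (𝓝 Xm) → z = x

/-- `x` end-point tracks a path from `Xm` to `Xp`. -/
def EndpointTracks (x : ℝ → ℝ) (Xm Xp : ℝ) : Prop :=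
  Tendsto x atBot (𝓝 Xm) ∧ Tendsto x atTop (𝓝 Xp)

/-- Irreversible R-tipping from `Xm` on `Λ` with critical limit `Yp`: for all rates below some
`r₀ > 0` the pullback attractor from `Xm` end-point tracks a stable path to `Xp`, and at the rate
`r₀` it tends to `Yp ≠ Xp`. The limit `Yp` is an extended real, so that at the critical rate
escape to infinity is possible. -/
def IrreversibleRTippingTo (f : ℝ → ℝ → ℝ) (lm lp : ℝ) (Λ : ℝ → ℝ) (Xm : ℝ) (Yp : EReal) : Prop :=
  ∃ r₀ : ℝ, 0 < r₀ ∧ ∃ Xp : ℝ, LambdaConnected f lm lp Λ Xm Xp ∧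
    (∀ r, 0 < r → r < r₀ →
      ∃ x : ℝ → ℝ, IsPullbackAttractorFrom f Λ r Xm x ∧ EndpointTracks x Xm Xp) ∧
    Yp ≠ (Xp : EReal) ∧
    ∃ x : ℝ → ℝ, IsPullbackAttractorFrom f Λ r₀ Xm x ∧
      Tendsto (fun t => (x t : EReal)) atTop (𝓝 Yp)

/-- Irreversible R-tipping from `Xm` on `Λ`, the critical limit being finite or infinite. -/
def IrreversibleRTipping (f : ℝ → ℝ → ℝ) (lm lp : ℝ) (Λ : ℝ → ℝ) (Xm : ℝ) : Prop :=
  ∃ Yp : EReal, IrreversibleRTippingTo f lm lp Λ Xm Yp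

end RTip

end

open RTip

noncomputable section

namespace RTip

/-! In the time `s = r t`, with `μ = r⁻¹`, the equation reads `y' = μ f(y, Λ s)`: the shift is fixed
and the rate only scales the field. The state space is one-dimensional, so the whole argument rests
on a comparison principle (`comparison`). Hyperbolicity at `lp` makes every forward solution
converge in `[-∞, ∞]` (`exists_tendsto_ereal`), a finite limit being an equilibrium. Contraction
near `Xm` produces the pullback attractor and its continuous dependence on the rate.

Claim 1. Forward basin stability forces `f > 0` between the running infimum of `X` and `X` itself.
Hence this infimum is an antitone subsolution and stays below the trajectory
(`antitone_le_of_subsolution`). A limit below `Xp` would be approached from below and would be a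
degenerate zero of `f(·, lp)` (`le_limit_of_pos_below`). Reflection in the state gives the other
inequality.

Claims 2 and 3. Slow rates track the branch (`exists_slow_tracking`) and tracking is an open
condition on the rate, so a single non-tracking rate yields a smallest one, the critical rate
(`exists_critical_rate`). In claim 3 a fast rate fails to track, since the state has no time to
leave `Xm` before the parameter is near `lp` (`exists_not_tracksAt`). In claim 2 a shift is built
that lets the state follow `B` up to `Λ u`, jumps to `Λ v`, waits there until the state is close to
`Y`, and then moves slowly along `Y` (`exists_jump_not_tracksAt`).

For a finite critical limit the shift is accelerated close to `lp` (`exists_finite_critical`): the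
trajectory is still bounded when a high and a low level acquire fields of constant sign. Escape
through such a level would be irrevocable, and would already happen at slightly smaller rates, which
track. -/

/-- The partial derivative of `f` in the state variable. -/
def dx (f : ℝ → ℝ → ℝ) (x l : ℝ) : ℝ := deriv (fun y => f y l) x

/-! ### Smoothness of the field: local bounds and contraction tubes. -/

section Regularity

variable {f : ℝ → ℝ → ℝ}

theorem continuous_state (hf : ContDiff ℝ 2 (fun p : ℝ × ℝ => f p.1 p.2)) (l : ℝ) :
    Continuous fun x => f x l :=
  hf.continuous.comp (by fun_prop : Continuous fun x : ℝ => (x, l))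

theorem continuous_param (hf : ContDiff ℝ 2 (fun p : ℝ × ℝ => f p.1 p.2)) (x : ℝ) :
    Continuous fun l => f x l :=
  hf.continuous.comp (by fun_prop : Continuous fun l : ℝ => (x, l))

theorem hasDerivAt_fderiv (hf : ContDiff ℝ 2 (fun p : ℝ × ℝ => f p.1 p.2)) (x l : ℝ) :
    HasDerivAt (fun y => f y l) (fderiv ℝ (fun p : ℝ × ℝ => f p.1 p.2) (x, l) (1, 0)) x := by
  have h1 : HasFDerivAt (fun p : ℝ × ℝ => f p.1 p.2) _ (x, l) :=
    (hf.differentiable (by norm_num) (x, l)).hasFDerivAt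
  have h2 : HasDerivAt (fun y : ℝ => (y, l)) ((1 : ℝ), (0 : ℝ)) x :=
    (hasDerivAt_id x).prodMk (hasDerivAt_const x l)
  exact h1.comp_hasDerivAt x h2

theorem hasDerivAt_dx (hf : ContDiff ℝ 2 (fun p : ℝ × ℝ => f p.1 p.2)) (x l : ℝ) :
    HasDerivAt (fun y => f y l) (dx f x l) x :=
  (hasDerivAt_fderiv hf x l).differentiableAt.hasDerivAt

theorem continuous_dx (hf : ContDiff ℝ 2 (fun p : ℝ × ℝ => f p.1 p.2)) :
    Continuous fun p : ℝ × ℝ => dx f p.1 p.2 := by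
  have h : (fun p : ℝ × ℝ => dx f p.1 p.2) =
      fun p => fderiv ℝ (fun p : ℝ × ℝ => f p.1 p.2) p (1, 0) := by
    funext p
    exact (hasDerivAt_fderiv hf p.1 p.2).deriv
  rw [h]
  exact (hf.continuous_fderiv (by norm_num)).clm_apply continuous_const

theorem exists_lipschitz (hf : ContDiff ℝ 2 (fun p : ℝ × ℝ => f p.1 p.2)) (R l₁ l₂ : ℝ) :
    ∃ L, 0 ≤ L ∧ ∀ x x' l l', |x| ≤ R → |x'| ≤ R → l ∈ Icc l₁ l₂ → l' ∈ Icc l₁ l₂ →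
      |f x l - f x' l'| ≤ L * (|x - x'| + |l - l'|) := by
  obtain ⟨C, hC⟩ := ((isCompact_Icc (a := -R) (b := R)).prod
    (isCompact_Icc (a := l₁) (b := l₂))).exists_bound_of_continuousOn
    (hf.continuous_fderiv (by norm_num)).continuousOn
  refine ⟨max C 0, le_max_right _ _, fun x x' l l' hx hx' hl hl' => ?_⟩
  have h := ((convex_Icc (-R) R).prod (convex_Icc l₁ l₂)).norm_image_sub_le_of_norm_fderiv_le
    (𝕜 := ℝ) (f := fun p : ℝ × ℝ => f p.1 p.2) (C := max C 0) (x := (x', l')) (y := (x, l))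
    (fun p _ => hf.differentiable (by norm_num) p)
    (fun p hp => (hC p hp).trans (le_max_left _ _))
    ⟨abs_le.1 hx', hl'⟩ ⟨abs_le.1 hx, hl⟩
  refine (Real.norm_eq_abs _ ▸ h).trans ?_
  gcongr
  rw [Prod.norm_def]
  simp only [Prod.fst_sub, Prod.snd_sub, Real.norm_eq_abs]
  exact max_le (le_add_of_nonneg_right (abs_nonneg _)) (le_add_of_nonneg_left (abs_nonneg _))

theorem exists_bound (hf : ContDiff ℝ 2 (fun p : ℝ × ℝ => f p.1 p.2)) (R l₁ l₂ : ℝ) :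
    ∃ F, 0 < F ∧ ∀ x l, |x| ≤ R → l ∈ Icc l₁ l₂ → |f x l| ≤ F := by
  obtain ⟨C, hC⟩ := ((isCompact_Icc (a := -R) (b := R)).prod
    (isCompact_Icc (a := l₁) (b := l₂))).exists_bound_of_continuousOn hf.continuous.continuousOn
  exact ⟨max C 1, by positivity, fun x l hx hl =>
    (hC (x, l) ⟨abs_le.1 hx, hl⟩).trans (le_max_left _ _)⟩

/-- A one-sided bound on the derivative gives strong monotonicity. -/
theorem sub_le_of_dx_le (hf : ContDiff ℝ 2 (fun p : ℝ × ℝ => f p.1 p.2)) {l c x y : ℝ}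
    (hxy : x ≤ y) (h : ∀ z ∈ Icc x y, dx f z l ≤ -c) : f y l - f x l ≤ -c * (y - x) :=
  (convex_Icc x y).image_sub_le_mul_sub_of_deriv_le (continuous_state hf l).continuousOn
    (fun z _ => (hasDerivAt_dx hf z l).differentiableAt.differentiableWithinAt)
    (fun z hz => h z (interior_subset hz)) x (left_mem_Icc.2 hxy) y (right_mem_Icc.2 hxy) hxy

theorem exists_dx_le (hf : ContDiff ℝ 2 (fun p : ℝ × ℝ => f p.1 p.2)) {x₀ l₀ : ℝ}
    (h : dx f x₀ l₀ < 0) :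
    ∃ δ c, 0 < δ ∧ 0 < c ∧ ∀ x l, |x - x₀| ≤ δ → |l - l₀| ≤ δ → dx f x l ≤ -c := by
  have hc : 0 < -dx f x₀ l₀ / 2 := by linarith
  have h1 : ∀ᶠ p : ℝ × ℝ in 𝓝 (x₀, l₀), dx f p.1 p.2 < -(-dx f x₀ l₀ / 2) :=
    (continuous_dx hf).continuousAt.eventually_lt continuousAt_const
      (show dx f x₀ l₀ < _ by linarith)
  obtain ⟨ε, hε, h2⟩ := Metric.eventually_nhds_iff.1 h1
  refine ⟨ε / 2, _, by positivity, hc, fun x l hx hl => (h2 (y := (x, l)) ?_).le⟩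
  rw [Prod.dist_eq, Real.dist_eq, Real.dist_eq]
  exact max_lt (by linarith) (by linarith)

/-- A uniform contraction tube around a compact curve of linearly stable states. -/
theorem exists_tube (hf : ContDiff ℝ 2 (fun p : ℝ × ℝ => f p.1 p.2)) {a b : ℝ} {B : ℝ → ℝ}
    (hB : ContinuousOn B (Icc a b)) (h : ∀ l ∈ Icc a b, dx f (B l) l < 0) :
    ∃ δ c, 0 < δ ∧ 0 < c ∧ ∀ l ∈ Icc a b, ∀ x, |x - B l| ≤ δ → dx f x l ≤ -c := by
  set K : Set (ℝ × ℝ) := (fun l => (B l, l)) '' Icc a b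
  have hK : IsCompact K := isCompact_Icc.image_of_continuousOn (hB.prodMk continuousOn_id)
  have hU : IsOpen {p : ℝ × ℝ | dx f p.1 p.2 < 0} :=
    isOpen_lt (continuous_dx hf) continuous_const
  obtain ⟨δ, hδ, hsub⟩ := hK.exists_cthickening_subset_open hU (by
    rintro _ ⟨l, hl, rfl⟩
    exact h l hl)
  have hmem : ∀ l ∈ Icc a b, ∀ x, |x - B l| ≤ δ → (x, l) ∈ Metric.cthickening δ K := by
    intro l hl x hx
    refine Metric.mem_cthickening_of_dist_le (x, l) (B l, l) δ K ⟨l, hl, rfl⟩ ?_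
    rw [Prod.dist_eq, Real.dist_eq, dist_self]
    exact max_le hx hδ.le
  rcases (Metric.cthickening δ K).eq_empty_or_nonempty with he | hne
  · refine ⟨δ, 1, hδ, one_pos, fun l hl x hx => ?_⟩
    have := hmem l hl x hx
    rw [he] at this
    exact this.elim
  · obtain ⟨p, hp, hmax⟩ := hK.cthickening.exists_isMaxOn hne (continuous_dx hf).continuousOn
    have hp' : dx f p.1 p.2 < 0 := hsub hp
    refine ⟨δ, -dx f p.1 p.2, hδ, by linarith, fun l hl x hx => ?_⟩
    have := hmax (hmem l hl x hx)
    simpa using this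

end Regularity

/-! ### Comparison principle for one-sided differential inequalities. -/

section Comparison

/-- Differential inequality `y' ≤ G t y` at the time `t`, to the right. -/
def SubAt (G : ℝ → ℝ → ℝ) (y : ℝ → ℝ) (t : ℝ) : Prop :=
  ∀ ε, 0 < ε → ∀ᶠ t' in 𝓝[>] t, y t' ≤ y t + (G t (y t) + ε) * (t' - t)

/-- Differential inequality `y' ≥ G t y` at the time `t`, to the right. -/
def SuperAt (G : ℝ → ℝ → ℝ) (y : ℝ → ℝ) (t : ℝ) : Prop :=
  ∀ ε, 0 < ε → ∀ᶠ t' in 𝓝[>] t, y t + (G t (y t) - ε) * (t' - t) ≤ y t'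

theorem eventually_slope {y : ℝ → ℝ} {t d : ℝ} (h : HasDerivWithinAt y d (Ici t) t) {ε : ℝ}
    (hε : 0 < ε) : ∀ᶠ t' in 𝓝[>] t, |y t' - y t - d * (t' - t)| ≤ ε * (t' - t) := by
  have h1 := (hasDerivWithinAt_iff_isLittleO.1 (h.mono Ioi_subset_Ici_self)).def hε
  filter_upwards [h1, self_mem_nhdsWithin] with t' ht' (hlt : t < t')
  rw [Real.norm_eq_abs, Real.norm_eq_abs, abs_of_pos (sub_pos.2 hlt), smul_eq_mul] at ht'
  rwa [mul_comm d]

theorem SubAt.of_deriv {G : ℝ → ℝ → ℝ} {y : ℝ → ℝ} {t d : ℝ}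
    (h : HasDerivWithinAt y d (Ici t) t) (hd : d ≤ G t (y t)) : SubAt G y t := by
  intro ε hε
  filter_upwards [eventually_slope h hε, self_mem_nhdsWithin] with t' ht' (hlt : t < t')
  have h1 := (abs_le.1 ht').2
  nlinarith [mul_le_mul_of_nonneg_right hd (sub_pos.2 hlt).le]

theorem SuperAt.of_deriv {G : ℝ → ℝ → ℝ} {y : ℝ → ℝ} {t d : ℝ}
    (h : HasDerivWithinAt y d (Ici t) t) (hd : G t (y t) ≤ d) : SuperAt G y t := by
  intro ε hε
  filter_upwards [eventually_slope h hε, self_mem_nhdsWithin] with t' ht' (hlt : t < t')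
  have h1 := (abs_le.1 ht').1
  nlinarith [mul_le_mul_of_nonneg_right hd (sub_pos.2 hlt).le]

/-- Only right-hand slopes enter, so kinked functions and merely monotone ones can serve as
barriers. The proof raises `z` by the exponential `η exp((L+1)(t-a))`, propagates the inequality to
the right by continuous induction, and lets `η → 0`. -/
theorem comparison {G : ℝ → ℝ → ℝ} {y z : ℝ → ℝ} {a b : ℝ}
    (hG : ∀ R, ∃ L, 0 ≤ L ∧ ∀ t ∈ Icc a b, ∀ x x', |x| ≤ R → |x'| ≤ R →
      |G t x - G t x'| ≤ L * |x - x'|)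
    (hy : ContinuousOn y (Icc a b)) (hz : ContinuousOn z (Icc a b))
    (hsub : ∀ t ∈ Ico a b, SubAt G y t) (hsup : ∀ t ∈ Ico a b, SuperAt G z t)
    (h0 : y a ≤ z a) : ∀ t ∈ Icc a b, y t ≤ z t := by
  obtain ⟨R₁, hR₁⟩ := isCompact_Icc.exists_bound_of_continuousOn hy
  obtain ⟨R₂, hR₂⟩ := isCompact_Icc.exists_bound_of_continuousOn hz
  obtain ⟨L, hL0, hL⟩ := hG (max R₁ R₂)
  have key : ∀ η, 0 < η → ∀ t ∈ Icc a b, y t - z t - η * Real.exp ((L + 1) * (t - a)) ≤ 0 := by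
    intro η hη
    set h : ℝ → ℝ := fun t => y t - z t - η * Real.exp ((L + 1) * (t - a))
    have hcont : ContinuousOn h (Icc a b) :=
      (hy.sub hz).sub (Continuous.continuousOn (by fun_prop))
    have hcl : IsClosed ({t | h t ≤ 0} ∩ Icc a b) := by
      rw [inter_comm]
      exact hcont.preimage_isClosed_of_isClosed isClosed_Icc isClosed_Iic
    rcases lt_or_ge b a with hba | hab
    · intro t ht
      exact absurd (ht.1.trans ht.2) (not_le.2 hba)
    refine fun t ht => hcl.Icc_subset_of_forall_mem_nhdsWithin ?_ ?_ ht
    · change y a - z a - η * Real.exp ((L + 1) * (a - a)) ≤ 0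
      have := mul_pos hη (Real.exp_pos ((L + 1) * (a - a)))
      linarith
    · rintro t ⟨ht0, ht⟩
      rcases (show h t ≤ 0 from ht0).lt_or_eq with hlt | heq
      · have h1 : ContinuousWithinAt h (Ioi t) t :=
          ((hcont t (Ico_subset_Icc_self ht)).mono_of_mem_nhdsWithin
            (Icc_mem_nhdsGT_of_mem ht))
        filter_upwards [h1.eventually_lt continuousWithinAt_const hlt] with s hs using hs.le
      · set w := η * Real.exp ((L + 1) * (t - a)) with hw
        have hwpos : 0 < w := by positivity
        have hyz : y t - z t = w := by
          have : y t - z t - w = 0 := heq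
          linarith
        have ht' := Ico_subset_Icc_self ht
        have hGL : G t (y t) - G t (z t) ≤ L * w := by
          have := hL t ht' (y t) (z t) ((hR₁ t ht').trans (le_max_left _ _))
            ((hR₂ t ht').trans (le_max_right _ _))
          rw [hyz, abs_of_pos hwpos] at this
          exact (le_abs_self _).trans this
        -- The exponent `L + 1` exceeds the Lipschitz growth `L` by one, a surplus slope `w` that
        -- pays for the two errors `w / 2`.
        filter_upwards [hsub t ht (w / 2) (by positivity), hsup t ht (w / 2) (by positivity),
          self_mem_nhdsWithin] with s hs1 hs2 (hs : t < s)
        have hexp : w * (1 + (L + 1) * (s - t)) ≤ η * Real.exp ((L + 1) * (s - a)) := by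
          have e : Real.exp ((L + 1) * (s - a)) =
              Real.exp ((L + 1) * (t - a)) * Real.exp ((L + 1) * (s - t)) := by
            rw [← Real.exp_add]; ring_nf
          rw [e, ← mul_assoc, ← hw]
          gcongr
          linarith [Real.add_one_le_exp ((L + 1) * (s - t))]
        change y s - z s - η * Real.exp ((L + 1) * (s - a)) ≤ 0
        have h3 : (G t (y t) - G t (z t)) * (s - t) ≤ L * w * (s - t) := by
          gcongr
        nlinarith
  intro t ht
  refine le_of_forall_pos_le_add fun ε hε => ?_
  have := key (ε / Real.exp ((L + 1) * (t - a))) (by positivity) t ht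
  rw [div_mul_cancel₀ _ (Real.exp_pos _).ne'] at this
  linarith

/-- Comparison for the equation `y' = μ f(y, Λ s)`. -/
theorem comparison_field {f : ℝ → ℝ → ℝ} (hf : ContDiff ℝ 2 (fun p : ℝ × ℝ => f p.1 p.2))
    {Λ : ℝ → ℝ} (hΛ : Continuous Λ) {μ : ℝ} {y z : ℝ → ℝ} {a b : ℝ}
    (hy : ContinuousOn y (Icc a b)) (hz : ContinuousOn z (Icc a b))
    (hsub : ∀ t ∈ Ico a b, SubAt (fun s x => μ * f x (Λ s)) y t)
    (hsup : ∀ t ∈ Ico a b, SuperAt (fun s x => μ * f x (Λ s)) z t)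
    (h0 : y a ≤ z a) : ∀ t ∈ Icc a b, y t ≤ z t := by
  refine comparison (fun R => ?_) hy hz hsub hsup h0
  obtain ⟨C, hC⟩ := (isCompact_Icc (a := a) (b := b)).exists_bound_of_continuousOn hΛ.continuousOn
  obtain ⟨L, hL0, hL⟩ := exists_lipschitz hf R (-C) C
  refine ⟨|μ| * L, by positivity, fun t ht x x' hx hx' => ?_⟩
  have hl : Λ t ∈ Icc (-C) C := abs_le.1 (hC t ht)
  have := hL x x' (Λ t) (Λ t) hx hx' hl hl
  rw [sub_self, abs_zero, add_zero] at this
  rw [← mul_sub, abs_mul, mul_assoc]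
  gcongr

end Comparison

/-! ### Solutions on compact intervals: invariance, dependence on data, contraction. -/

/-- `y` solves `y' = μ f(y, Λ s)` on `[a, b]`, in the sense of right derivatives. -/
structure SolOn (f : ℝ → ℝ → ℝ) (Λ : ℝ → ℝ) (μ a b : ℝ) (y : ℝ → ℝ) : Prop where
  cont : ContinuousOn y (Icc a b)
  deriv : ∀ s ∈ Ico a b, HasDerivWithinAt y (μ * f (y s) (Λ s)) (Ici s) s

namespace SolOn

variable {f : ℝ → ℝ → ℝ} {Λ Λ' : ℝ → ℝ} {μ a b : ℝ} {y z : ℝ → ℝ}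

theorem mono (h : SolOn f Λ μ a b y) {a' b' : ℝ} (ha : a ≤ a') (hb : b' ≤ b) :
    SolOn f Λ μ a' b' y :=
  ⟨h.cont.mono (Icc_subset_Icc ha hb), fun s hs => h.deriv s (Ico_subset_Ico ha hb hs)⟩

theorem congr_param (h : SolOn f Λ μ a b y) (hΛ : ∀ s ∈ Ico a b, Λ s = Λ' s) :
    SolOn f Λ' μ a b y :=
  ⟨h.cont, fun s hs => hΛ s hs ▸ h.deriv s hs⟩

theorem of_hasDerivAt (h : ∀ t, HasDerivAt y (μ * f (y t) (Λ t)) t) (a b : ℝ) :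
    SolOn f Λ μ a b y :=
  ⟨fun t _ => (h t).continuousAt.continuousWithinAt, fun s _ => (h s).hasDerivWithinAt⟩

theorem subAt (h : SolOn f Λ μ a b y) {t : ℝ} (ht : t ∈ Ico a b) :
    SubAt (fun s x => μ * f x (Λ s)) y t := .of_deriv (h.deriv t ht) le_rfl

theorem superAt (h : SolOn f Λ μ a b y) {t : ℝ} (ht : t ∈ Ico a b) :
    SuperAt (fun s x => μ * f x (Λ s)) y t := .of_deriv (h.deriv t ht) le_rfl

theorem unique (hf : ContDiff ℝ 2 (fun p : ℝ × ℝ => f p.1 p.2)) (hΛ : Continuous Λ)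
    (hy : SolOn f Λ μ a b y) (hz : SolOn f Λ μ a b z) (h : y a = z a) :
    ∀ t ∈ Icc a b, y t = z t := fun t ht =>
  le_antisymm
    (comparison_field hf hΛ hy.cont hz.cont (fun _ => hy.subAt) (fun _ => hz.superAt) h.le t ht)
    (comparison_field hf hΛ hz.cont hy.cont (fun _ => hz.subAt) (fun _ => hy.superAt) h.ge t ht)

theorem le_const (hf : ContDiff ℝ 2 (fun p : ℝ × ℝ => f p.1 p.2)) (hΛ : Continuous Λ)
    (hμ : 0 ≤ μ) (hy : SolOn f Λ μ a b y) {N : ℝ} (hN : ∀ s ∈ Ico a b, f N (Λ s) ≤ 0)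
    (h : y a ≤ N) : ∀ t ∈ Icc a b, y t ≤ N :=
  comparison_field (z := fun _ => N) hf hΛ hy.cont continuousOn_const (fun _ => hy.subAt)
    (fun t ht => .of_deriv (hasDerivWithinAt_const t _ N)
      (mul_nonpos_of_nonneg_of_nonpos hμ (hN t ht))) h

theorem const_le (hf : ContDiff ℝ 2 (fun p : ℝ × ℝ => f p.1 p.2)) (hΛ : Continuous Λ)
    (hμ : 0 ≤ μ) (hy : SolOn f Λ μ a b y) {N : ℝ} (hN : ∀ s ∈ Ico a b, 0 ≤ f N (Λ s))
    (h : N ≤ y a) : ∀ t ∈ Icc a b, N ≤ y t :=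
  comparison_field (y := fun _ => N) hf hΛ continuousOn_const hy.cont
    (fun t ht => .of_deriv (hasDerivWithinAt_const t _ N) (mul_nonneg hμ (hN t ht)))
    (fun _ => hy.superAt) h

theorem mem_Icc (hf : ContDiff ℝ 2 (fun p : ℝ × ℝ => f p.1 p.2)) (hΛ : Continuous Λ)
    (hμ : 0 ≤ μ) (hy : SolOn f Λ μ a b y) {α β : ℝ} (hα : ∀ s ∈ Ico a b, 0 ≤ f α (Λ s))
    (hβ : ∀ s ∈ Ico a b, f β (Λ s) ≤ 0)
    (h : y a ∈ Icc α β) : ∀ t ∈ Icc a b, y t ∈ Icc α β := fun t ht =>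
  ⟨hy.const_le hf hΛ hμ hα h.1 t ht, hy.le_const hf hΛ hμ hβ h.2 t ht⟩

theorem hasDerivWithinAt_line (κ c t₀ t : ℝ) (s : Set ℝ) :
    HasDerivWithinAt (fun t => c + κ * (t - t₀)) κ s t := by
  have := (((hasDerivAt_id t).sub_const t₀).const_mul κ).const_add c
  simpa using this.hasDerivWithinAt

theorem add_le_of_le_deriv (hy : SolOn f Λ μ a b y) {κ : ℝ}
    (h : ∀ s ∈ Ico a b, κ ≤ μ * f (y s) (Λ s)) : ∀ t ∈ Icc a b, y a + κ * (t - a) ≤ y t :=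
  comparison (G := fun _ _ => κ) (fun _ => ⟨0, le_rfl, by simp⟩)
    (Continuous.continuousOn (by fun_prop)) hy.cont
    (fun t _ => .of_deriv (hasDerivWithinAt_line κ (y a) a t _) le_rfl)
    (fun t ht => .of_deriv (hy.deriv t ht) (h t ht)) (by simp)

/-- The symmetry `x ↦ -x` turns lower bounds into upper bounds, so that later arguments need only
one side. -/
theorem refl_sol (hy : SolOn f Λ μ a b y) :
    SolOn (fun x l => -f (-x) l) Λ μ a b (fun t => -y t) :=
  ⟨hy.cont.neg, fun s hs => by
    simp only [neg_neg, mul_neg]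
    exact (hy.deriv s hs).neg⟩

theorem continuous_dependence (hf : ContDiff ℝ 2 (fun p : ℝ × ℝ => f p.1 p.2))
    (hΛ : Continuous Λ) (hz : SolOn f Λ μ a b z) {ε : ℝ} (hε : 0 < ε) :
    ∃ η, 0 < η ∧ ∀ μ' y, SolOn f Λ μ' a b y → |μ' - μ| ≤ η → |y a - z a| ≤ η →
      ∀ t ∈ Icc a b, |y t - z t| ≤ ε := by
  obtain ⟨C, hC⟩ := (isCompact_Icc (a := a) (b := b)).exists_bound_of_continuousOn hΛ.continuousOn
  obtain ⟨R, hR⟩ := isCompact_Icc.exists_bound_of_continuousOn hz.cont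
  obtain ⟨L, hL0, hL⟩ := exists_lipschitz hf (R + 1) (-C) C
  obtain ⟨F, hF0, hF⟩ := exists_bound hf (R + 1) (-C) C
  -- The barriers are `z ± w` with `w' = k w`: the part `|μ| L` is the Lipschitz growth and the
  -- extra `1` absorbs the error `|μ' - μ| F ≤ w₀ ≤ w`. The value `w₀` is chosen to give `w b = e`,
  -- and `e ≤ 1` keeps the barriers inside the ball of radius `R + 1`.
  set k := |μ| * L + 1
  have hk : 0 < k := by positivity
  set e := min ε 1
  have he : 0 < e := lt_min hε one_pos
  set w₀ := e * Real.exp (-(k * (b - a)))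
  have hw₀ : 0 < w₀ := by positivity
  set w : ℝ → ℝ := fun t => w₀ * Real.exp (k * (t - a))
  have hwc : Continuous w := by fun_prop
  have hw_le : ∀ t ∈ Icc a b, w t ≤ e := by
    intro t ht
    change e * Real.exp (-(k * (b - a))) * Real.exp (k * (t - a)) ≤ e
    rw [mul_assoc, ← Real.exp_add]
    refine mul_le_of_le_one_right he.le (Real.exp_le_one_iff.2 ?_)
    nlinarith [ht.2]
  have hw_ge : ∀ t ∈ Icc a b, w₀ ≤ w t := fun t ht =>
    le_mul_of_one_le_right hw₀.le (Real.one_le_exp (mul_nonneg hk.le (sub_nonneg.2 ht.1)))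
  have hwd : ∀ t s, HasDerivWithinAt w (k * w t) s t := by
    intro t s
    have h1 := ((((hasDerivAt_id t).sub_const a).const_mul k).exp.const_mul w₀)
    refine (h1.congr_deriv ?_).hasDerivWithinAt
    simp only [id_eq, mul_one, w]
    ring
  refine ⟨w₀ / (F + 1), by positivity, fun μ' y hy hμ h0 => ?_⟩
  have hηF : |μ' - μ| * F ≤ w₀ := by
    calc |μ' - μ| * F ≤ w₀ / (F + 1) * (F + 1) := by gcongr; linarith
      _ = w₀ := div_mul_cancel₀ _ (by positivity)
  have h0' : |y a - z a| ≤ w₀ := h0.trans (div_le_self hw₀.le (by linarith))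
  have est : ∀ t ∈ Icc a b, ∀ x, |x - z t| = w t →
      |μ' * f x (Λ t) - μ * f (z t) (Λ t)| ≤ k * w t := by
    intro t ht x hx
    have hz1 : |z t| ≤ R := hR t ht
    have hw1 := (hw_le t ht).trans (min_le_right _ _)
    have hx1 : |x| ≤ R + 1 := by
      have := abs_add_le (x - z t) (z t)
      rw [sub_add_cancel] at this
      linarith
    have hl : Λ t ∈ Icc (-C) C := abs_le.1 (hC t ht)
    have h1 := hL x (z t) _ _ hx1 (hz1.trans (by linarith)) hl hl
    rw [sub_self, abs_zero, add_zero, hx] at h1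
    have h2 := hF x _ hx1 hl
    have h3 : μ' * f x (Λ t) - μ * f (z t) (Λ t) =
      (μ' - μ) * f x (Λ t) + μ * (f x (Λ t) - f (z t) (Λ t)) := by ring
    rw [h3]
    refine (abs_add_le _ _).trans ?_
    rw [abs_mul, abs_mul]
    have h4 : |μ' - μ| * |f x (Λ t)| ≤ |μ' - μ| * F := by gcongr
    have h5 : |μ| * |f x (Λ t) - f (z t) (Λ t)| ≤ |μ| * (L * w t) := by gcongr
    have h6 := hw_ge t ht
    change _ ≤ (|μ| * L + 1) * w t
    linarith
  have hwa : w a = w₀ := by simp [w]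
  have hwpos : ∀ t, 0 < w t := fun t => by positivity
  intro t ht
  have hab : a ≤ b := ht.1.trans ht.2
  have up : y t ≤ z t + w t := by
    refine comparison_field (z := fun t => z t + w t) hf hΛ hy.cont
      (hz.cont.add hwc.continuousOn) (fun _ => hy.subAt) (fun s hs => ?_) ?_ t ht
    · refine .of_deriv ((hz.deriv s hs).add (hwd s _)) ?_
      have := (abs_le.1 (est s (Ico_subset_Icc_self hs) (z s + w s)
        (by rw [add_sub_cancel_left, abs_of_pos (hwpos s)]))).2
      linarith
    · have := (abs_le.1 h0').2
      rw [hwa]; linarith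
  have lo : z t - w t ≤ y t := by
    refine comparison_field (y := fun t => z t - w t) hf hΛ (hz.cont.sub hwc.continuousOn)
      hy.cont (fun s hs => ?_) (fun _ => hy.superAt) ?_ t ht
    · refine .of_deriv ((hz.deriv s hs).sub (hwd s _)) ?_
      have := (abs_le.1 (est s (Ico_subset_Icc_self hs) (z s - w s)
        (by rw [sub_sub_cancel_left, abs_neg, abs_of_pos (hwpos s)]))).1
      linarith
    · have := (abs_le.1 h0').1
      rw [hwa]; linarith
  have h7 := (hw_le t ht).trans (min_le_left _ _)
  exact abs_le.2 ⟨by linarith, by linarith⟩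

/-- Contraction in a region where the field is uniformly decreasing in the state. -/
theorem contraction (hf : ContDiff ℝ 2 (fun p : ℝ × ℝ => f p.1 p.2))
    (hΛ : Continuous Λ) (hμ : 0 ≤ μ) {x₀ δ c : ℝ}
    (hc : ∀ s ∈ Icc a b, ∀ x, |x - x₀| ≤ 3 * δ → dx f x (Λ s) ≤ -c) (hc0 : 0 ≤ c)
    (hy : SolOn f Λ μ a b y) (hz : SolOn f Λ μ a b z)
    (hyδ : ∀ s ∈ Icc a b, |y s - x₀| ≤ δ) (hzδ : ∀ s ∈ Icc a b, |z s - x₀| ≤ δ) {w₀ : ℝ}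
    (hw : w₀ ≤ 2 * δ) (h0 : |y a - z a| ≤ w₀) :
    ∀ t ∈ Icc a b, |y t - z t| ≤ w₀ * Real.exp (-(μ * c * (t - a))) := by
  have hw0 : 0 ≤ w₀ := (abs_nonneg _).trans h0
  set w : ℝ → ℝ := fun t => w₀ * Real.exp (-(μ * c * (t - a)))
  have hwc : Continuous w := by fun_prop
  have hwd : ∀ t s, HasDerivWithinAt w (-(μ * c * w t)) s t := by
    intro t s
    have h1 := ((((hasDerivAt_id t).sub_const a).const_mul (μ * c)).neg.exp.const_mul w₀)
    refine (h1.congr_deriv ?_).hasDerivWithinAt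
    simp only [Pi.neg_apply, id_eq, mul_one, w]
    ring
  have hwa : w a = w₀ := by simp [w]
  have hwpos : ∀ t, 0 ≤ w t := fun t => by positivity
  -- The barrier `z + w` lies within `δ + 2δ` of `x₀`, which is why the derivative bound is required
  -- up to distance `3δ`.
  have hw_le : ∀ t ∈ Icc a b, w t ≤ 2 * δ := fun t ht => by
    refine (mul_le_of_le_one_right hw0 (Real.exp_le_one_iff.2 ?_)).trans hw
    have : 0 ≤ μ * c * (t - a) := mul_nonneg (mul_nonneg hμ hc0) (sub_nonneg.2 ht.1)
    linarith
  have main : ∀ {y z : ℝ → ℝ}, SolOn f Λ μ a b y → SolOn f Λ μ a b z →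
      (∀ s ∈ Icc a b, |z s - x₀| ≤ δ) → y a - z a ≤ w₀ →
      ∀ t ∈ Icc a b, y t ≤ z t + w t := by
    intro y z hy hz hzδ h0
    refine comparison_field (z := fun t => z t + w t) hf hΛ hy.cont
      (hz.cont.add hwc.continuousOn) (fun _ => hy.subAt) (fun s hs => ?_) (by rw [hwa]; linarith)
    refine .of_deriv ((hz.deriv s hs).add (hwd s _)) ?_
    have hs' := Ico_subset_Icc_self hs
    have h1 := sub_le_of_dx_le hf (l := Λ s) (c := c)
      (le_add_of_nonneg_right (hwpos s) : z s ≤ z s + w s) (fun v hv => hc s hs' v (by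
        have h2 := abs_le.1 (hzδ s hs')
        have h3 := hw_le s hs'
        exact abs_le.2 ⟨by linarith [hv.1], by linarith [hv.2]⟩))
    rw [add_sub_cancel_left] at h1
    have := mul_le_mul_of_nonneg_left h1 hμ
    change μ * f (z s + w s) (Λ s) ≤ _
    linarith
  intro t ht
  have h1 := main hy hz hzδ (abs_le.1 h0).2 t ht
  have h2 := main hz hy hyδ (by linarith [(abs_le.1 h0).1]) t ht
  exact abs_le.2 ⟨by linarith, by linarith⟩

end SolOn

/-! ### Forward limits when the limiting system is hyperbolic. -/

section Limits

variable {f : ℝ → ℝ → ℝ} {Λ : ℝ → ℝ} {μ a l : ℝ} {y : ℝ → ℝ}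

/-- A field vanishing on an open interval has zero derivative there, so its zeros would not be
hyperbolic. -/
theorem exists_ne_zero_of_hyperbolic
    (hb : ∀ x, f x l = 0 → dx f x l ≠ 0) {u v : ℝ} (huv : u < v) :
    ∃ x ∈ Ioo u v, f x l ≠ 0 := by
  by_contra! h
  obtain ⟨x, hx⟩ := nonempty_Ioo.2 huv
  refine hb x (h x hx) ?_
  have : (fun y => f y l) =ᶠ[𝓝 x] fun _ => 0 := by
    filter_upwards [isOpen_Ioo.mem_nhds hx] with y hy using h y hy
  change deriv _ x = 0
  rw [this.deriv_eq, deriv_const]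

/-- A level at which the limiting field does not vanish is eventually crossed in one direction
only. -/
theorem eventually_level (hf : ContDiff ℝ 2 (fun p : ℝ × ℝ => f p.1 p.2)) (hΛ : Continuous Λ)
    (hl : Tendsto Λ atTop (𝓝 l)) (hμ : 0 ≤ μ) (hy : ∀ b, SolOn f Λ μ a b y) {N : ℝ}
    (hN : f N l ≠ 0) : (∀ᶠ s in atTop, y s ≤ N) ∨ (∀ᶠ s in atTop, N ≤ y s) := by
  have hlim : Tendsto (fun s => f N (Λ s)) atTop (𝓝 (f N l)) :=
    ((continuous_param hf N).tendsto l).comp hl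
  rcases hN.lt_or_gt with h | h
  · obtain ⟨S, hS⟩ := eventually_atTop.1 (hlim.eventually_lt_const h)
    by_cases hc : ∀ s ≥ max S a, N ≤ y s
    · exact .inr (eventually_atTop.2 ⟨_, hc⟩)
    · push Not at hc
      obtain ⟨s, hs, hlt⟩ := hc
      refine .inl (eventually_atTop.2 ⟨s, fun t ht => ?_⟩)
      exact ((hy t).mono ((le_max_right _ _).trans hs) le_rfl).le_const hf hΛ hμ
        (fun r hr => (hS r ((le_max_left _ _).trans (hs.trans hr.1))).le) hlt.le t ⟨ht, le_rfl⟩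
  · obtain ⟨S, hS⟩ := eventually_atTop.1 (hlim.eventually_const_lt h)
    by_cases hc : ∀ s ≥ max S a, y s ≤ N
    · exact .inl (eventually_atTop.2 ⟨_, hc⟩)
    · push Not at hc
      obtain ⟨s, hs, hlt⟩ := hc
      refine .inr (eventually_atTop.2 ⟨s, fun t ht => ?_⟩)
      exact ((hy t).mono ((le_max_right _ _).trans hs) le_rfl).const_le hf hΛ hμ
        (fun r hr => (hS r ((le_max_left _ _).trans (hs.trans hr.1))).le) hlt.le t ⟨ht, le_rfl⟩

/-- Between any two values lies a level at which the limiting field is nonzero. By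
`eventually_level` it is eventually crossed in one direction only, so no interval is upcrossed
infinitely often. -/
theorem exists_tendsto_ereal (hf : ContDiff ℝ 2 (fun p : ℝ × ℝ => f p.1 p.2)) (hΛ : Continuous Λ)
    (hl : Tendsto Λ atTop (𝓝 l)) (hb : ∀ x, f x l = 0 → dx f x l ≠ 0) (hμ : 0 ≤ μ)
    (hy : ∀ b, SolOn f Λ μ a b y) :
    ∃ Z : EReal, Tendsto (fun s => (y s : EReal)) atTop (𝓝 Z) := by
  refine tendsto_of_no_upcrossings dense_univ ?_
  rintro u - v - huv ⟨h1, h2⟩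
  obtain ⟨p, hup, hpv⟩ := EReal.lt_iff_exists_real_btwn.1 huv
  obtain ⟨q, hpq, hqv⟩ := EReal.lt_iff_exists_real_btwn.1 hpv
  obtain ⟨N, hN, hN0⟩ := exists_ne_zero_of_hyperbolic hb (EReal.coe_lt_coe_iff.1 hpq)
  rcases eventually_level hf hΛ hl hμ hy hN0 with h | h
  · refine h2 (h.mono fun s hs => not_lt.2 ?_)
    exact (EReal.coe_le_coe_iff.2 (hs.trans hN.2.le)).trans hqv.le
  · refine h1 (h.mono fun s hs => not_lt.2 ?_)
    exact hup.le.trans (EReal.coe_le_coe_iff.2 (hN.1.le.trans hs))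

/-- With `f z l > 0` the solution would finally grow at least linearly; `t` is the time at which the
linear lower bound reaches `z + 1`. -/
theorem not_pos_of_tendsto (hf : ContDiff ℝ 2 (fun p : ℝ × ℝ => f p.1 p.2))
    (hl : Tendsto Λ atTop (𝓝 l)) (hμ : 0 < μ)
    (hy : ∀ b, SolOn f Λ μ a b y) {z : ℝ} (hz : Tendsto y atTop (𝓝 z)) : ¬ 0 < f z l := by
  intro h
  have hlim : Tendsto (fun s => f (y s) (Λ s)) atTop (𝓝 (f z l)) :=
    (hf.continuous.tendsto (z, l)).comp (hz.prodMk_nhds hl)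
  obtain ⟨S, hS⟩ := eventually_atTop.1 ((hlim.eventually_const_lt (half_lt_self h)).and
    (hz.eventually_lt_const (lt_add_one z)))
  set s₀ := max S a
  set κ := μ * (f z l / 2)
  have hκ : 0 < κ := by positivity
  set t := s₀ + (z + 1 - y s₀) / κ
  have ht : s₀ ≤ t := by
    have : 0 ≤ z + 1 - y s₀ := by linarith [(hS s₀ (le_max_left _ _)).2]
    exact le_add_of_nonneg_right (by positivity)
  have h1 := ((hy t).mono (le_max_right S a) le_rfl).add_le_of_le_deriv (κ := κ)
    (fun s hs => mul_le_mul_of_nonneg_left (hS s ((le_max_left _ _).trans hs.1)).1.le hμ.le)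
    t ⟨ht, le_rfl⟩
  have h2 : κ * (t - s₀) = z + 1 - y s₀ := by
    simp only [t, add_sub_cancel_left]
    field_simp
  have h3 := (hS t ((le_max_left _ _).trans ht)).2
  change y s₀ + κ * (t - s₀) ≤ y t at h1
  linarith

theorem refl_contDiff (hf : ContDiff ℝ 2 (fun p : ℝ × ℝ => f p.1 p.2)) :
    ContDiff ℝ 2 (fun p : ℝ × ℝ => (fun x l => -f (-x) l) p.1 p.2) :=
  (hf.comp (contDiff_fst.neg.prodMk contDiff_snd)).neg

theorem dx_refl (hf : ContDiff ℝ 2 (fun p : ℝ × ℝ => f p.1 p.2)) (x l : ℝ) :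
    dx (fun x l => -f (-x) l) x l = dx f (-x) l := by
  have := ((hasDerivAt_dx hf (-x) l).comp x (hasDerivAt_neg x)).neg
  have h2 := this.deriv
  simp only [mul_neg, mul_one, neg_neg] at h2
  exact h2

/-- A finite limit of a solution is an equilibrium of the limiting system. -/
theorem eq_zero_of_tendsto (hf : ContDiff ℝ 2 (fun p : ℝ × ℝ => f p.1 p.2))
    (hl : Tendsto Λ atTop (𝓝 l)) (hμ : 0 < μ)
    (hy : ∀ b, SolOn f Λ μ a b y) {z : ℝ} (hz : Tendsto y atTop (𝓝 z)) : f z l = 0 := by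
  refine le_antisymm (not_lt.1 (not_pos_of_tendsto hf hl hμ hy hz)) (not_lt.1 fun h => ?_)
  refine not_pos_of_tendsto (refl_contDiff hf) hl hμ (fun b => (hy b).refl_sol) hz.neg ?_
  simpa using h

theorem exists_tendsto_of_mem_Icc (hf : ContDiff ℝ 2 (fun p : ℝ × ℝ => f p.1 p.2))
    (hΛ : Continuous Λ) (hl : Tendsto Λ atTop (𝓝 l)) (hb : ∀ x, f x l = 0 → dx f x l ≠ 0)
    (hμ : 0 < μ) (hy : ∀ b, SolOn f Λ μ a b y) {α β : ℝ}
    (h : ∀ᶠ s in atTop, y s ∈ Icc α β) :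
    ∃ z ∈ Icc α β, Tendsto y atTop (𝓝 z) ∧ f z l = 0 := by
  obtain ⟨Z, hZ⟩ := exists_tendsto_ereal hf hΛ hl hb hμ.le hy
  have h1 : (α : EReal) ≤ Z := ge_of_tendsto hZ (h.mono fun s hs => EReal.coe_le_coe_iff.2 hs.1)
  have h2 : Z ≤ (β : EReal) := le_of_tendsto hZ (h.mono fun s hs => EReal.coe_le_coe_iff.2 hs.2)
  lift Z to ℝ using ⟨fun h => by simp [h] at h2, fun h => by simp [h] at h1⟩
  have hz : Tendsto y atTop (𝓝 Z) := EReal.tendsto_coe.1 hZ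
  exact ⟨Z, ⟨EReal.coe_le_coe_iff.1 h1, EReal.coe_le_coe_iff.1 h2⟩, hz,
    eq_zero_of_tendsto hf hl hμ hy hz⟩

end Limits

/-! ### Trajectories emanating from a stable equilibrium at `-∞`. -/

section Past

variable {f : ℝ → ℝ → ℝ} {Λ : ℝ → ℝ} {μ x₀ l₀ S : ℝ} {y z : ℝ → ℝ}

theorem stable_signs (hf : ContDiff ℝ 2 (fun p : ℝ × ℝ => f p.1 p.2)) (h0 : f x₀ l₀ = 0)
    (h : dx f x₀ l₀ < 0) : ∃ ρ₀, 0 < ρ₀ ∧ ∀ ρ, 0 < ρ → ρ ≤ ρ₀ →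
      f (x₀ + ρ) l₀ < 0 ∧ 0 < f (x₀ - ρ) l₀ := by
  obtain ⟨δ, c, hδ, hc, H⟩ := exists_dx_le hf h
  refine ⟨δ, hδ, fun ρ hρ hρδ => ⟨?_, ?_⟩⟩
  · have := sub_le_of_dx_le hf (l := l₀) (c := c) (le_add_of_nonneg_right hρ.le : x₀ ≤ x₀ + ρ)
      (fun v hv => H v l₀ (abs_le.2 ⟨by linarith [hv.1], by linarith [hv.2]⟩) (by simpa using hδ.le))
    rw [h0] at this
    nlinarith
  · have := sub_le_of_dx_le hf (l := l₀) (c := c) (sub_le_self x₀ hρ.le)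
      (fun v hv => H v l₀ (abs_le.2 ⟨by linarith [hv.1], by linarith [hv.2]⟩) (by simpa using hδ.le))
    rw [h0] at this
    nlinarith

theorem exists_early_contraction (hf : ContDiff ℝ 2 (fun p : ℝ × ℝ => f p.1 p.2))
    (hl : Tendsto Λ atBot (𝓝 l₀)) (h : dx f x₀ l₀ < 0) :
    ∃ δ c s₀, 0 < δ ∧ 0 < c ∧ ∀ s ≤ s₀, ∀ x, |x - x₀| ≤ 3 * δ → dx f x (Λ s) ≤ -c := by
  obtain ⟨δ, c, hδ, hc, H⟩ := exists_dx_le hf h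
  obtain ⟨s₀, hs₀⟩ := eventually_atBot.1 (hl.eventually (Metric.ball_mem_nhds l₀ hδ))
  refine ⟨δ / 3, c, s₀, by positivity, hc, fun s hs x hx => H x _ (by linarith) ?_⟩
  have := hs₀ s hs
  rw [Real.dist_eq] at this
  exact this.le

theorem exists_early_signs (hf : ContDiff ℝ 2 (fun p : ℝ × ℝ => f p.1 p.2))
    (hl : Tendsto Λ atBot (𝓝 l₀)) (h0 : f x₀ l₀ = 0) (h : dx f x₀ l₀ < 0) {ε : ℝ} (hε : 0 < ε) :
    ∃ ρ s₀, 0 < ρ ∧ ρ ≤ ε ∧ ∀ s ≤ s₀, f (x₀ + ρ) (Λ s) ≤ 0 ∧ 0 ≤ f (x₀ - ρ) (Λ s) := by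
  obtain ⟨ρ₀, hρ₀, H⟩ := stable_signs hf h0 h
  obtain ⟨h1, h2⟩ := H (min ρ₀ ε) (lt_min hρ₀ hε) (min_le_left _ _)
  have e1 := (((continuous_param hf _).tendsto l₀).comp hl).eventually_lt_const h1
  have e2 := (((continuous_param hf _).tendsto l₀).comp hl).eventually_const_lt h2
  obtain ⟨s₀, hs₀⟩ := eventually_atBot.1 (e1.and e2)
  exact ⟨min ρ₀ ε, s₀, lt_min hρ₀ hε, min_le_right _ _,
    fun s hs => ⟨(hs₀ s hs).1.le, (hs₀ s hs).2.le⟩⟩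

/-- `y` solves `y' = μ f(y, Λ s)` on `(-∞, S]` and tends to `x₀` at `-∞`. -/
structure PastSol (f : ℝ → ℝ → ℝ) (Λ : ℝ → ℝ) (μ x₀ S : ℝ) (y : ℝ → ℝ) : Prop where
  sol : ∀ a b, b ≤ S → SolOn f Λ μ a b y
  tendsto : Tendsto y atBot (𝓝 x₀)

theorem PastSol.exists_near (hy : PastSol f Λ μ x₀ S y) {ε : ℝ} (hε : 0 < ε) :
    ∃ a₀, ∀ a ≤ a₀, |y a - x₀| ≤ ε := by
  obtain ⟨a, ha⟩ := eventually_atBot.1 (hy.tendsto.eventually (Metric.ball_mem_nhds x₀ hε))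
  refine ⟨a, fun s hs => ?_⟩
  have := ha s hs
  rw [Real.dist_eq] at this
  exact this.le

/-- The past limit puts the trajectory inside the interval at some early time, and the signs at its
ends keep it there. The bound `s₀` does not depend on `μ`, hence the estimate is uniform in the
rate. -/
theorem PastSol.tube (hf : ContDiff ℝ 2 (fun p : ℝ × ℝ => f p.1 p.2)) (hΛ : Continuous Λ)
    (hμ : 0 ≤ μ) (hy : PastSol f Λ μ x₀ S y) {ρ s₀ : ℝ} (hρ : 0 < ρ)
    (h : ∀ s ≤ s₀, f (x₀ + ρ) (Λ s) ≤ 0 ∧ 0 ≤ f (x₀ - ρ) (Λ s)) {s : ℝ} (hs₀ : s ≤ s₀)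
    (hS : s ≤ S) : |y s - x₀| ≤ ρ := by
  obtain ⟨a, ha⟩ := hy.exists_near hρ
  have h1 := abs_le.1 (ha (min a s) (min_le_left _ _))
  have h2 := (hy.sol (min a s) s hS).mem_Icc hf hΛ hμ (α := x₀ - ρ) (β := x₀ + ρ)
    (fun r hr => (h r (hr.2.le.trans hs₀)).2) (fun r hr => (h r (hr.2.le.trans hs₀)).1)
    ⟨by linarith, by linarith⟩ s ⟨min_le_right _ _, le_rfl⟩
  exact abs_le.2 ⟨by linarith [h2.1], by linarith [h2.2]⟩

theorem tendsto_mul_exp_atBot {w k : ℝ} (hk : 0 < k) (t : ℝ) :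
    Tendsto (fun a => w * Real.exp (-(k * (t - a)))) atBot (𝓝 0) := by
  have h1 : Tendsto (fun a : ℝ => k * (t - a)) atBot atTop :=
    (tendsto_atTop_add_const_left _ t tendsto_neg_atBot_atTop).const_mul_atTop hk
  simpa using (Real.tendsto_exp_neg_atTop_nhds_zero.comp h1).const_mul w

/-- Both solutions lie in the contraction region for all early times. Contraction over `[a, t]`
bounds their distance at `t` by `2δ exp(-μc(t-a))`, and `a → -∞`. -/
theorem PastSol.unique (hf : ContDiff ℝ 2 (fun p : ℝ × ℝ => f p.1 p.2)) (hΛ : Continuous Λ)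
    (hl : Tendsto Λ atBot (𝓝 l₀)) (h0 : f x₀ l₀ = 0) (h : dx f x₀ l₀ < 0)
    (hμ : 0 < μ) (hy : PastSol f Λ μ x₀ S y) (hz : PastSol f Λ μ x₀ S z) :
    ∀ s ≤ S, y s = z s := by
  obtain ⟨δ, c, s₀, hδ, hc, H⟩ := exists_early_contraction hf hl h
  obtain ⟨ρ, s₁, hρ, hρδ, hs⟩ := exists_early_signs hf hl h0 h hδ
  have early : ∀ t ≤ min S (min s₀ s₁), y t = z t := by
    intro t ht
    have htS : t ≤ S := ht.trans (min_le_left _ _)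
    have ht0 : t ≤ s₀ := ht.trans ((min_le_right _ _).trans (min_le_left _ _))
    have ht1 : t ≤ s₁ := ht.trans ((min_le_right _ _).trans (min_le_right _ _))
    have hyt : ∀ s ≤ t, |y s - x₀| ≤ δ := fun s hst =>
      (hy.tube hf hΛ hμ.le hρ hs (hst.trans ht1) (hst.trans htS)).trans hρδ
    have hzt : ∀ s ≤ t, |z s - x₀| ≤ δ := fun s hst =>
      (hz.tube hf hΛ hμ.le hρ hs (hst.trans ht1) (hst.trans htS)).trans hρδ
    have hb : ∀ a ≤ t, |y t - z t| ≤ 2 * δ * Real.exp (-(μ * c * (t - a))) := by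
      intro a ha
      refine (hy.sol a t htS).contraction hf hΛ hμ.le (x₀ := x₀) (δ := δ) (c := c)
        (fun s hs => H s (hs.2.trans ht0)) hc.le (hz.sol a t htS)
        (fun s hs => hyt s hs.2) (fun s hs => hzt s hs.2) le_rfl ?_ t ⟨ha, le_rfl⟩
      have h1 := abs_le.1 (hyt a ha)
      have h2 := abs_le.1 (hzt a ha)
      exact abs_le.2 ⟨by linarith, by linarith⟩
    have h3 : |y t - z t| ≤ 0 := ge_of_tendsto (tendsto_mul_exp_atBot (mul_pos hμ hc) t)
      (eventually_atBot.2 ⟨t, hb⟩)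
    exact sub_eq_zero.1 (abs_nonpos_iff.1 h3)
  intro s hsS
  set t := min s (min S (min s₀ s₁))
  exact (hy.sol t S le_rfl).unique hf hΛ (hz.sol t S le_rfl) (early t (min_le_right _ _)) s
    ⟨min_le_left _ _, hsS⟩

/-- The trajectory from the past limit `x₀` depends continuously on the time scale `μ`. -/
theorem PastSol.continuous_dependence (hf : ContDiff ℝ 2 (fun p : ℝ × ℝ => f p.1 p.2))
    (hΛ : Continuous Λ) {lm lp : ℝ} (hb : ∀ s, Λ s ∈ Icc lm lp)
    (hl : Tendsto Λ atBot (𝓝 l₀)) (h0 : f x₀ l₀ = 0) (h : dx f x₀ l₀ < 0)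
    (hμ : 0 < μ) (hy : PastSol f Λ μ x₀ S y) {ε : ℝ} (hε : 0 < ε) :
    ∃ η, 0 < η ∧ ∀ μ' z, 0 < μ' → PastSol f Λ μ' x₀ S z → |μ' - μ| ≤ η → |z S - y S| ≤ ε := by
  obtain ⟨δ, c, s₀, hδ, hc, H⟩ := exists_early_contraction hf hl h
  obtain ⟨ρ, s₁, hρ, hρδ, hs⟩ := exists_early_signs hf hl h0 h hδ
  set t := min S (min s₀ s₁)
  have htS : t ≤ S := min_le_left _ _
  have ht0 : t ≤ s₀ := (min_le_right _ _).trans (min_le_left _ _)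
  have ht1 : t ≤ s₁ := (min_le_right _ _).trans (min_le_right _ _)
  obtain ⟨η₁, hη₁, H₁⟩ := (hy.sol t S le_rfl).continuous_dependence hf hΛ hε
  obtain ⟨F, hF0, hF⟩ := exists_bound hf (|x₀| + 3 * δ) lm lp
  set e := min η₁ δ
  have he : 0 < e := lt_min hη₁ hδ
  have heδ : e ≤ δ := min_le_right _ _
  -- For early times `y ± e` are barriers for the equation with `μ'`: the contraction gains `μ c e`,
  -- while changing the time scale costs at most `|μ' - μ| F`. After `t` ordinary continuous
  -- dependence on `[t, S]` takes over.
  refine ⟨min η₁ (μ * c * e / F), lt_min hη₁ (by positivity), fun μ' z hμ' hz hd => ?_⟩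
  have hd1 : |μ' - μ| * F ≤ μ * c * e := by
    rw [← le_div_iff₀ hF0]
    exact hd.trans (min_le_right _ _)
  refine H₁ μ' z (hz.sol t S le_rfl) (hd.trans (min_le_left _ _)) ?_ S ⟨htS, le_rfl⟩
  refine le_trans ?_ (min_le_left η₁ δ)
  obtain ⟨a₁, ha₁⟩ := hy.exists_near (half_pos he)
  obtain ⟨a₂, ha₂⟩ := hz.exists_near (half_pos he)
  set a := min t (min a₁ a₂)
  have hat : a ≤ t := min_le_left _ _
  have hya := abs_le.1 (ha₁ a ((min_le_right _ _).trans (min_le_left _ _)))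
  have hza := abs_le.1 (ha₂ a ((min_le_right _ _).trans (min_le_right _ _)))
  have hysol := hy.sol a t htS
  have hzsol := hz.sol a t htS
  have hyt : ∀ s ≤ t, |y s - x₀| ≤ δ := fun s hst =>
    (hy.tube hf hΛ hμ.le hρ hs (hst.trans ht1) (hst.trans htS)).trans hρδ
  have hbd : ∀ s, ∀ x, |x - x₀| ≤ 3 * δ → |(μ' - μ) * f x (Λ s)| ≤ μ * c * e := by
    intro s x hx
    rw [abs_mul]
    refine le_trans ?_ hd1
    gcongr
    refine hF x _ ?_ (hb s)
    have := abs_add_le (x - x₀) x₀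
    rw [sub_add_cancel] at this
    linarith
  have up : z t ≤ y t + e := by
    refine comparison_field (z := fun t => y t + e) hf hΛ hzsol.cont
      (hysol.cont.add continuousOn_const) (fun _ => hzsol.subAt) (fun s hs => ?_) (by linarith)
      t ⟨hat, le_rfl⟩
    refine .of_deriv ((hysol.deriv s hs).add_const e) ?_
    have h1 := abs_le.1 (hyt s hs.2.le)
    have h2 := sub_le_of_dx_le hf (l := Λ s) (c := c)
      (le_add_of_nonneg_right he.le : y s ≤ y s + e) (fun v hv => H s (hs.2.le.trans ht0) v
        (abs_le.2 ⟨by linarith [hv.1], by linarith [hv.2]⟩))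
    have h3 := (abs_le.1 (hbd s (y s + e) (abs_le.2 ⟨by linarith, by linarith⟩))).2
    have h4 := mul_le_mul_of_nonneg_left h2 hμ.le
    change μ' * f (y s + e) (Λ s) ≤ _
    nlinarith
  have lo : y t - e ≤ z t := by
    refine comparison_field (y := fun t => y t - e) hf hΛ (hysol.cont.sub continuousOn_const)
      hzsol.cont (fun s hs => ?_) (fun _ => hzsol.superAt) (by linarith) t ⟨hat, le_rfl⟩
    refine .of_deriv ((hysol.deriv s hs).sub_const e) ?_
    have h1 := abs_le.1 (hyt s hs.2.le)
    have h2 := sub_le_of_dx_le hf (l := Λ s) (c := c)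
      (sub_le_self _ he.le : y s - e ≤ y s) (fun v hv => H s (hs.2.le.trans ht0) v
        (abs_le.2 ⟨by linarith [hv.1], by linarith [hv.2]⟩))
    have h3 := (abs_le.1 (hbd s (y s - e) (abs_le.2 ⟨by linarith, by linarith⟩))).1
    have h4 := mul_le_mul_of_nonneg_left h2 hμ.le
    change _ ≤ μ' * f (y s - e) (Λ s)
    nlinarith
  exact abs_le.2 ⟨by linarith, by linarith⟩

end Past

/-! ### Existence and uniqueness of the pullback attractor. -/

section Pullback

variable {f : ℝ → ℝ → ℝ} {Λ : ℝ → ℝ} {lm lp r Xm : ℝ}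

theorem IsSolutionFrom.solOn {s x₀ : ℝ} {x : ℝ → ℝ} (h : IsSolutionFrom f Λ r s x₀ x) (b : ℝ) :
    SolOn f (fun t => Λ (r * t)) 1 s b x :=
  ⟨fun t ht => (h.2 t ht.1).continuousWithinAt.mono Icc_subset_Ici_self, fun t ht => by
    rw [one_mul]
    exact (h.2 t ht.1).mono (Ici_subset_Ici.2 ht.1)⟩

theorem IsSolution.solOn {x : ℝ → ℝ} (h : IsSolution f Λ r x) (a b : ℝ) :
    SolOn f (fun t => Λ (r * t)) 1 a b x :=
  .of_hasDerivAt (fun t => by simpa using h t) a b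

theorem IsSolution.rescale {x : ℝ → ℝ} (hr : 0 < r) (h : IsSolution f Λ r x) (s : ℝ) :
    HasDerivAt (fun s => x (r⁻¹ * s)) (r⁻¹ * f (x (r⁻¹ * s)) (Λ s)) s := by
  have h1 := (h (r⁻¹ * s)).comp s ((hasDerivAt_id s).const_mul r⁻¹)
  rw [mul_inv_cancel_left₀ hr.ne'] at h1
  refine h1.congr_deriv ?_
  ring

/-- The attractor is the limit of the solutions started in `Xm` at the times `-n`. These form a
Cauchy sequence at early times by contraction, and continuous dependence carries the convergence to
all later times. The same contraction gives pullback attraction, and `PastSol.unique` gives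
uniqueness. -/
theorem exists_pullbackAttractorFrom (hf : ContDiff ℝ 2 (fun p : ℝ × ℝ => f p.1 p.2))
    (hcomplete : ForwardComplete f lm lp) (hΛ : IsParameterShift lm lp Λ)
    (hXm : (Xm, lm) ∈ stabSet f lm lp) (hr : 0 < r) :
    ∃ x : ℝ → ℝ, IsPullbackAttractorFrom f Λ r Xm x := by
  set M : ℝ → ℝ := fun t => Λ (r * t)
  have hM : Continuous M := hΛ.contDiff.continuous.comp (by fun_prop)
  have hl : Tendsto M atBot (𝓝 lm) :=
    hΛ.tendsto_atBot.comp (tendsto_id.const_mul_atBot hr)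
  have h0 : f Xm lm = 0 := hXm.1.1
  have h : dx f Xm lm < 0 := hXm.2
  obtain ⟨δ', c, s₀', hδ', hc, H'⟩ := exists_early_contraction hf hl h
  obtain ⟨δ, s₁, hδ, hδδ', hs'⟩ := exists_early_signs hf hl h0 h hδ'
  set s₀ := min s₀' s₁
  have H : ∀ s ≤ s₀, ∀ x, |x - Xm| ≤ 3 * δ → dx f x (M s) ≤ -c := fun s hs x hx =>
    H' s (hs.trans (min_le_left _ _)) x (hx.trans (by linarith))
  have hs : ∀ s ≤ s₀, f (Xm + δ) (M s) ≤ 0 ∧ 0 ≤ f (Xm - δ) (M s) := fun s hs =>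
    hs' s (hs.trans (min_le_right _ _))
  have tube : ∀ ρ s₂, (∀ s ≤ s₂, f (Xm + ρ) (M s) ≤ 0 ∧ 0 ≤ f (Xm - ρ) (M s)) →
      ∀ a y, (∀ b, SolOn f M 1 a b y) → |y a - Xm| ≤ ρ → ∀ s, a ≤ s → s ≤ s₂ →
      |y s - Xm| ≤ ρ := by
    intro ρ s₂ h a y hy hya s has hs
    have h1 := abs_le.1 hya
    have h2 := (hy s).mem_Icc hf hM zero_le_one (α := Xm - ρ) (β := Xm + ρ)
      (fun r hr => (h r (hr.2.le.trans hs)).2) (fun r hr => (h r (hr.2.le.trans hs)).1)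
      ⟨by linarith, by linarith⟩ s ⟨has, le_rfl⟩
    exact abs_le.2 ⟨by linarith [h2.1], by linarith [h2.2]⟩
  have contr : ∀ a y z, (∀ b, SolOn f M 1 a b y) → (∀ b, SolOn f M 1 a b z) →
      |y a - Xm| ≤ δ → |z a - Xm| ≤ δ → ∀ t, a ≤ t → t ≤ s₀ →
      |y t - z t| ≤ 2 * δ * Real.exp (-(c * (t - a))) := by
    intro a y z hy hz hya hza t hat ht
    have h1 := abs_le.1 hya
    have h2 := abs_le.1 hza
    have := (hy t).contraction hf hM zero_le_one (x₀ := Xm) (δ := δ) (c := c) (w₀ := 2 * δ)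
      (fun s hs => H s (hs.2.trans ht)) hc.le (hz t)
      (fun s hst => tube δ s₀ hs a y hy hya s hst.1 (hst.2.trans ht))
      (fun s hst => tube δ s₀ hs a z hz hza s hst.1 (hst.2.trans ht)) le_rfl
      (abs_le.2 ⟨by linarith, by linarith⟩) t ⟨hat, le_rfl⟩
    rwa [one_mul] at this
  choose φ hφ using fun s x₀ => hcomplete Λ hΛ r hr s x₀
  have hφs : ∀ s x₀ b, SolOn f M 1 s b (φ s x₀) := fun s x₀ b => (hφ s x₀).solOn b
  have hφ0 : ∀ s x₀, φ s x₀ s = x₀ := fun s x₀ => (hφ s x₀).1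
  -- the trajectories starting at `Xm` converge as the starting time tends to `-∞`
  have conv₀ : ∀ t ≤ s₀, ∃ v, Tendsto (fun n : ℕ => φ (-n) Xm t) atTop (𝓝 v) := by
    intro t ht
    refine cauchySeq_tendsto_of_complete (Metric.cauchySeq_iff'.2 fun ε hε => ?_)
    have h1 : Tendsto (fun n : ℕ => 2 * δ * Real.exp (-(c * (t - (-(n : ℝ)))))) atTop (𝓝 0) :=
      (tendsto_mul_exp_atBot hc t).comp
        (tendsto_neg_atTop_atBot.comp tendsto_natCast_atTop_atTop)
    obtain ⟨N, hN1, hN2⟩ := ((h1.eventually_lt_const hε).and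
      (tendsto_natCast_atTop_atTop.eventually_ge_atTop (-t))).exists
    refine ⟨N, fun n hn => ?_⟩
    have hnN : -(n : ℝ) ≤ -(N : ℝ) := neg_le_neg (Nat.cast_le.2 hn)
    have hNt : -(N : ℝ) ≤ t := by linarith
    rw [Real.dist_eq]
    refine lt_of_le_of_lt (contr (-N) _ _ (fun b => (hφs _ _ b).mono hnN le_rfl) (hφs _ _) ?_ ?_ t
      hNt ht) hN1
    · exact tube δ s₀ hs (-n) _ (hφs _ _) (by simp [hφ0, hδ.le]) _ hnN (hNt.trans ht)
    · simp [hφ0, hδ.le]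
  have transport : ∀ a v, Tendsto (fun n : ℕ => φ (-n) Xm a) atTop (𝓝 v) → ∀ t, a ≤ t →
      Tendsto (fun n : ℕ => φ (-n) Xm t) atTop (𝓝 (φ a v t)) := by
    intro a v hv t hat
    refine Metric.tendsto_atTop'.2 fun ε hε => ?_
    obtain ⟨η, hη, hcd⟩ := (hφs a v t).continuous_dependence hf hM (half_pos hε)
    obtain ⟨N, hN⟩ := Metric.tendsto_atTop'.1 hv η hη
    obtain ⟨N', hN'⟩ := exists_nat_ge (-a)
    refine ⟨max N N', fun n hn => ?_⟩
    have h1 := hN n ((le_max_left _ _).trans_lt hn)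
    have h2 : -(n : ℝ) ≤ a := by
      have : (N' : ℝ) ≤ n := Nat.cast_le.2 ((le_max_right _ _).trans hn.le)
      linarith
    rw [Real.dist_eq] at h1 ⊢
    have := hcd 1 _ ((hφs (-n) Xm t).mono h2 le_rfl) (by simpa using hη.le)
      (by rw [hφ0 a v]; exact h1.le) t ⟨hat, le_rfl⟩
    linarith
  have conv : ∀ t, ∃ v, Tendsto (fun n : ℕ => φ (-n) Xm t) atTop (𝓝 v) := by
    intro t
    obtain ⟨v, hv⟩ := conv₀ (min t s₀) (min_le_right _ _)
    exact ⟨_, transport _ v hv t (min_le_left _ _)⟩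
  choose x hx using conv
  have hxφ : ∀ a t, a ≤ t → x t = φ a (x a) t := fun a t hat =>
    tendsto_nhds_unique (hx t) (transport a _ (hx a) t hat)
  have hsol : IsSolution f Λ r x := by
    intro t
    have ht : t - 1 < t := sub_one_lt t
    have h1 := ((hφ (t - 1) (x (t - 1))).2 t ht.le).hasDerivAt (Ici_mem_nhds ht)
    rw [← hxφ _ _ ht.le] at h1
    refine h1.congr_of_eventuallyEq ?_
    filter_upwards [Ici_mem_nhds ht] with s hs using hxφ _ _ hs
  have hxs := hsol.solOn
  have hxt : ∀ ρ s₂, 0 < ρ → (∀ s ≤ s₂, f (Xm + ρ) (M s) ≤ 0 ∧ 0 ≤ f (Xm - ρ) (M s)) →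
      ∀ s ≤ s₂, |x s - Xm| ≤ ρ := by
    intro ρ s₂ hρ h s hs
    refine le_of_tendsto ((hx s).sub_const Xm).abs ?_
    obtain ⟨N, hN⟩ := exists_nat_ge (-s)
    refine eventually_atTop.2 ⟨N, fun n hn => ?_⟩
    have : (N : ℝ) ≤ n := Nat.cast_le.2 hn
    exact tube ρ s₂ h (-n) _ (hφs _ _) (by simp [hφ0, hρ.le]) s (by linarith) hs
  have hxlim : Tendsto x atBot (𝓝 Xm) := by
    refine Metric.tendsto_nhds.2 fun ε hε => ?_
    obtain ⟨ρ, s₂, hρ, hρε, h2⟩ := exists_early_signs hf hl h0 h (half_pos hε)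
    refine eventually_atBot.2 ⟨s₂, fun s hs => ?_⟩
    rw [Real.dist_eq]
    linarith [hxt ρ s₂ hρ h2 s hs]
  refine ⟨x, ⟨hsol, Ioo (Xm - 2 * δ / 2) (Xm + δ), isOpen_Ioo, Metric.isBounded_Ioo _ _,
    ?_⟩, hxlim, fun z hz hzlim => ?_⟩
  · obtain ⟨s₂, h2⟩ := eventually_atBot.1 (hxlim.eventually
      (Ioo_mem_nhds (show Xm - 2 * δ / 2 < Xm by linarith) (show Xm < Xm + δ by linarith)))
    refine ⟨max 1 (-s₂), by positivity, fun t ht => h2 t ?_, fun y hy t => ?_⟩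
    · linarith [le_max_right 1 (-s₂)]
    rw [Metric.tendsto_nhds]
    intro ε hε
    set t₀ := min t s₀
    obtain ⟨η, hη, hcd⟩ := (hxs t₀ t).continuous_dependence hf hM (half_pos hε)
    have h3 : Tendsto (fun s : ℝ => 2 * δ * Real.exp (-(c * (t₀ - (t - s))))) atTop (𝓝 0) := by
      refine (tendsto_mul_exp_atBot hc t₀).comp ?_
      exact tendsto_atBot_add_const_left _ t tendsto_neg_atTop_atBot
    filter_upwards [h3.eventually_lt_const hη, eventually_ge_atTop (t - t₀)] with s hs1 hs2
    have hst : t - s ≤ t₀ := by linarith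
    have hex : ∃ x : ℝ → ℝ, IsSolutionFrom f Λ r (t - s) y x := ⟨_, hφ _ _⟩
    -- The cocycle is an arbitrarily chosen forward solution; `contr` and `hcd` apply to any such
    -- solution.
    have hcoc : cocycle f Λ r t (t - s) y = hex.choose t := dif_pos hex
    have hch := hex.choose_spec
    rw [hcoc, Real.dist_eq, sub_zero, abs_abs]
    have h4 := contr (t - s) _ _ hch.solOn (hxs (t - s))
      (by rw [hch.1]; exact abs_le.2 ⟨by linarith [hy.1], by linarith [hy.2]⟩)
      (hxt δ s₀ hδ hs _ (hst.trans (min_le_right _ _))) t₀ hst (min_le_right _ _)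
    have := hcd 1 _ ((hch.solOn t).mono hst le_rfl) (by simpa using hη.le) (h4.trans hs1.le) t
      ⟨min_le_left _ _, le_rfl⟩
    linarith
  · funext t
    exact PastSol.unique (S := t) hf hM hl h0 h one_pos ⟨fun a b _ => hz.solOn a b, hzlim⟩
      ⟨fun a b _ => hxs a b, hxlim⟩ t le_rfl

end Pullback

/-! ### Slow tracking of a curve of stable equilibria. -/

section Tracking

variable {f : ℝ → ℝ → ℝ} {Λ : ℝ → ℝ} {p q : ℝ} {B : ℝ → ℝ}

/-- Solutions stay in a contraction tube around a curve of equilibria if the parameter moves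
slowly in comparison with the contraction. -/
theorem SolOn.curve_tube (hf : ContDiff ℝ 2 (fun p : ℝ × ℝ => f p.1 p.2)) (hΛ : Continuous Λ)
    {μ a b : ℝ} {y : ℝ → ℝ} (hμ : 0 ≤ μ) (hB : ContinuousOn B (Icc p q))
    (heq : ∀ l ∈ Icc p q, f (B l) l = 0) {δ₀ c : ℝ} (hc : 0 < c)
    (htube : ∀ l ∈ Icc p q, ∀ x, |x - B l| ≤ δ₀ → dx f x l ≤ -c) {L K : ℝ} (hL0 : 0 ≤ L)
    (hL : ∀ l ∈ Icc p q, ∀ l' ∈ Icc p q, |f (B l') l - f (B l') l'| ≤ L * |l - l'|)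
    (hK : ∀ s ∈ Icc a b, ∀ s' ∈ Icc a b, |Λ s' - Λ s| ≤ K * |s' - s|)
    (hmem : ∀ s ∈ Icc a b, Λ s ∈ Icc p q) {δ : ℝ} (hδ : 0 < δ) (hδ₀ : δ ≤ δ₀)
    (hsmall : L * K ≤ μ * c ^ 2 * δ) (hy : SolOn f Λ μ a b y) (h0 : |y a - B (Λ a)| ≤ δ) :
    ∀ t ∈ Icc a b, |y t - B (Λ t)| ≤ δ := by
  have hψ : ContinuousOn (fun s => B (Λ s)) (Icc a b) := hB.comp hΛ.continuousOn hmem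
  have hslope : ∀ t ∈ Ico a b, ∀ᶠ t' in 𝓝[>] t,
      |B (Λ t') - B (Λ t)| ≤ μ * c * δ * (t' - t) := by
    intro t ht
    have ht1 := Ico_subset_Icc_self ht
    have h1 : Tendsto (fun s => B (Λ s)) (𝓝[>] t) (𝓝 (B (Λ t))) :=
      (hψ t ht1).mono_of_mem_nhdsWithin (Icc_mem_nhdsGT_of_mem ht)
    filter_upwards [h1.eventually (Metric.ball_mem_nhds _ (hδ.trans_le hδ₀)),
      Icc_mem_nhdsGT_of_mem ht, self_mem_nhdsWithin] with t' h2 h3 (h4 : t < t')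
    have h2' := abs_lt.1 (Real.dist_eq _ _ ▸ h2)
    -- Strong monotonicity bounds the displacement of the zero by the residual of the new zero at
    -- the old parameter, so `B ∘ Λ` has slope at most `L K / c` without any differentiability of
    -- `B`. By `hsmall` this is at most `μ c δ`, the inward speed at distance `δ`.
    have h5 : c * |B (Λ t') - B (Λ t)| ≤ |f (B (Λ t')) (Λ t)| := by
      have e := heq _ (hmem t ht1)
      have hz : ∀ z, B (Λ t) - δ₀ ≤ z → z ≤ B (Λ t) + δ₀ → dx f z (Λ t) ≤ -c := fun z hz1 hz2 =>
        htube _ (hmem t ht1) z (abs_le.2 ⟨by linarith, by linarith⟩)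
      rcases le_total (B (Λ t)) (B (Λ t')) with hle | hle
      · have := sub_le_of_dx_le hf (l := Λ t) (c := c) hle
          (fun z hz' => hz z (by linarith [hz'.1]) (by linarith [hz'.2]))
        rw [abs_of_nonneg (sub_nonneg.2 hle)]
        refine le_trans ?_ (neg_abs_le _ |> neg_le.1)
        linarith
      · have := sub_le_of_dx_le hf (l := Λ t) (c := c) hle
          (fun z hz' => hz z (by linarith [hz'.1]) (by linarith [hz'.2]))
        rw [abs_of_nonpos (sub_nonpos.2 hle)]
        refine le_trans ?_ (le_abs_self _)
        linarith
    have h6 := hL _ (hmem t ht1) _ (hmem t' h3)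
    rw [heq _ (hmem t' h3), sub_zero] at h6
    have h7 := hK t' h3 t ht1
    rw [abs_sub_comm t t', abs_of_pos (sub_pos.2 h4)] at h7
    have h8 : c * |B (Λ t') - B (Λ t)| ≤ c * (μ * c * δ * (t' - t)) := by
      calc _ ≤ L * (K * (t' - t)) := h5.trans (h6.trans (by gcongr))
        _ = L * K * (t' - t) := by ring
        _ ≤ μ * c ^ 2 * δ * (t' - t) := by gcongr
        _ = _ := by ring
    exact le_of_mul_le_mul_left h8 hc
  have h0' := abs_le.1 h0
  have up := comparison_field (z := fun s => B (Λ s) + δ) hf hΛ hy.cont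
    (hψ.add continuousOn_const) (fun _ => hy.subAt) (fun t ht ε hε => by
      filter_upwards [hslope t ht, self_mem_nhdsWithin] with t' h1 (h2 : t < t')
      have ht1 := hmem t (Ico_subset_Icc_self ht)
      have h3 := sub_le_of_dx_le hf (l := Λ t) (c := c)
        (le_add_of_nonneg_right hδ.le : B (Λ t) ≤ B (Λ t) + δ)
        (fun z hz => htube _ ht1 z (abs_le.2 ⟨by linarith [hz.1], by linarith [hz.2]⟩))
      rw [heq _ ht1, add_sub_cancel_left, sub_zero] at h3
      have h4 := mul_le_mul_of_nonneg_left h3 hμ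
      have h5 := (abs_le.1 h1).1
      have h6 := mul_le_mul_of_nonneg_right h4 (sub_pos.2 h2).le
      have h7 := mul_pos hε (sub_pos.2 h2)
      linarith) (by linarith)
  have lo := comparison_field (y := fun s => B (Λ s) - δ) hf hΛ
    (hψ.sub continuousOn_const) hy.cont (fun t ht ε hε => by
      filter_upwards [hslope t ht, self_mem_nhdsWithin] with t' h1 (h2 : t < t')
      have ht1 := hmem t (Ico_subset_Icc_self ht)
      have h3 := sub_le_of_dx_le hf (l := Λ t) (c := c)
        (sub_le_self _ hδ.le : B (Λ t) - δ ≤ B (Λ t))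
        (fun z hz => htube _ ht1 z (abs_le.2 ⟨by linarith [hz.1], by linarith [hz.2]⟩))
      rw [heq _ ht1, sub_sub_cancel, zero_sub] at h3
      have h4 := mul_le_mul_of_nonneg_left h3 hμ
      have h5 := (abs_le.1 h1).2
      have h6 := mul_le_mul_of_nonneg_right h4 (sub_pos.2 h2).le
      have h7 := mul_pos hε (sub_pos.2 h2)
      linarith) (fun _ => hy.superAt) (by linarith)
  intro t ht
  have h1 := up t ht
  have h2 := lo t ht
  exact abs_le.2 ⟨by linarith, by linarith⟩

/-- The width `δ` is fixed before the Lipschitz bound `K`, and `μ₁` depends on no particular shift,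
interval or solution; shifts constructed later can therefore be inserted. -/
theorem exists_slow_tube (hf : ContDiff ℝ 2 (fun p : ℝ × ℝ => f p.1 p.2))
    (hB : ContinuousOn B (Icc p q)) (heq : ∀ l ∈ Icc p q, f (B l) l = 0)
    (hdx : ∀ l ∈ Icc p q, dx f (B l) l < 0) {ε : ℝ} (hε : 0 < ε) :
    ∃ δ, 0 < δ ∧ δ ≤ ε ∧ ∀ K, ∃ μ₁, 0 < μ₁ ∧ ∀ μ, μ₁ ≤ μ → ∀ (Λ : ℝ → ℝ) (a b : ℝ) (y : ℝ → ℝ),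
      Continuous Λ → (∀ s ∈ Icc a b, Λ s ∈ Icc p q) →
      (∀ s ∈ Icc a b, ∀ s' ∈ Icc a b, |Λ s' - Λ s| ≤ K * |s' - s|) →
      SolOn f Λ μ a b y → |y a - B (Λ a)| ≤ δ → ∀ t ∈ Icc a b, |y t - B (Λ t)| ≤ δ := by
  obtain ⟨δ₀, c, hδ₀, hc, htube⟩ := exists_tube hf hB hdx
  obtain ⟨R, hR⟩ := isCompact_Icc.exists_bound_of_continuousOn hB
  obtain ⟨L, hL0, hL⟩ := exists_lipschitz hf R p q
  have hδ : 0 < min δ₀ ε := lt_min hδ₀ hε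
  refine ⟨min δ₀ ε, hδ, min_le_right _ _, fun K => ?_⟩
  refine ⟨max 1 (L * K / (c ^ 2 * min δ₀ ε)), by positivity, ?_⟩
  intro μ hμ Λ a b y hΛ hmem hK hy h0
  refine hy.curve_tube hf hΛ (zero_le_one.trans ((le_max_left _ _).trans hμ)) hB heq hc htube
    (L := L) hL0 (fun l hl l' hl' => ?_) hK hmem hδ (min_le_left _ _) ?_ h0
  · simpa using hL (B l') (B l') l l' (hR l' hl') (hR l' hl') hl hl'
  · have := (div_le_iff₀ (by positivity)).1 ((le_max_right _ _).trans hμ)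
    linarith

/-- On the closure of the stable set the derivative is nonpositive by continuity; only bifurcation
points have derivative zero. -/
theorem IsStableBranch.dx_neg (hf : ContDiff ℝ 2 (fun p : ℝ × ℝ => f p.1 p.2)) {lm lp : ℝ}
    (hB : IsStableBranch f lm lp p q B) {l : ℝ} (hl : l ∈ Icc p q)
    (hbif : (B l, l) ∉ bifSet f lm lp) : dx f (B l) l < 0 := by
  have h1 : closure (stabSet f lm lp) ⊆ {p : ℝ × ℝ | dx f p.1 p.2 ≤ 0} :=
    closure_minimal (fun p hp => le_of_lt hp.2) (isClosed_le (continuous_dx hf) continuous_const)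
  refine lt_of_le_of_ne (h1 (hB.mem_closure l hl)) fun h => hbif ⟨hB.mem_equilibria l hl, h⟩

end Tracking

/-! ### Trapping intervals and basins of attraction. -/

section Traps

variable {f : ℝ → ℝ → ℝ} {Λ : ℝ → ℝ}

theorem exists_trap (hf : ContDiff ℝ 2 (fun p : ℝ × ℝ => f p.1 p.2)) {z l ε : ℝ}
    (h0 : f z l = 0) (h : dx f z l < 0) (hε : 0 < ε) :
    ∃ ρ η, 0 < ρ ∧ ρ ≤ ε ∧ 0 < η ∧
      (∀ l', |l' - l| ≤ η → f (z + ρ) l' ≤ 0 ∧ 0 ≤ f (z - ρ) l') ∧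
      ∀ x, |x - z| ≤ ρ → f x l = 0 → x = z := by
  obtain ⟨ρ₀, hρ₀, H⟩ := stable_signs hf h0 h
  have hρ : 0 < min ρ₀ ε := lt_min hρ₀ hε
  obtain ⟨h1, h2⟩ := H (min ρ₀ ε) hρ (min_le_left _ _)
  obtain ⟨η, hη, h3⟩ := Metric.eventually_nhds_iff.1
    ((((continuous_param hf (z + min ρ₀ ε)).tendsto l).eventually_lt_const h1).and
      (((continuous_param hf (z - min ρ₀ ε)).tendsto l).eventually_const_lt h2))
  refine ⟨min ρ₀ ε, η / 2, hρ, min_le_right _ _, by positivity, fun l' hl' => ?_, fun x hx hx0 => ?_⟩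
  · have := h3 (y := l') (by rw [Real.dist_eq]; linarith)
    exact ⟨this.1.le, this.2.le⟩
  · by_contra hne
    rcases lt_or_gt_of_ne hne with hlt | hlt
    · have := (H (z - x) (by linarith)
        ((by linarith [(abs_le.1 hx).1] : z - x ≤ _).trans (min_le_left ρ₀ ε))).2
      rw [sub_sub_cancel, hx0] at this
      exact lt_irrefl _ this
    · have := (H (x - z) (by linarith)
        ((by linarith [(abs_le.1 hx).2] : x - z ≤ _).trans (min_le_left ρ₀ ε))).1
      rw [add_sub_cancel, hx0] at this
      exact lt_irrefl _ this

/-- A trapped solution is bounded, so it converges to an equilibrium of the limiting system, and the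
trap contains only one. -/
theorem tendsto_of_trap (hf : ContDiff ℝ 2 (fun p : ℝ × ℝ => f p.1 p.2)) (hΛ : Continuous Λ)
    {l : ℝ} (hl : Tendsto Λ atTop (𝓝 l)) (hb : ∀ x, f x l = 0 → dx f x l ≠ 0) {μ a α β z : ℝ}
    {y : ℝ → ℝ} (hμ : 0 < μ) (hy : ∀ b, SolOn f Λ μ a b y)
    (hα : ∀ s ≥ a, 0 ≤ f α (Λ s)) (hβ : ∀ s ≥ a, f β (Λ s) ≤ 0)
    (hz : ∀ x ∈ Icc α β, f x l = 0 → x = z) (h0 : y a ∈ Icc α β) :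
    Tendsto y atTop (𝓝 z) := by
  obtain ⟨w, hw, hlim, hw0⟩ := exists_tendsto_of_mem_Icc hf hΛ hl hb hμ hy (α := α) (β := β)
    (eventually_atTop.2 ⟨a, fun s hs => (hy s).mem_Icc hf hΛ hμ.le (fun r hr => hα r hr.1)
      (fun r hr => hβ r hr.1) h0 s ⟨hs, le_rfl⟩⟩)
  rwa [← hz w hw hw0]

theorem solOn_of_basin {l : ℝ} {y : ℝ → ℝ}
    (hy : ∀ t, 0 ≤ t → HasDerivWithinAt y (f (y t) l) (Ici 0) t) (b : ℝ) :
    SolOn f (fun _ => l) 1 0 b y :=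
  ⟨fun t ht => (hy t ht.1).continuousWithinAt.mono Icc_subset_Ici_self, fun t ht => by
    rw [one_mul]
    exact (hy t ht.1).mono (Ici_subset_Ici.2 ht.1)⟩

theorem basin_unique (hf : ContDiff ℝ 2 (fun p : ℝ × ℝ => f p.1 p.2)) {x z z' l : ℝ}
    (h : x ∈ basin f z l) (h' : x ∈ basin f z' l) : z = z' := by
  obtain ⟨y, hy0, hy, hlim⟩ := h
  obtain ⟨y', hy0', hy', hlim'⟩ := h'
  refine tendsto_nhds_unique hlim (hlim'.congr' (eventually_atTop.2 ⟨0, fun t ht => ?_⟩))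
  exact (solOn_of_basin hy' t).unique hf continuous_const (solOn_of_basin hy t)
    (hy0'.trans hy0.symm) t ⟨ht, le_rfl⟩

/-- If `f w l ≤ 0`, the constant `w` would be a barrier separating the solution from `z`. -/
theorem pos_of_basin (hf : ContDiff ℝ 2 (fun p : ℝ × ℝ => f p.1 p.2)) {x z w l : ℝ}
    (h : x ∈ basin f z l) (hxw : x ≤ w) (hwz : w < z) : 0 < f w l := by
  by_contra! hle
  obtain ⟨y, hy0, hy, hlim⟩ := h
  refine not_le.2 hwz (le_of_tendsto hlim (eventually_atTop.2 ⟨0, fun t ht => ?_⟩))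
  exact (solOn_of_basin hy t).le_const hf continuous_const zero_le_one (fun _ _ => hle)
    (hy0.trans_le hxw) t ⟨ht, le_rfl⟩

theorem neg_of_basin (hf : ContDiff ℝ 2 (fun p : ℝ × ℝ => f p.1 p.2)) {x z w l : ℝ}
    (h : x ∈ basin f z l) (hxw : w ≤ x) (hwz : z < w) : f w l < 0 := by
  by_contra! hle
  obtain ⟨y, hy0, hy, hlim⟩ := h
  refine not_le.2 hwz (ge_of_tendsto hlim (eventually_atTop.2 ⟨0, fun t ht => ?_⟩))
  exact (solOn_of_basin hy t).const_le hf continuous_const zero_le_one (fun _ _ => hle)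
    (hxw.trans hy0.ge) t ⟨ht, le_rfl⟩

/-- A point in the basin of a linearly stable equilibrium is interior to a trapping interval. -/
theorem exists_basin_trap (hf : ContDiff ℝ 2 (fun p : ℝ × ℝ => f p.1 p.2)) {x z l : ℝ}
    (hx : x ∈ basin f z l) (h0 : f z l = 0) (h : dx f z l < 0) :
    ∃ α β, α < x ∧ x < β ∧ α < z ∧ z < β ∧ (∀ w, α ≤ w → w < z → 0 < f w l) ∧
      ∀ w, z < w → w ≤ β → f w l < 0 := by
  obtain ⟨ρ₀, hρ₀, H⟩ := stable_signs hf h0 h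
  have hcont := continuous_state hf l
  obtain ⟨α, hα1, hα2, hα3⟩ : ∃ α, α < x ∧ α < z ∧ ∀ w, α ≤ w → w < z → 0 < f w l := by
    rcases lt_or_ge x z with hxz | hxz
    · obtain ⟨ε, hε, h1⟩ := Metric.eventually_nhds_iff.1
        ((hcont.tendsto x).eventually_const_lt (pos_of_basin hf hx le_rfl hxz))
      refine ⟨x - ε / 2, by linarith, by linarith, fun w hw hwz => ?_⟩
      rcases le_total x w with hxw | hxw
      · exact pos_of_basin hf hx hxw hwz
      · exact h1 (by rw [Real.dist_eq, abs_lt]; constructor <;> linarith)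
    · refine ⟨z - ρ₀, by linarith, by linarith, fun w hw hwz => ?_⟩
      have := (H (z - w) (by linarith) (by linarith)).2
      rwa [sub_sub_cancel] at this
  obtain ⟨β, hβ1, hβ2, hβ3⟩ : ∃ β, x < β ∧ z < β ∧ ∀ w, z < w → w ≤ β → f w l < 0 := by
    rcases lt_or_ge z x with hxz | hxz
    · obtain ⟨ε, hε, h1⟩ := Metric.eventually_nhds_iff.1
        ((hcont.tendsto x).eventually_lt_const (neg_of_basin hf hx le_rfl hxz))
      refine ⟨x + ε / 2, by linarith, by linarith, fun w hwz hw => ?_⟩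
      rcases le_total w x with hxw | hxw
      · exact neg_of_basin hf hx hxw hwz
      · exact h1 (by rw [Real.dist_eq, abs_lt]; constructor <;> linarith)
    · refine ⟨z + ρ₀, by linarith, by linarith, fun w hwz hw => ?_⟩
      have := (H (w - z) (by linarith) (by linarith)).1
      rwa [add_sub_cancel] at this
  exact ⟨α, β, hα1, hβ1, hα2, hβ2, hα3, hβ3⟩

end Traps

/-! ### Openness of tracking in the rate, and the critical rate. -/

section CriticalRate

variable {f : ℝ → ℝ → ℝ} {Λ : ℝ → ℝ} {lm lp Xm Xp : ℝ}

theorem IsPullbackAttractorFrom.pastSol {r : ℝ} {x : ℝ → ℝ} (hr : 0 < r)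
    (h : IsPullbackAttractorFrom f Λ r Xm x) (S : ℝ) :
    PastSol f Λ r⁻¹ Xm S (fun s => x (r⁻¹ * s)) :=
  ⟨fun a b _ => SolOn.of_hasDerivAt (h.isPullbackAttractor.1.rescale hr) a b,
    h.tendsto_atBot.comp (tendsto_id.const_mul_atBot (inv_pos.2 hr))⟩

theorem tendsto_rescale_iff {r : ℝ} (hr : 0 < r) {x : ℝ → ℝ} {α : Type*} {g : ℝ → α}
    {F : Filter α} :
    Tendsto (fun s => g (x (r⁻¹ * s))) atTop F ↔ Tendsto (fun t => g (x t)) atTop F := by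
  refine ⟨fun h => ?_, fun h => h.comp (tendsto_id.const_mul_atTop (inv_pos.2 hr))⟩
  refine (h.comp (tendsto_id.const_mul_atTop hr)).congr fun t => ?_
  simp [hr.ne']

/-- At the rate `r` the pullback attractor from `Xm` tends to `Xp`. -/
def TracksAt (f : ℝ → ℝ → ℝ) (Λ : ℝ → ℝ) (Xm Xp r : ℝ) : Prop :=
  ∃ x, IsPullbackAttractorFrom f Λ r Xm x ∧ Tendsto x atTop (𝓝 Xp)

theorem TracksAt.tendsto {r : ℝ} (h : TracksAt f Λ Xm Xp r) {x : ℝ → ℝ}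
    (hx : IsPullbackAttractorFrom f Λ r Xm x) : Tendsto x atTop (𝓝 Xp) := by
  obtain ⟨y, hy, hlim⟩ := h
  rwa [← hy.unique x hx.isPullbackAttractor.1 hx.tendsto_atBot] at hlim

theorem hyperbolic_of_not_mem_bifSet (hlt : lm ≤ lp)
    (hbif : ∀ x : ℝ, (x, lm) ∉ bifSet f lm lp ∧ (x, lp) ∉ bifSet f lm lp) :
    ∀ x, f x lp = 0 → dx f x lp ≠ 0 :=
  fun x hx h => (hbif x).2 ⟨⟨hx, right_mem_Icc.2 hlt⟩, h⟩

theorem IsParameterShift.lt (hΛ : IsParameterShift lm lp Λ) : lm < lp :=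
  (hΛ.mem_Ioo 0).1.trans (hΛ.mem_Ioo 0).2

theorem IsParameterShift.continuous (hΛ : IsParameterShift lm lp Λ) : Continuous Λ :=
  hΛ.contDiff.continuous

theorem IsParameterShift.mem_Icc (hΛ : IsParameterShift lm lp Λ) (s : ℝ) : Λ s ∈ Icc lm lp :=
  Ioo_subset_Icc_self (hΛ.mem_Ioo s)

theorem IsParameterShift.exists_near_atTop (hΛ : IsParameterShift lm lp Λ) {η : ℝ} (hη : 0 < η) :
    ∃ S, ∀ s ≥ S, |Λ s - lp| ≤ η := by
  obtain ⟨S, hS⟩ := eventually_atTop.1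
    (hΛ.tendsto_atTop.eventually (Metric.ball_mem_nhds lp hη))
  exact ⟨S, fun s hs => (Real.dist_eq _ _ ▸ hS s hs : |Λ s - lp| < η).le⟩

/-- Rates near a rate with tracking have the state of the trajectory at a given time nearby. -/
theorem exists_near_rate (hf : ContDiff ℝ 2 (fun p : ℝ × ℝ => f p.1 p.2))
    (hΛ : IsParameterShift lm lp Λ) (hXm : (Xm, lm) ∈ stabSet f lm lp) {r : ℝ} (hr : 0 < r)
    {x : ℝ → ℝ} (hx : IsPullbackAttractorFrom f Λ r Xm x) (S : ℝ) {ε : ℝ} (hε : 0 < ε) :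
    ∃ η, 0 < η ∧ ∀ r' x', 0 < r' → IsPullbackAttractorFrom f Λ r' Xm x' → |r' - r| < η →
      |x' (r'⁻¹ * S) - x (r⁻¹ * S)| ≤ ε := by
  obtain ⟨η, hη, H⟩ := (hx.pastSol hr S).continuous_dependence hf hΛ.continuous hΛ.mem_Icc
    hΛ.tendsto_atBot hXm.1.1 hXm.2 (inv_pos.2 hr) hε
  have h1 : Tendsto (fun r' : ℝ => r'⁻¹) (𝓝 r) (𝓝 r⁻¹) := tendsto_inv₀ hr.ne'
  obtain ⟨η', hη', H'⟩ := Metric.tendsto_nhds_nhds.1 h1 η hη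
  refine ⟨η', hη', fun r' x' hr' hx' hd => ?_⟩
  exact H _ _ (inv_pos.2 hr') (hx'.pastSol hr' S) (H' hd).le

/-- At a late time the tracking trajectory is well inside a trap around `Xp`. Nearby rates give
nearby states at that fixed rescaled time, hence states in the same trap. -/
theorem TracksAt.exists_open (hf : ContDiff ℝ 2 (fun p : ℝ × ℝ => f p.1 p.2))
    (hcomplete : ForwardComplete f lm lp) (hΛ : IsParameterShift lm lp Λ)
    (hXm : (Xm, lm) ∈ stabSet f lm lp) (hXp : (Xp, lp) ∈ stabSet f lm lp)
    (hb : ∀ x, f x lp = 0 → dx f x lp ≠ 0) {r : ℝ} (hr : 0 < r) (h : TracksAt f Λ Xm Xp r) :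
    ∃ η, 0 < η ∧ ∀ r', 0 < r' → |r' - r| < η → TracksAt f Λ Xm Xp r' := by
  obtain ⟨x, hx, hlim⟩ := h
  obtain ⟨ρ, η, hρ, -, hη, htrap, huniq⟩ := exists_trap hf hXp.1.1 hXp.2 one_pos
  obtain ⟨S₁, hS₁⟩ := hΛ.exists_near_atTop hη
  have hlim' := (tendsto_rescale_iff (g := id) hr).2 hlim
  obtain ⟨S, hS1, hS2⟩ := ((hlim'.eventually (Metric.ball_mem_nhds Xp (half_pos hρ))).and
    (eventually_ge_atTop S₁)).exists
  have hS1' : |x (r⁻¹ * S) - Xp| < ρ / 2 := Real.dist_eq _ _ ▸ hS1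
  obtain ⟨η', hη', H⟩ := exists_near_rate hf hΛ hXm hr hx S (half_pos hρ)
  refine ⟨η', hη', fun r' hr' hd => ?_⟩
  obtain ⟨x', hx'⟩ := exists_pullbackAttractorFrom hf hcomplete hΛ hXm hr'
  refine ⟨x', hx', (tendsto_rescale_iff (g := id) hr').1 ?_⟩
  have h1 := H r' x' hr' hx' hd
  have h2 := abs_le.1 ((abs_sub_le _ _ _).trans (add_le_add h1 hS1'.le))
  refine tendsto_of_trap hf hΛ.continuous hΛ.tendsto_atTop hb (inv_pos.2 hr') (a := S)
    (fun b => (hx'.pastSol hr' b).sol S b le_rfl)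
    (fun s hs => (htrap _ (hS₁ s (hS2.trans hs))).2) (fun s hs => (htrap _ (hS₁ s (hS2.trans hs))).1)
    (fun w hw => huniq w (abs_le.2 ⟨by linarith [hw.1], by linarith [hw.2]⟩))
    ⟨?_, ?_⟩ <;> simp only [id_eq] <;> linarith

/-- The critical rate is the infimum of the non-tracking rates. It is itself non-tracking, since
otherwise openness would leave a gap above it. -/
theorem exists_critical_rate (hf : ContDiff ℝ 2 (fun p : ℝ × ℝ => f p.1 p.2))
    (hcomplete : ForwardComplete f lm lp) (hΛ : IsParameterShift lm lp Λ)
    (hXm : (Xm, lm) ∈ stabSet f lm lp) (hXp : (Xp, lp) ∈ stabSet f lm lp)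
    (hb : ∀ x, f x lp = 0 → dx f x lp ≠ 0) {r₁ R : ℝ} (hr₁ : 0 < r₁)
    (hsmall : ∀ r, 0 < r → r < r₁ → TracksAt f Λ Xm Xp r) (hR : 0 < R)
    (hnot : ¬ TracksAt f Λ Xm Xp R) :
    ∃ r₀, r₁ ≤ r₀ ∧ r₀ ≤ R ∧ (∀ r, 0 < r → r < r₀ → TracksAt f Λ Xm Xp r) ∧
      ¬ TracksAt f Λ Xm Xp r₀ := by
  set N : Set ℝ := {r | 0 < r ∧ ¬ TracksAt f Λ Xm Xp r}
  have hne : N.Nonempty := ⟨R, hR, hnot⟩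
  have hlb : ∀ r ∈ N, r₁ ≤ r := fun r hr => not_lt.1 fun h => hr.2 (hsmall r hr.1 h)
  have hbdd : BddBelow N := ⟨r₁, hlb⟩
  have h1 : r₁ ≤ sInf N := le_csInf hne hlb
  have hlt : ∀ r, 0 < r → r < sInf N → TracksAt f Λ Xm Xp r := fun r hr h => by
    by_contra hn
    exact not_le.2 h (csInf_le hbdd ⟨hr, hn⟩)
  refine ⟨sInf N, h1, csInf_le hbdd ⟨hR, hnot⟩, hlt, fun h => ?_⟩
  obtain ⟨η, hη, H⟩ := h.exists_open hf hcomplete hΛ hXm hXp hb (hr₁.trans_le h1)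
  obtain ⟨r, hr, hrη⟩ := exists_lt_of_csInf_lt hne (lt_add_of_pos_right (sInf N) hη)
  refine hr.2 (H r hr.1 ?_)
  have := csInf_le hbdd hr
  rw [abs_lt]
  constructor <;> linarith

end CriticalRate

theorem exists_bound_of_tendsto {g : ℝ → ℝ} (hg : Continuous g) {u v : ℝ}
    (hu : Tendsto g atBot (𝓝 u)) (hv : Tendsto g atTop (𝓝 v)) : ∃ C, ∀ s, |g s| ≤ C := by
  obtain ⟨a, ha⟩ := eventually_atBot.1 (hu.abs.eventually_lt_const (lt_add_one |u|))
  obtain ⟨b, hb⟩ := eventually_atTop.1 (hv.abs.eventually_lt_const (lt_add_one |v|))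
  obtain ⟨C, hC⟩ := (isCompact_Icc (a := a) (b := b)).exists_bound_of_continuousOn hg.continuousOn
  refine ⟨max C (max (|u| + 1) (|v| + 1)), fun s => ?_⟩
  rcases le_total s a with h | h
  · exact (ha s h).le.trans ((le_max_left _ _).trans (le_max_right _ _))
  · rcases le_total b s with h' | h'
    · exact (hb s h').le.trans ((le_max_right _ _).trans (le_max_right _ _))
    · exact (hC s ⟨h, h'⟩).trans (le_max_left _ _)

/-! ### The running infimum of a path. -/

section RunningInfimum

variable {X : ℝ → ℝ} {x₀ : ℝ}

/-- The infimum of `X` over `(-∞, v]`. -/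
def runInf (X : ℝ → ℝ) (v : ℝ) : ℝ := sInf (X '' Iic v)

theorem le_runInf {c v : ℝ} (h : ∀ u ≤ v, c ≤ X u) : c ≤ runInf X v :=
  le_csInf (nonempty_Iic.image X) (by rintro _ ⟨u, hu, rfl⟩; exact h u hu)

theorem runInf_le {C : ℝ} (hC : ∀ s, |X s| ≤ C) {u v : ℝ} (h : u ≤ v) : runInf X v ≤ X u :=
  csInf_le ⟨-C, by rintro _ ⟨u, -, rfl⟩; exact (abs_le.1 (hC u)).1⟩ ⟨u, h, rfl⟩

theorem runInf_antitone {C : ℝ} (hC : ∀ s, |X s| ≤ C) : Antitone (runInf X) := fun _ _ h =>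
  le_runInf fun _ hu => runInf_le hC (hu.trans h)

/-- The infimum may be approached only as `u → -∞`; this is where the closure in forward basin
stability is needed. The end point `v` itself is reached by continuity. -/
theorem runInf_mem_closure (hX : Continuous X) {C : ℝ} (hC : ∀ s, |X s| ≤ C) (v : ℝ) :
    runInf X v ∈ closure (X '' Iio v) := by
  have h1 : runInf X v ∈ closure (X '' Iic v) := csInf_mem_closure (nonempty_Iic.image X)
    ⟨-C, by rintro _ ⟨u, -, rfl⟩; exact (abs_le.1 (hC u)).1⟩
  refine closure_minimal ?_ isClosed_closure h1
  rw [← closure_Iio v]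
  exact image_closure_subset_closure_image hX

theorem runInf_tendsto {C : ℝ} (hC : ∀ s, |X s| ≤ C) (hlim : Tendsto X atBot (𝓝 x₀)) :
    Tendsto (runInf X) atBot (𝓝 x₀) := by
  refine Metric.tendsto_nhds.2 fun ε hε => ?_
  obtain ⟨a, ha⟩ := eventually_atBot.1 (Metric.tendsto_nhds.1 hlim (ε / 2) (half_pos hε))
  refine eventually_atBot.2 ⟨a, fun v hv => ?_⟩
  have hb : ∀ u ≤ v, |X u - x₀| < ε / 2 := fun u hu => Real.dist_eq _ _ ▸ ha u (hu.trans hv)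
  have h1 : x₀ - ε / 2 ≤ runInf X v := le_runInf fun u hu => by linarith [(abs_lt.1 (hb u hu)).1]
  have h2 := (runInf_le hC (le_refl v)).trans_lt (sub_lt_iff_lt_add'.1 (abs_lt.1 (hb v le_rfl)).2)
  rw [Real.dist_eq, abs_lt]
  constructor <;> linarith

/-- Over a short time the infimum drops by at most the oscillation of `X`. -/
theorem runInf_continuous (hX : Continuous X) {C : ℝ} (hC : ∀ s, |X s| ≤ C) :
    Continuous (runInf X) := by
  refine continuous_iff_continuousAt.2 fun v => Metric.tendsto_nhds.2 fun ε hε => ?_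
  obtain ⟨δ, hδ, H⟩ := Metric.tendsto_nhds_nhds.1 (hX.tendsto v) (ε / 3) (by positivity)
  have hb : ∀ u, |u - v| < δ → |X u - X v| < ε / 3 := fun u hu =>
    Real.dist_eq _ _ ▸ H (Real.dist_eq u v ▸ hu)
  have step : ∀ s t, |s - v| < δ → |t - v| < δ → s ≤ t → runInf X s - 2 * (ε / 3) ≤ runInf X t := by
    intro s t hs ht hst
    refine le_runInf fun u hu => ?_
    rcases le_total u s with h | h
    · linarith [runInf_le hC h]
    · have h1 := abs_lt.1 (hb s hs)
      have h2 := abs_lt.1 hs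
      have h3 := abs_lt.1 ht
      have h4 := abs_lt.1 (hb u (abs_lt.2 ⟨by linarith, by linarith⟩))
      linarith [runInf_le hC (le_refl s)]
  filter_upwards [Metric.ball_mem_nhds v hδ] with t ht
  have ht' : |t - v| < δ := Real.dist_eq t v ▸ ht
  have hv' : |v - v| < δ := by simpa using hδ
  rw [Real.dist_eq, abs_lt]
  rcases le_total t v with h | h
  · have := step t v ht' hv' h
    have := runInf_antitone hC h
    constructor <;> linarith
  · have := step v t hv' ht' h
    have := runInf_antitone hC h
    constructor <;> linarith

end RunningInfimum

/-! ### Forward basin stability implies tracking. -/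

section BasinStable

variable {f : ℝ → ℝ → ℝ} {Λ X m y : ℝ → ℝ} {lm lp Xm Xp μ : ℝ}

/-- An antitone `m` with `f(m, Λ) ≥ 0` is a subsolution, whether differentiable or not. Since `m`
and `y` share the limit at `-∞`, there is no ordered starting point; lowering `m` by `e` creates
one, and in the contraction region `m - e` is still a subsolution. Then `e → 0` gives the inequality
at early times, and comparison continues it. -/
theorem antitone_le_of_subsolution (hf : ContDiff ℝ 2 (fun p : ℝ × ℝ => f p.1 p.2))
    (hΛ : Continuous Λ) (hl : Tendsto Λ atBot (𝓝 lm)) (h : dx f Xm lm < 0)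
    (hμ : 0 ≤ μ) (hy : ∀ S, PastSol f Λ μ Xm S y) (hanti : Antitone m) (hmc : Continuous m)
    (hm : Tendsto m atBot (𝓝 Xm)) (hsub : ∀ v, 0 ≤ f (m v) (Λ v)) (s : ℝ) : m s ≤ y s := by
  obtain ⟨δ, c, s₀, hδ, hc, H⟩ := exists_early_contraction hf hl h
  have near : ∀ e, 0 < e → ∃ a₀, ∀ a ≤ a₀, |m a - Xm| ≤ e := fun e he => by
    obtain ⟨a, ha⟩ := eventually_atBot.1 (hm.eventually (Metric.ball_mem_nhds Xm he))
    exact ⟨a, fun t ht => (Real.dist_eq _ _ ▸ ha t ht : |m t - Xm| < e).le⟩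
  obtain ⟨s₁, hs₁⟩ := near δ hδ
  have early : ∀ t ≤ min s₀ s₁, m t ≤ y t := by
    intro t ht
    refine le_of_forall_pos_le_add fun ε hε => ?_
    set e := min ε δ
    have he : 0 < e := lt_min hε hδ
    have heδ : e ≤ δ := min_le_right _ _
    obtain ⟨a₁, ha₁⟩ := near (e / 2) (half_pos he)
    obtain ⟨a₂, ha₂⟩ := (hy t).exists_near (half_pos he)
    set a := min t (min a₁ a₂)
    have hat : a ≤ t := min_le_left _ _
    have hma := abs_le.1 (ha₁ a ((min_le_right _ _).trans (min_le_left _ _)))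
    have hya := abs_le.1 (ha₂ a ((min_le_right _ _).trans (min_le_right _ _)))
    have hys := (hy t).sol a t le_rfl
    have := comparison_field (y := fun v => m v - e) hf hΛ
      (hmc.sub continuous_const).continuousOn hys.cont (fun v hv ε' hε' => by
        filter_upwards [self_mem_nhdsWithin] with v' (hv' : v < v')
        have h1 := abs_le.1 (hs₁ v (hv.2.le.trans (ht.trans (min_le_right _ _))))
        have h2 := sub_le_of_dx_le hf (l := Λ v) (c := c) (sub_le_self _ he.le : m v - e ≤ m v)
          (fun z hz => H v (hv.2.le.trans (ht.trans (min_le_left _ _))) z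
            (abs_le.2 ⟨by linarith [hz.1], by linarith [hz.2]⟩))
        rw [sub_sub_cancel] at h2
        have h3 : 0 ≤ f (m v - e) (Λ v) := by linarith [hsub v, mul_pos hc he]
        have h4 : 0 ≤ (μ * f (m v - e) (Λ v) + ε') * (v' - v) :=
          mul_nonneg (add_nonneg (mul_nonneg hμ h3) hε'.le) (sub_pos.2 hv').le
        linarith [hanti hv'.le]) (fun _ => hys.superAt) (by linarith) t ⟨hat, le_rfl⟩
    have h5 : e ≤ ε := min_le_left _ _
    linarith
  set t := min s (min s₀ s₁)
  have hys := (hy s).sol t s le_rfl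
  refine comparison_field hf hΛ hmc.continuousOn hys.cont (fun v hv ε hε => ?_)
    (fun _ => hys.superAt) (early t (min_le_right _ _)) s ⟨min_le_left _ _, le_rfl⟩
  filter_upwards [self_mem_nhdsWithin] with v' (hv' : v < v')
  have h4 : 0 ≤ (μ * f (m v) (Λ v) + ε) * (v' - v) :=
    mul_nonneg (add_nonneg (mul_nonneg hμ (hsub v)) hε.le) (sub_pos.2 hv').le
  linarith [hanti hv'.le]

/-- If `z < Xp`, the trajectory finally lies between `m` and `X`, where `f > 0`, so it increases
strictly to `z`. Passing to the limit in the parameter, `f(·, lp) ≥ 0` on both sides of its zero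
`z`, a local minimum with vanishing derivative, contrary to hyperbolicity. -/
theorem le_limit_of_pos_below (hf : ContDiff ℝ 2 (fun p : ℝ × ℝ => f p.1 p.2))
    (hl : Tendsto Λ atTop (𝓝 lp)) (hb : ∀ x, f x lp = 0 → dx f x lp ≠ 0)
    (hX : Tendsto X atTop (𝓝 Xp)) (hμ : 0 < μ)
    (hy : ∀ t, HasDerivAt y (μ * f (y t) (Λ t)) t) (hanti : Antitone m) (hm : ∀ s, m s ≤ y s)
    (hpos : ∀ v w, m v ≤ w → w < X v → 0 < f w (Λ v)) {z : ℝ} (hz : Tendsto y atTop (𝓝 z)) :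
    Xp ≤ z := by
  by_contra! hlt
  obtain ⟨k, hzk, hkX⟩ := exists_between hlt
  obtain ⟨S, hS⟩ := eventually_atTop.1
    ((hz.eventually_lt_const hzk).and (hX.eventually_const_lt hkX))
  have hmono : StrictMonoOn y (Ici S) := by
    refine strictMonoOn_of_deriv_pos (convex_Ici S)
      (fun t _ => (hy t).continuousAt.continuousWithinAt) fun t ht => ?_
    rw [interior_Ici] at ht
    rw [(hy t).deriv]
    exact mul_pos hμ (hpos t _ (hm t) ((hS t (le_of_lt ht)).1.trans (hS t (le_of_lt ht)).2))
  have h1 : y S < z := by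
    refine (hmono self_mem_Ici (mem_Ici.2 (by linarith : S ≤ S + 1)) (lt_add_one S)).trans_le ?_
    refine ge_of_tendsto hz (eventually_atTop.2 ⟨S + 1, fun t ht => ?_⟩)
    exact hmono.monotoneOn (mem_Ici.2 (by linarith)) (mem_Ici.2 (by linarith)) ht
  have hnn : ∀ w, y S < w → w < k → 0 ≤ f w lp := by
    intro w hw1 hw2
    refine ge_of_tendsto (((continuous_param hf w).tendsto lp).comp hl)
      (eventually_atTop.2 ⟨S, fun v hv => ?_⟩)
    exact (hpos v w ((hanti hv).trans ((hm S).trans hw1.le)) (hw2.trans (hS v hv).2)).le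
  have hz0 : f z lp = 0 := eq_zero_of_tendsto (a := 0) hf hl hμ (SolOn.of_hasDerivAt hy 0) hz
  have hmin : IsLocalMin (fun w => f w lp) z := by
    filter_upwards [Ioo_mem_nhds h1 hzk] with w hw
    rw [hz0]
    exact hnn w hw.1 hw.2
  exact hb z hz0 hmin.deriv_eq_zero

theorem lower_limit_of_basinStable (hf : ContDiff ℝ 2 (fun p : ℝ × ℝ => f p.1 p.2))
    (hΛ : IsParameterShift lm lp Λ) (h : dx f Xm lm < 0)
    (hb : ∀ x, f x lp = 0 → dx f x lp ≠ 0) (hXc : Continuous X)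
    (hXm : Tendsto X atBot (𝓝 Xm)) (hXp : Tendsto X atTop (𝓝 Xp))
    (heq : ∀ s, f (X s) (Λ s) = 0) (hfbs : ForwardBasinStable f Λ X) (hμ : 0 < μ)
    (hy : ∀ t, HasDerivAt y (μ * f (y t) (Λ t)) t) (hlim : Tendsto y atBot (𝓝 Xm)) :
    (∃ C, ∀ s, C ≤ y s) ∧ ∀ z, Tendsto y atTop (𝓝 z) → Xp ≤ z := by
  obtain ⟨C, hC⟩ := exists_bound_of_tendsto hXc hXm hXp
  have hpos : ∀ v w, runInf X v ≤ w → w < X v → 0 < f w (Λ v) := fun v w =>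
    pos_of_basin hf (hfbs v (runInf_mem_closure hXc hC v))
  have hsub : ∀ v, 0 ≤ f (runInf X v) (Λ v) := fun v => by
    rcases (runInf_le hC (le_refl v)).lt_or_eq with hlt | he
    · exact (hpos v _ le_rfl hlt).le
    · rw [he, heq]
  have hle := antitone_le_of_subsolution hf hΛ.continuous hΛ.tendsto_atBot h hμ.le
    (fun S => ⟨fun a b _ => .of_hasDerivAt hy a b, hlim⟩) (runInf_antitone hC)
    (runInf_continuous hXc hC) (runInf_tendsto hC hXm) hsub
  exact ⟨⟨-C, fun s => (le_runInf fun u _ => (abs_le.1 (hC u)).1).trans (hle s)⟩, fun z hz =>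
    le_limit_of_pos_below hf hΛ.tendsto_atTop hb hXp hμ hy (runInf_antitone hC) hle hpos hz⟩

theorem basin_refl {x z l : ℝ} (h : -x ∈ basin f z l) :
    x ∈ basin (fun x l => -f (-x) l) (-z) l := by
  obtain ⟨y, hy0, hy, hlim⟩ := h
  refine ⟨fun t => -y t, by simp only [hy0, neg_neg], fun t ht => ?_, hlim.neg⟩
  simp only [neg_neg]
  exact (hy t ht).neg

theorem ForwardBasinStable.refl (h : ForwardBasinStable f Λ X) :
    ForwardBasinStable (fun x l => -f (-x) l) Λ (fun s => -X s) := by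
  intro v x hx
  refine basin_refl (h v (map_mem_closure continuous_neg hx ?_))
  rintro _ ⟨u, hu, rfl⟩
  exact ⟨u, hu, (neg_neg _).symm⟩

/-- The upper estimate is the lower one for the reflected field, path and trajectory. The two
together bound the trajectory, hence it converges, and they pin down the limit. -/
theorem tendsto_of_basinStable (hf : ContDiff ℝ 2 (fun p : ℝ × ℝ => f p.1 p.2))
    (hΛ : IsParameterShift lm lp Λ) (h : dx f Xm lm < 0)
    (hb : ∀ x, f x lp = 0 → dx f x lp ≠ 0) (hXc : Continuous X)
    (hXm : Tendsto X atBot (𝓝 Xm)) (hXp : Tendsto X atTop (𝓝 Xp))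
    (heq : ∀ s, f (X s) (Λ s) = 0) (hfbs : ForwardBasinStable f Λ X) (hμ : 0 < μ)
    (hy : ∀ t, HasDerivAt y (μ * f (y t) (Λ t)) t) (hlim : Tendsto y atBot (𝓝 Xm)) :
    Tendsto y atTop (𝓝 Xp) := by
  obtain ⟨⟨C, hC⟩, h1⟩ :=
    lower_limit_of_basinStable hf hΛ h hb hXc hXm hXp heq hfbs hμ hy hlim
  obtain ⟨⟨D, hD⟩, h2⟩ := lower_limit_of_basinStable (y := fun t => -y t) (refl_contDiff hf) hΛ
    (Xm := -Xm) (by rw [dx_refl hf, neg_neg]; exact h)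
    (fun x hx => by rw [dx_refl hf]; exact hb _ (by simpa using hx)) hXc.neg hXm.neg hXp.neg
    (fun s => by simpa using heq s) hfbs.refl hμ (fun t => by
      simp only [neg_neg, mul_neg]
      exact (hy t).neg) hlim.neg
  obtain ⟨z, -, hz, -⟩ := exists_tendsto_of_mem_Icc (a := 0) hf hΛ.continuous hΛ.tendsto_atTop hb hμ
    (SolOn.of_hasDerivAt hy 0) (α := C) (β := -D)
    (.of_forall fun s => ⟨hC s, by linarith [hD s]⟩)
  have h3 := h1 z hz
  have h4 := h2 (-z) hz.neg
  rwa [le_antisymm h3 (neg_le_neg_iff.1 h4)]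

end BasinStable

/-! ### Tracking at all small rates. -/

section SlowTracking

variable {f : ℝ → ℝ → ℝ} {lm lp Xm Xp : ℝ} {B : ℝ → ℝ}

theorem exists_slow_past_tube (hf : ContDiff ℝ 2 (fun p : ℝ × ℝ => f p.1 p.2)) (hlt : lm < lp)
    (hB : ContinuousOn B (Icc lm lp)) (heq : ∀ l ∈ Icc lm lp, f (B l) l = 0)
    (hdx : ∀ l ∈ Icc lm lp, dx f (B l) l < 0) {ε : ℝ} (hε : 0 < ε) (K : ℝ) :
    ∃ μ₁, 0 < μ₁ ∧ ∀ μ, μ₁ ≤ μ → ∀ (Λ : ℝ → ℝ) (S : ℝ) (y : ℝ → ℝ), IsParameterShift lm lp Λ →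
      (∀ s ≤ S, ∀ s' ≤ S, |Λ s' - Λ s| ≤ K * |s' - s|) → PastSol f Λ μ (B lm) S y →
      |y S - B (Λ S)| ≤ ε := by
  obtain ⟨δ, hδ, hδε, H⟩ := exists_slow_tube hf hB heq hdx hε
  obtain ⟨μ₁, hμ₁, H₁⟩ := H K
  refine ⟨μ₁, hμ₁, fun μ hμ Λ S y hΛ hK hys => ?_⟩
  have hBlim : Tendsto (fun s => B (Λ s)) atBot (𝓝 (B lm)) := by
    refine (hB lm (left_mem_Icc.2 hlt.le)).tendsto.comp
      (tendsto_nhdsWithin_iff.2 ⟨hΛ.tendsto_atBot, .of_forall hΛ.mem_Icc⟩)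
  obtain ⟨a₁, ha₁⟩ := hys.exists_near (half_pos hδ)
  obtain ⟨a₂, ha₂⟩ := eventually_atBot.1 (hBlim.eventually (Metric.ball_mem_nhds _ (half_pos hδ)))
  set a := min S (min a₁ a₂)
  have haS : a ≤ S := min_le_left _ _
  have hya := abs_le.1 (ha₁ a ((min_le_right _ _).trans (min_le_left _ _)))
  have hBa : |B (Λ a) - B lm| < δ / 2 :=
    Real.dist_eq _ _ ▸ ha₂ a ((min_le_right _ _).trans (min_le_right _ _))
  have hBa' := abs_lt.1 hBa
  exact (H₁ μ hμ Λ a S y hΛ.continuous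
    (fun s _ => hΛ.mem_Icc s) (fun s hs s' hs' => hK s hs.2 s' hs'.2) (hys.sol a S le_rfl)
    (abs_le.2 ⟨by linarith, by linarith⟩) S ⟨haS, le_rfl⟩).trans hδε

/-- The threshold `r₁` depends on the shift only through a Lipschitz bound up to `S`. After `S` a
trap around `B lp` suffices, however fast the shift moves, so `r₁` survives every modification of
the shift after `S` that stays `η`-close to `lp`. -/
theorem exists_slow_tracking (hf : ContDiff ℝ 2 (fun p : ℝ × ℝ => f p.1 p.2))
    (hcomplete : ForwardComplete f lm lp) (hlt : lm < lp)
    (hXm : (B lm, lm) ∈ stabSet f lm lp) (hXp : (B lp, lp) ∈ stabSet f lm lp)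
    (hb : ∀ x, f x lp = 0 → dx f x lp ≠ 0) (hB : ContinuousOn B (Icc lm lp))
    (heq : ∀ l ∈ Icc lm lp, f (B l) l = 0) (hdx : ∀ l ∈ Icc lm lp, dx f (B l) l < 0) :
    ∃ η, 0 < η ∧ ∀ K, ∃ r₁, 0 < r₁ ∧ ∀ (Λ : ℝ → ℝ) (S : ℝ), IsParameterShift lm lp Λ →
      (∀ s ≤ S, ∀ s' ≤ S, |Λ s' - Λ s| ≤ K * |s' - s|) → (∀ s ≥ S, |Λ s - lp| ≤ η) →
      ∀ r, 0 < r → r < r₁ → TracksAt f Λ (B lm) (B lp) r := by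
  obtain ⟨ρ, η₁, hρ, -, hη₁, htrap, huniq⟩ := exists_trap hf hXp.1.1 hXp.2 one_pos
  obtain ⟨η₂, hη₂, hBη⟩ := Metric.continuousWithinAt_iff.1 (hB lp (right_mem_Icc.2 hlt.le))
    (ρ / 2) (half_pos hρ)
  refine ⟨min η₁ (η₂ / 2), lt_min hη₁ (half_pos hη₂), fun K => ?_⟩
  obtain ⟨μ₁, hμ₁, H₁⟩ := exists_slow_past_tube hf hlt hB heq hdx (half_pos hρ) K
  refine ⟨μ₁⁻¹, inv_pos.2 hμ₁, fun Λ S hΛ hK hS r hr hr₁ => ?_⟩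
  obtain ⟨x, hx⟩ := exists_pullbackAttractorFrom hf hcomplete hΛ hXm hr
  refine ⟨x, hx, (tendsto_rescale_iff (g := id) hr).1 ?_⟩
  have hyS := abs_le.1 (H₁ r⁻¹ ((le_inv_comm₀ hμ₁ hr).2 hr₁.le) Λ S _ hΛ hK (hx.pastSol hr S))
  have hBS : |B (Λ S) - B lp| < ρ / 2 := by
    have h1 := (hS S le_rfl).trans (min_le_right _ _)
    exact Real.dist_eq _ _ ▸ hBη (hΛ.mem_Icc S) (by rw [Real.dist_eq]; linarith)
  have hBS' := abs_lt.1 hBS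
  refine tendsto_of_trap hf hΛ.continuous hΛ.tendsto_atTop hb (inv_pos.2 hr) (a := S)
    (fun b => (hx.pastSol hr b).sol S b le_rfl)
    (fun s hs => (htrap _ ((hS s hs).trans (min_le_left _ _))).2)
    (fun s hs => (htrap _ ((hS s hs).trans (min_le_left _ _))).1)
    (fun w hw => huniq w (abs_le.2 ⟨by linarith [hw.1], by linarith [hw.2]⟩))
    ⟨?_, ?_⟩ <;> simp only [id_eq] <;> linarith

theorem exists_lipschitz_of_deriv_tendsto {g : ℝ → ℝ} (hg : ContDiff ℝ 2 g) {u v : ℝ}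
    (hu : Tendsto (deriv g) atBot (𝓝 u)) (hv : Tendsto (deriv g) atTop (𝓝 v)) :
    ∃ K, 0 ≤ K ∧ ∀ s s', |g s' - g s| ≤ K * |s' - s| := by
  obtain ⟨K, hK⟩ := exists_bound_of_tendsto (hg.continuous_deriv (by norm_num)) hu hv
  refine ⟨K, (abs_nonneg _).trans (hK 0), fun s s' => ?_⟩
  have := convex_univ.norm_image_sub_le_of_norm_deriv_le (f := g) (C := K)
    (fun x _ => hg.differentiable (by norm_num) x) (fun x _ => hK x) (mem_univ s)
    (mem_univ s')
  simpa [Real.norm_eq_abs] using this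

/-- The speed bound is known only within distance `D`; the barriers `x₀ ± (d + κ(s-a))` never leave
that region. -/
theorem SolOn.drift {Λ y : ℝ → ℝ} {μ a b x₀ d D κ : ℝ}
    (hf : ContDiff ℝ 2 (fun p : ℝ × ℝ => f p.1 p.2)) (hΛ : Continuous Λ)
    (hy : SolOn f Λ μ a b y) (hκ : 0 ≤ κ)
    (h : ∀ s ∈ Icc a b, ∀ x, |x - x₀| ≤ D → |μ * f x (Λ s)| ≤ κ)
    (hd : |y a - x₀| ≤ d) (hD : d + κ * (b - a) ≤ D) : ∀ t ∈ Icc a b, |y t - x₀| ≤ D := by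
  intro t ht
  have h0 := abs_le.1 hd
  have hd0 : 0 ≤ d := (abs_nonneg _).trans hd
  have hline : ∀ s ∈ Icc a b, |d + κ * (s - a)| ≤ D := fun s hs => by
    rw [abs_of_nonneg (add_nonneg hd0 (mul_nonneg hκ (sub_nonneg.2 hs.1)))]
    exact (by gcongr; exact hs.2 : d + κ * (s - a) ≤ d + κ * (b - a)).trans hD
  have up := comparison_field (z := fun s => (x₀ + d) + κ * (s - a)) hf hΛ hy.cont
    (Continuous.continuousOn (by fun_prop)) (fun _ => hy.subAt)
    (fun s hs => .of_deriv (hasDerivWithinAt_line _ _ _ _ _)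
      (abs_le.1 (h s (Ico_subset_Icc_self hs) _ (by
        simpa [add_assoc] using hline s (Ico_subset_Icc_self hs)))).2) (by simp; linarith) t ht
  have lo := comparison_field (y := fun s => (x₀ - d) + (-κ) * (s - a)) hf hΛ
    (Continuous.continuousOn (by fun_prop)) hy.cont
    (fun s hs => .of_deriv (hasDerivWithinAt_line _ _ _ _ _)
      (abs_le.1 (h s (Ico_subset_Icc_self hs) _ (by
        have := hline s (Ico_subset_Icc_self hs)
        rw [← abs_neg] at this
        refine le_of_eq_of_le ?_ this
        ring_nf))).1) (fun _ => hy.superAt) (by simp; linarith) t ht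
  have h1 := le_of_abs_le (hline t ht)
  exact abs_le.2 ⟨by linarith, by linarith⟩

end SlowTracking

/-! ### Failure of tracking at a fast rate. -/

section FastNontracking

variable {f : ℝ → ℝ → ℝ} {Λ : ℝ → ℝ} {lm lp Xm Xp : ℝ}

/-- Up to `s₀` the state is near `Xm` at every rate. On `[s₀, S]` a large rate makes the rescaled
field too weak to move it out of a trap around `Xm` and `Y`, and from `S` on this trap is invariant.
It contains no equilibrium at `lp` other than `Y`. -/
theorem exists_not_tracksAt (hf : ContDiff ℝ 2 (fun p : ℝ × ℝ => f p.1 p.2))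
    (hΛ : IsParameterShift lm lp Λ)
    (hXm : (Xm, lm) ∈ stabSet f lm lp) (hXp : f Xp lp = 0) {Y : ℝ} (hY : (Y, lp) ∈ stabSet f lm lp)
    (hne : Y ≠ Xp) (hbasin : Xm ∈ basin f Y lp) : ∃ R, 0 < R ∧ ¬ TracksAt f Λ Xm Xp R := by
  obtain ⟨α, β, hα, hβ, hαY, hβY, hpos, hneg⟩ := exists_basin_trap hf hbasin hY.1.1 hY.2
  have hXpn : Xp ∉ Icc α β := fun hmem => by
    rcases lt_or_gt_of_ne hne with hlt | hlt
    · exact (hneg Xp hlt hmem.2).ne hXp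
    · exact (hpos Xp hmem.1 hlt).ne' hXp
  obtain ⟨S₁, hS₁⟩ := eventually_atTop.1
    (((((continuous_param hf α).tendsto lp).comp hΛ.tendsto_atTop).eventually_const_lt
      (hpos α le_rfl hαY)).and
    ((((continuous_param hf β).tendsto lp).comp hΛ.tendsto_atTop).eventually_lt_const
      (hneg β hβY le_rfl)))
  set ε := min (Xm - α) (β - Xm)
  have hε : 0 < ε := lt_min (by linarith) (by linarith)
  obtain ⟨ρ, s₀, hρ, hρε, hs₀⟩ := exists_early_signs hf hΛ.tendsto_atBot hXm.1.1 hXm.2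
    (half_pos hε)
  obtain ⟨F, hF0, hF⟩ := exists_bound hf (|Xm| + ε) lm lp
  set S := max s₀ S₁
  -- This bounds the drift `R⁻¹ F (S - s₀)` by `ε / 2`; the summand `1` keeps `R` positive when `S =
  -- s₀`.
  set R := 2 * F * (S - s₀ + 1) / ε
  have hSs : 0 ≤ S - s₀ := sub_nonneg.2 (le_max_left _ _)
  have hR : 0 < R := by positivity
  refine ⟨R, hR, fun ⟨x, hx, hlim⟩ => hXpn ?_⟩
  have hys := hx.pastSol hR
  set y := fun s => x (R⁻¹ * s)
  have h1 : |y s₀ - Xm| ≤ ε / 2 := ((hys s₀).tube hf hΛ.continuous (inv_pos.2 hR).le hρ hs₀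
    le_rfl le_rfl).trans hρε
  have h2 : |y S - Xm| ≤ ε := by
    refine ((hys S).sol s₀ S le_rfl).drift hf hΛ.continuous (κ := R⁻¹ * F) (D := ε) (d := ε / 2)
      (by positivity) (fun s _ z hz => ?_) h1 ?_ S ⟨le_max_left _ _, le_rfl⟩
    · rw [abs_mul, abs_of_pos (inv_pos.2 hR)]
      gcongr
      refine hF z _ ?_ (hΛ.mem_Icc s)
      have := abs_add_le (z - Xm) Xm
      rw [sub_add_cancel] at this
      linarith
    · have : R⁻¹ * F * (S - s₀) ≤ ε / 2 := by
        rw [mul_assoc, inv_mul_le_iff₀ hR]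
        have : R * (ε / 2) = F * (S - s₀ + 1) := by
          simp only [R]; field_simp
        rw [this]
        gcongr
        linarith
      linarith
  have h3 := abs_le.1 h2
  have hyS : y S ∈ Icc α β :=
    ⟨by linarith [min_le_left (Xm - α) (β - Xm)], by linarith [min_le_right (Xm - α) (β - Xm)]⟩
  refine isClosed_Icc.mem_of_tendsto ((tendsto_rescale_iff (g := id) hR).2 hlim)
    (eventually_atTop.2 ⟨S, fun s hs => ?_⟩)
  exact ((hys s).sol S s le_rfl).mem_Icc hf hΛ.continuous (inv_pos.2 hR).le
    (fun t ht => (hS₁ t ((le_max_right _ _).trans ht.1)).1.le)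
    (fun t ht => (hS₁ t ((le_max_right _ _).trans ht.1)).2.le) hyS s ⟨hs, le_rfl⟩

end FastNontracking

/-! ### Construction of shifts: a fast jump, and an acceleration near the end. -/

section JumpShift

theorem expNegInvGlue_of_pos {x : ℝ} (h : 0 < x) : expNegInvGlue x = Real.exp (-x⁻¹) :=
  if_neg (not_le.2 h)

theorem expNegInvGlue_lt_one (x : ℝ) : expNegInvGlue x < 1 := by
  rcases le_or_gt x 0 with h | h
  · rw [expNegInvGlue.zero_of_nonpos h]; exact one_pos
  · rw [expNegInvGlue_of_pos h, Real.exp_lt_one_iff]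
    exact neg_lt_zero.2 (inv_pos.2 h)

theorem expNegInvGlue_tendsto : Tendsto expNegInvGlue atTop (𝓝 1) := by
  have h : Tendsto (fun x : ℝ => Real.exp (-x⁻¹)) atTop (𝓝 1) := by
    simpa [Function.comp_def] using (Real.continuous_exp.tendsto _).comp (tendsto_inv_atTop_zero (𝕜 := ℝ)).neg
  refine h.congr' ?_
  filter_upwards [eventually_gt_atTop 0] with x hx using (expNegInvGlue_of_pos hx).symm

theorem deriv_expNegInvGlue_atTop : Tendsto (deriv expNegInvGlue) atTop (𝓝 0) := by
  have h1 : Tendsto (fun x : ℝ => Real.exp (-x⁻¹) * (x ^ 2)⁻¹) atTop (𝓝 0) := by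
    have h2 : Tendsto (fun x : ℝ => Real.exp (-x⁻¹)) atTop (𝓝 1) := by
      simpa [Function.comp_def] using (Real.continuous_exp.tendsto _).comp (tendsto_inv_atTop_zero (𝕜 := ℝ)).neg
    simpa using h2.mul (tendsto_inv_atTop_zero.comp (tendsto_pow_atTop (α := ℝ) two_ne_zero))
  refine h1.congr' ?_
  filter_upwards [eventually_gt_atTop 0] with x hx
  have h2 : expNegInvGlue =ᶠ[𝓝 x] fun x => Real.exp (-x⁻¹) := by
    filter_upwards [Ioi_mem_nhds hx] with y hy using expNegInvGlue_of_pos hy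
  rw [h2.deriv_eq]
  have h3 := ((hasDerivAt_inv hx.ne').neg.exp).deriv
  simp only [neg_neg] at h3
  exact h3.symm

theorem deriv_expNegInvGlue_atBot : Tendsto (deriv expNegInvGlue) atBot (𝓝 0) := by
  refine tendsto_const_nhds.congr' ?_
  filter_upwards [eventually_lt_atBot 0] with x hx
  have h2 : expNegInvGlue =ᶠ[𝓝 x] fun _ => 0 := by
    filter_upwards [Iio_mem_nhds hx] with y hy
      using expNegInvGlue.zero_of_nonpos (le_of_lt hy)
  rw [h2.deriv_eq, deriv_const]

/-- A shift from `lm` to `lp` that moves from `p` to `q` during the time interval `[0, τ]` and then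
stays at `q` for a unit of time. -/
def jumpShift (lm lp p q τ s : ℝ) : ℝ :=
  lm + (p - lm) * (1 - expNegInvGlue (-s)) + (q - p) * Real.smoothTransition (s / τ) +
    (lp - q) * expNegInvGlue (s - τ - 1)

variable {lm lp p q τ s : ℝ}

/-- Here the formula is free of `τ`, and after `τ` it depends on `τ` only by translation. The speed
outside the jump is thus known before the duration of the jump is chosen. -/
theorem jumpShift_of_nonpos (hτ : 0 < τ) (hs : s ≤ 0) :
    jumpShift lm lp p q τ s = lm + (p - lm) * (1 - expNegInvGlue (-s)) := by
  rw [jumpShift, Real.smoothTransition.zero_of_nonpos (div_nonpos_of_nonpos_of_nonneg hs hτ.le),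
    expNegInvGlue.zero_of_nonpos (by linarith : s - τ - 1 ≤ 0)]
  ring

theorem jumpShift_of_ge (hτ : 0 < τ) (hs : τ ≤ s) :
    jumpShift lm lp p q τ s = q + (lp - q) * expNegInvGlue (s - τ - 1) := by
  rw [jumpShift, Real.smoothTransition.one_of_one_le ((one_le_div hτ).2 hs),
    expNegInvGlue.zero_of_nonpos (by linarith : -s ≤ 0)]
  ring

theorem jumpShift_of_mem (hs : s ∈ Icc 0 τ) :
    jumpShift lm lp p q τ s = p + (q - p) * Real.smoothTransition (s / τ) := by
  rw [jumpShift, expNegInvGlue.zero_of_nonpos (by linarith [hs.1] : -s ≤ 0),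
    expNegInvGlue.zero_of_nonpos (by linarith [hs.2] : s - τ - 1 ≤ 0)]
  ring

theorem isParameterShift_jumpShift (hp : p ∈ Ioo lm lp) (hq : q ∈ Ioo lm lp) (hτ : 0 < τ) :
    IsParameterShift lm lp (jumpShift lm lp p q τ) := by
  have hg : ContDiff ℝ 2 expNegInvGlue := expNegInvGlue.contDiff
  have hgd : Differentiable ℝ expNegInvGlue := hg.differentiable (by norm_num)
  have hbot : ∀ s < 0, deriv (jumpShift lm lp p q τ) s = (p - lm) * deriv expNegInvGlue (-s) := by
    intro s hs
    have h2 : jumpShift lm lp p q τ =ᶠ[𝓝 s]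
        fun s => lm + (p - lm) * (1 - expNegInvGlue (-s)) := by
      filter_upwards [Iio_mem_nhds hs] with t ht using jumpShift_of_nonpos hτ (le_of_lt ht)
    rw [h2.deriv_eq]
    have h3 := ((((hgd (-s)).hasDerivAt.comp s (hasDerivAt_neg s)).const_sub 1).const_mul
      (p - lm)).const_add lm
    refine h3.deriv.trans ?_
    ring
  have htop : ∀ s > τ, deriv (jumpShift lm lp p q τ) s =
      (lp - q) * deriv expNegInvGlue (s - τ - 1) := by
    intro s hs
    have h2 : jumpShift lm lp p q τ =ᶠ[𝓝 s]
        fun s => q + (lp - q) * expNegInvGlue (s - τ - 1) := by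
      filter_upwards [Ioi_mem_nhds hs] with t ht using jumpShift_of_ge hτ (le_of_lt ht)
    rw [h2.deriv_eq]
    have h3 := (((hgd (s - τ - 1)).hasDerivAt.comp s
      (((hasDerivAt_id s).sub_const τ).sub_const 1)).const_mul (lp - q)).const_add q
    refine h3.deriv.trans ?_
    ring
  have hshift : Tendsto (fun s : ℝ => s - τ - 1) atTop atTop :=
    tendsto_atTop_add_const_right _ _ (tendsto_atTop_add_const_right _ _ tendsto_id)
  refine ⟨?_, fun s => ?_, ?_, ?_, ?_, ?_⟩
  · have hb : ContDiff ℝ 2 Real.smoothTransition := Real.smoothTransition.contDiff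
    unfold jumpShift
    exact ((contDiff_const.add (contDiff_const.mul (contDiff_const.sub (hg.comp contDiff_neg)))).add
      (contDiff_const.mul (hb.comp (contDiff_id.div_const τ)))).add
      (contDiff_const.mul (hg.comp ((contDiff_id.sub contDiff_const).sub contDiff_const)))
  · have hp1 := sub_pos.2 hp.1
    have hq2 := sub_pos.2 hq.2
    rcases le_total s 0 with h | h
    · rw [jumpShift_of_nonpos hτ h]
      have h1 := expNegInvGlue_lt_one (-s)
      have h2 := expNegInvGlue.nonneg (-s)
      have h3 := mul_pos hp1 (sub_pos.2 h1)
      have h4 := mul_nonneg hp1.le h2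
      exact ⟨by linarith, by linarith [hp.2]⟩
    · rcases le_total s τ with h' | h'
      · rw [jumpShift_of_mem ⟨h, h'⟩]
        have h1 := Real.smoothTransition.nonneg (s / τ)
        have h2 := Real.smoothTransition.le_one (s / τ)
        have := (convex_Ioo lm lp) hp hq (sub_nonneg.2 h2) h1 (by ring)
        convert this using 1
        simp only [smul_eq_mul]
        ring
      · rw [jumpShift_of_ge hτ h']
        have h1 := expNegInvGlue_lt_one (s - τ - 1)
        have h2 := expNegInvGlue.nonneg (s - τ - 1)
        have h3 := mul_pos hq2 (sub_pos.2 h1)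
        have h4 := mul_nonneg hq2.le h2
        exact ⟨by linarith [hq.1], by linarith⟩
  · have h1 : Tendsto (fun s => lm + (p - lm) * (1 - expNegInvGlue (-s))) atBot (𝓝 lm) := by
      simpa using (((expNegInvGlue_tendsto.comp tendsto_neg_atBot_atTop).const_sub 1).const_mul
        (p - lm)).const_add lm
    refine h1.congr' ?_
    filter_upwards [eventually_le_atBot 0] with s hs using (jumpShift_of_nonpos hτ hs).symm
  · have h1 : Tendsto (fun s => q + (lp - q) * expNegInvGlue (s - τ - 1)) atTop (𝓝 lp) := by
      simpa using ((expNegInvGlue_tendsto.comp hshift).const_mul (lp - q)).const_add q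
    refine h1.congr' ?_
    filter_upwards [eventually_ge_atTop τ] with s hs using (jumpShift_of_ge hτ hs).symm
  · have h1 := (deriv_expNegInvGlue_atTop.comp tendsto_neg_atBot_atTop).const_mul (p - lm)
    rw [mul_zero] at h1
    refine h1.congr' ?_
    filter_upwards [eventually_lt_atBot 0] with s hs using (hbot s hs).symm
  · have h1 := (deriv_expNegInvGlue_atTop.comp hshift).const_mul (lp - q)
    rw [mul_zero] at h1
    refine h1.congr' ?_
    filter_upwards [eventually_gt_atTop τ] with s hs using (htop s hs).symm

/-- The time change `s ↦ s + K` after the time `S + τ`, trivial before the time `S`. -/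
def timeSkip (S K τ s : ℝ) : ℝ := s + K * Real.smoothTransition ((s - S) / τ)

variable {S K : ℝ}

theorem timeSkip_of_le (hτ : 0 < τ) (hs : s ≤ S) : timeSkip S K τ s = s := by
  rw [timeSkip, Real.smoothTransition.zero_of_nonpos
    (div_nonpos_of_nonpos_of_nonneg (sub_nonpos.2 hs) hτ.le), mul_zero, add_zero]

theorem timeSkip_of_ge (hτ : 0 < τ) (hs : S + τ ≤ s) : timeSkip S K τ s = s + K := by
  rw [timeSkip, Real.smoothTransition.one_of_one_le ((one_le_div hτ).2 (by linarith)), mul_one]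

theorem le_timeSkip (hK : 0 ≤ K) : s ≤ timeSkip S K τ s :=
  le_add_of_nonneg_right (mul_nonneg hK (Real.smoothTransition.nonneg _))

theorem IsParameterShift.comp_timeSkip {Λ : ℝ → ℝ} (hΛ : IsParameterShift lm lp Λ)
    (hτ : 0 < τ) : IsParameterShift lm lp (fun s => Λ (timeSkip S K τ s)) := by
  have hbot : ∀ s < S, (fun s => Λ (timeSkip S K τ s)) =ᶠ[𝓝 s] Λ := fun s hs => by
    filter_upwards [Iio_mem_nhds hs] with t ht
    rw [timeSkip_of_le hτ (le_of_lt ht)]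
  have htop : ∀ s > S + τ, (fun s => Λ (timeSkip S K τ s)) =ᶠ[𝓝 s] fun s => Λ (s + K) :=
    fun s hs => by
      filter_upwards [Ioi_mem_nhds hs] with t ht
      rw [timeSkip_of_ge hτ (le_of_lt ht)]
  have hshift : Tendsto (fun s : ℝ => s + K) atTop atTop :=
    tendsto_atTop_add_const_right _ _ tendsto_id
  refine ⟨?_, fun s => hΛ.mem_Ioo _, ?_, ?_, ?_, ?_⟩
  · have hb : ContDiff ℝ 2 Real.smoothTransition := Real.smoothTransition.contDiff
    exact hΛ.contDiff.comp (contDiff_id.add (contDiff_const.mul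
      (hb.comp ((contDiff_id.sub contDiff_const).div_const τ))))
  · refine hΛ.tendsto_atBot.congr' ?_
    filter_upwards [eventually_lt_atBot S] with s hs using (hbot s hs).eq_of_nhds.symm
  · refine (hΛ.tendsto_atTop.comp hshift).congr' ?_
    filter_upwards [eventually_gt_atTop (S + τ)] with s hs using (htop s hs).eq_of_nhds.symm
  · refine hΛ.deriv_atBot.congr' ?_
    filter_upwards [eventually_lt_atBot S] with s hs using (hbot s hs).deriv_eq.symm
  · refine (hΛ.deriv_atTop.comp hshift).congr' ?_
    filter_upwards [eventually_gt_atTop (S + τ)] with s hs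
    rw [(htop s hs).deriv_eq, deriv_comp_add_const]
    rfl

end JumpShift

/-! ### A jump from one branch into the basin of another. -/

section Jump

variable {f : ℝ → ℝ → ℝ} {lm lp : ℝ} {B Y : ℝ → ℝ}

/-- The barrier rises from `α` with slope `μκ` and is cut off at `γ`; it is a subsolution in the
right-hand sense despite its kink. -/
theorem SolOn.enter {Λ y : ℝ → ℝ} {μ a b α γ κ : ℝ}
    (hf : ContDiff ℝ 2 (fun p : ℝ × ℝ => f p.1 p.2)) (hΛ : Continuous Λ) (hab : a ≤ b)
    (hμ : 0 ≤ μ) (hy : SolOn f Λ μ a b y) (hκ : 0 ≤ κ) (hαγ : α ≤ γ)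
    (h : ∀ s ∈ Ico a b, ∀ w ∈ Icc α γ, κ ≤ f w (Λ s)) (ha : α ≤ y a)
    (hlong : γ - α ≤ μ * κ * (b - a)) : γ ≤ y b := by
  have hcont : Continuous fun t => min (α + μ * κ * (t - a)) γ := by fun_prop
  have := comparison_field (y := fun t => min (α + μ * κ * (t - a)) γ) hf hΛ hcont.continuousOn
    hy.cont (fun t ht ε hε => by
      filter_upwards [self_mem_nhdsWithin] with t' (ht' : t < t')
      have h0 : 0 ≤ μ * κ * (t - a) := mul_nonneg (mul_nonneg hμ hκ) (sub_nonneg.2 ht.1)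
      have h1 := mul_le_mul_of_nonneg_left (h t ht (min (α + μ * κ * (t - a)) γ)
        ⟨le_min (by linarith) hαγ, min_le_right _ _⟩) hμ
      have h2 : μ * κ * (t' - t) ≤
          (μ * f (min (α + μ * κ * (t - a)) γ) (Λ t) + ε) * (t' - t) :=
        mul_le_mul_of_nonneg_right (by linarith) (sub_pos.2 ht').le
      have h3 : 0 ≤ μ * κ * (t' - t) := mul_nonneg (mul_nonneg hμ hκ) (sub_pos.2 ht').le
      refine le_trans ?_ (add_le_add_right h2 _)
      rcases min_choice (α + μ * κ * (t - a)) γ with he | he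
      · rw [he]
        refine (min_le_left _ _).trans (le_of_eq (by ring))
      · rw [he]
        exact (min_le_right _ _).trans (by linarith)) (fun _ => hy.superAt)
    ((min_le_left _ _).trans (by simpa using ha)) b ⟨hab, le_rfl⟩
  rwa [min_eq_right (by linarith)] at this

/-- A fast passage from `p` to `q` carries the trajectory from the branch `B` to the branch `Y`,
whatever the continuation close to `lp`. -/
theorem exists_jump_not_tracksAt (hf : ContDiff ℝ 2 (fun p : ℝ × ℝ => f p.1 p.2)) (hlt : lm < lp)
    (hB : ContinuousOn B (Icc lm lp)) (heq : ∀ l ∈ Icc lm lp, f (B l) l = 0)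
    (hdx : ∀ l ∈ Icc lm lp, dx f (B l) l < 0) {p q : ℝ} (hp : p ∈ Ioo lm lp) (hq : q ∈ Ioo lm lp)
    (hY : ContinuousOn Y (Icc q lp)) (hYeq : ∀ l ∈ Icc q lp, f (Y l) l = 0)
    (hYdx : ∀ l ∈ Icc q lp, dx f (Y l) l < 0) {Xp : ℝ} (hne : Y lp ≠ Xp)
    (hbasin : B p ∈ basin f (Y q) q) :
    ∃ τ η R, 0 < τ ∧ 0 < η ∧ 0 < R ∧ ∀ S ≥ 2, ∀ Λ, IsParameterShift lm lp Λ →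
      (∀ s ≤ S, Λ s = jumpShift lm lp p q τ s) → (∀ s ≥ S, |Λ s - lp| ≤ η) →
      ¬ TracksAt f Λ (B lm) Xp R := by
  obtain ⟨Kg, hKg0, hKg⟩ := exists_lipschitz_of_deriv_tendsto expNegInvGlue.contDiff
    deriv_expNegInvGlue_atBot deriv_expNegInvGlue_atTop
  have hqlp : q ∈ Icc q lp := ⟨le_rfl, hq.2.le⟩
  have hlpq : lp ∈ Icc q lp := ⟨hq.2.le, le_rfl⟩
  obtain ⟨α, β, hα, hβ, hαY, hβY, hpos, hneg⟩ :=
    exists_basin_trap hf hbasin (hYeq q hqlp) (hYdx q hqlp)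
  obtain ⟨ρ, η₁, hρ, hρne, hη₁, htrap, -⟩ := exists_trap hf (hYeq lp hlpq) (hYdx lp hlpq)
    (half_pos (abs_pos.2 (sub_ne_zero.2 hne)))
  obtain ⟨η₂, hη₂, hYη⟩ := Metric.continuousWithinAt_iff.1 (hY lp hlpq) (ρ / 2) (half_pos hρ)
  obtain ⟨δ, hδ, hδρ, H⟩ := exists_slow_tube hf hY hYeq hYdx (half_pos hρ)
  obtain ⟨μ₄, hμ₄, H₄⟩ := H ((lp - q) * Kg)
  set ε := min (B p - α) (β - B p)
  have hε : 0 < ε := lt_min (by linarith) (by linarith)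
  obtain ⟨μ₁, hμ₁, H₁⟩ := exists_slow_past_tube hf hlt hB heq hdx (half_pos hε) ((p - lm) * Kg)
  obtain ⟨F, hF0, hF⟩ := exists_bound hf (|B p| + ε) lm lp
  -- Between the ends of the basin trap and the tube around `Y q` the field is bounded away from
  -- zero, which bounds the time needed to enter the tube.
  set γ := max α (Y q - δ)
  set γ' := min β (Y q + δ)
  have hγ : γ < Y q := max_lt hαY (by linarith)
  have hγ' : Y q < γ' := lt_min hβY (by linarith)
  obtain ⟨w, hw, hwmin⟩ := isCompact_Icc.exists_isMinOn (nonempty_Icc.2 (le_max_left α (Y q - δ)))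
    (continuous_state hf q).continuousOn
  obtain ⟨w', hw', hwmax⟩ := isCompact_Icc.exists_isMaxOn (nonempty_Icc.2 (min_le_left β (Y q + δ)))
    (continuous_state hf q).continuousOn
  have hκ : 0 < f w q := hpos w hw.1 (hw.2.trans_lt hγ)
  have hκ' : f w' q < 0 := hneg w' (hγ'.trans_le hw'.1) hw'.2
  set μ := max (max μ₁ μ₄) (max ((γ - α) / f w q) ((β - γ') / -f w' q))
  have hμ1 : μ₁ ≤ μ := (le_max_left _ _).trans (le_max_left _ _)
  have hμ4 : μ₄ ≤ μ := (le_max_right _ _).trans (le_max_left _ _)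
  have hμk : γ - α ≤ μ * f w q :=
    (div_le_iff₀ hκ).1 ((le_max_left _ _).trans (le_max_right _ _))
  have hμk' : β - γ' ≤ μ * -f w' q :=
    (div_le_iff₀ (neg_pos.2 hκ')).1 ((le_max_right _ _).trans (le_max_right _ _))
  have hμ : 0 < μ := hμ₁.trans_le hμ1
  set τ := min 1 (ε / 2 / (μ * F))
  have hτ : 0 < τ := lt_min one_pos (by positivity)
  have hτ1 : τ ≤ 1 := min_le_left _ _
  have hτF : μ * F * τ ≤ ε / 2 := by
    have : τ ≤ ε / 2 / (μ * F) := min_le_right _ _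
    rw [mul_comm]
    exact (le_div_iff₀ (by positivity)).1 this
  refine ⟨τ, min η₁ (η₂ / 2), μ⁻¹, hτ, lt_min hη₁ (half_pos hη₂), inv_pos.2 hμ, ?_⟩
  rintro S hS Λ hΛ hΛj hΛS ⟨x, hx, hlim⟩
  have hys := hx.pastSol (inv_pos.2 hμ)
  have hlim' := (tendsto_rescale_iff (g := id) (inv_pos.2 hμ)).2 hlim
  rw [inv_inv] at hys hlim'
  set y := fun s => x (μ * s)
  have hsol : ∀ a b, SolOn f Λ μ a b y := fun a b => (hys b).sol a b le_rfl
  have hΛ0 : ∀ s ≤ 0, Λ s = lm + (p - lm) * (1 - expNegInvGlue (-s)) := fun s hs => by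
    rw [hΛj s (by linarith), jumpShift_of_nonpos hτ hs]
  have hΛτ : ∀ s ∈ Icc τ S, Λ s = q + (lp - q) * expNegInvGlue (s - τ - 1) := fun s hs => by
    rw [hΛj s hs.2, jumpShift_of_ge hτ hs.1]
  have h0 : |y 0 - B p| ≤ ε / 2 := by
    have h1 : Λ 0 = p := by
      rw [hΛ0 0 le_rfl, neg_zero, expNegInvGlue.zero]
      ring
    have h2 := H₁ μ hμ1 Λ 0 y hΛ (fun s hs s' hs' => ?_) (hys 0)
    · rwa [h1] at h2
    · rw [hΛ0 s hs, hΛ0 s' hs']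
      have e : lm + (p - lm) * (1 - expNegInvGlue (-s')) - (lm + (p - lm) *
        (1 - expNegInvGlue (-s))) = (p - lm) * (expNegInvGlue (-s) - expNegInvGlue (-s')) := by ring
      have h3 := hKg (-s') (-s)
      rw [neg_sub_neg] at h3
      rw [e, abs_mul, abs_of_pos (sub_pos.2 hp.1), mul_assoc]
      gcongr
      exact (sub_pos.2 hp.1).le
  have h1 : |y τ - B p| ≤ ε := by
    refine (hsol 0 τ).drift hf hΛ.continuous (κ := μ * F) (D := ε) (by positivity)
      (fun s _ z hz => ?_) h0 (by linarith) τ ⟨hτ.le, le_rfl⟩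
    rw [abs_mul, abs_of_pos hμ]
    gcongr
    refine hF z _ ?_ (hΛ.mem_Icc s)
    have := abs_add_le (z - B p) (B p)
    rw [sub_add_cancel] at this
    linarith
  have h1' := abs_le.1 h1
  have hε1 : ε ≤ B p - α := min_le_left _ _
  have hε2 : ε ≤ β - B p := min_le_right _ _
  have hhold : ∀ s ∈ Ico τ (τ + 1), Λ s = q := fun s hs => by
    rw [hΛτ s ⟨hs.1, by linarith [hs.2]⟩, expNegInvGlue.zero_of_nonpos (by linarith [hs.2])]
    ring
  have hlow : γ ≤ y (τ + 1) := by
    refine (hsol τ (τ + 1)).enter hf hΛ.continuous (by linarith) hμ.le hκ.le (le_max_left _ _)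
      (fun s hs v hv => ?_) (α := α) (by linarith) (by linarith)
    rw [hhold s hs]
    exact hwmin hv
  have hhigh : y (τ + 1) ≤ γ' := by
    refine neg_le_neg_iff.1 (SolOn.enter (y := fun t => -y t) (α := -β) (γ := -γ')
      (κ := -f w' q) (refl_contDiff hf) hΛ.continuous (by linarith) hμ.le
      (hsol τ (τ + 1)).refl_sol (by linarith) (neg_le_neg (min_le_left _ _)) (fun s hs v hv => ?_)
      (neg_le_neg (by linarith)) (by linarith))
    rw [hhold s hs]
    exact neg_le_neg (hwmax ⟨by linarith [hv.2], by linarith [hv.1]⟩)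
  have hγδ : Y q - δ ≤ γ := le_max_right _ _
  have hγδ' : γ' ≤ Y q + δ := min_le_right _ _
  have hτS : τ + 1 ≤ S := by linarith
  have h2 : |y S - Y (Λ S)| ≤ δ := by
    refine H₄ μ hμ4 Λ (τ + 1) S y hΛ.continuous (fun s hs => ?_) (fun s hs s' hs' => ?_) (hsol _ _)
      ?_ S ⟨hτS, le_rfl⟩
    · refine ⟨?_, (hΛ.mem_Icc s).2⟩
      rw [hΛτ s ⟨by linarith [hs.1], hs.2⟩]
      exact le_add_of_nonneg_right
        (mul_nonneg (sub_pos.2 hq.2).le (expNegInvGlue.nonneg _))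
    · rw [hΛτ s ⟨by linarith [hs.1], hs.2⟩, hΛτ s' ⟨by linarith [hs'.1], hs'.2⟩,
        add_sub_add_left_eq_sub, ← mul_sub, abs_mul, abs_of_pos (sub_pos.2 hq.2), mul_assoc]
      have h3 := hKg (s - τ - 1) (s' - τ - 1)
      have e : s' - τ - 1 - (s - τ - 1) = s' - s := by ring
      rw [e] at h3
      gcongr
      exact (sub_pos.2 hq.2).le
    · have h3 : Λ (τ + 1) = q := by
        rw [hΛτ (τ + 1) ⟨by linarith, hτS⟩, expNegInvGlue.zero_of_nonpos (by linarith)]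
        ring
      rw [h3]
      exact abs_le.2 ⟨by linarith, by linarith⟩
  have h3 : |Y (Λ S) - Y lp| < ρ / 2 := by
    have h4 := (hΛS S le_rfl).trans (min_le_right _ _)
    refine Real.dist_eq _ _ ▸ hYη ⟨?_, (hΛ.mem_Icc S).2⟩ (by rw [Real.dist_eq]; linarith)
    rw [hΛτ S ⟨by linarith, le_rfl⟩]
    exact le_add_of_nonneg_right (mul_nonneg (sub_pos.2 hq.2).le (expNegInvGlue.nonneg _))
  have h2' := abs_le.1 h2
  have h3' := abs_lt.1 h3
  have hXp : Xp ∈ Icc (Y lp - ρ) (Y lp + ρ) := by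
    refine isClosed_Icc.mem_of_tendsto hlim' (eventually_atTop.2 ⟨S, fun s hs => ?_⟩)
    exact (hsol S s).mem_Icc hf hΛ.continuous hμ.le
      (fun t ht => (htrap _ ((hΛS t ht.1).trans (min_le_left _ _))).2)
      (fun t ht => (htrap _ ((hΛS t ht.1).trans (min_le_left _ _))).1)
      ⟨by linarith, by linarith⟩ s ⟨hs, le_rfl⟩
  have h5 : |Y lp - Xp| ≤ ρ := abs_le.2 ⟨by linarith [hXp.2], by linarith [hXp.1]⟩
  have h6 := abs_pos.2 (sub_ne_zero.2 hne)
  linarith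

end Jump

/-! ### Making the critical limit finite. -/

section FiniteLimit

variable {f : ℝ → ℝ → ℝ} {Λ : ℝ → ℝ} {lm lp Xm Xp : ℝ}

theorem exists_sign_near (hf : ContDiff ℝ 2 (fun p : ℝ × ℝ => f p.1 p.2)) {N l : ℝ}
    (h : f N l ≠ 0) : ∃ η, 0 < η ∧
      ((∀ l', |l' - l| ≤ η → f N l' ≤ 0) ∨ ∀ l', |l' - l| ≤ η → 0 ≤ f N l') := by
  have hc := (continuous_param hf N).tendsto l
  rcases h.lt_or_gt with h | h
  · obtain ⟨η, hη, H⟩ := Metric.eventually_nhds_iff.1 (hc.eventually_lt_const h)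
    exact ⟨η / 2, by positivity,
      .inl fun l' hl' => (H (by rw [Real.dist_eq]; linarith : dist l' l < η)).le⟩
  · obtain ⟨η, hη, H⟩ := Metric.eventually_nhds_iff.1 (hc.eventually_const_lt h)
    exact ⟨η / 2, by positivity,
      .inr fun l' hl' => (H (by rw [Real.dist_eq]; linarith : dist l' l < η)).le⟩

theorem exists_near_smaller_rate (hf : ContDiff ℝ 2 (fun p : ℝ × ℝ => f p.1 p.2))
    (hΛ : IsParameterShift lm lp Λ) (hXm : (Xm, lm) ∈ stabSet f lm lp) {r₀ : ℝ} (hr₀ : 0 < r₀)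
    {x : ℝ → ℝ} (hx : IsPullbackAttractorFrom f Λ r₀ Xm x)
    (htr : ∀ r, 0 < r → r < r₀ → TracksAt f Λ Xm Xp r) (s : ℝ) {ε : ℝ} (hε : 0 < ε) :
    ∃ r x', 0 < r ∧ IsPullbackAttractorFrom f Λ r Xm x' ∧ Tendsto x' atTop (𝓝 Xp) ∧
      |x' (r⁻¹ * s) - x (r₀⁻¹ * s)| ≤ ε := by
  obtain ⟨η, hη, H⟩ := exists_near_rate hf hΛ hXm hr₀ hx s hε
  obtain ⟨r, hr1, hr2⟩ := exists_between (max_lt hr₀ (sub_lt_self r₀ hη))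
  obtain ⟨hr, hrη⟩ := max_lt_iff.1 hr1
  obtain ⟨x', hx', hlim⟩ := htr r hr hr2
  exact ⟨r, x', hr, hx', hlim, H r x' hr hx' (abs_lt.2 ⟨by linarith, by linarith⟩)⟩

/-- A level with inward sign is a barrier. With outward sign it cannot be recrossed inwards: if the
critical trajectory exceeded `N`, so would those of slightly smaller rates, and they could not
return to `Xp < N`. -/
theorem critical_le (hf : ContDiff ℝ 2 (fun p : ℝ × ℝ => f p.1 p.2))
    (hΛ : IsParameterShift lm lp Λ) (hXm : (Xm, lm) ∈ stabSet f lm lp) {r₀ : ℝ} (hr₀ : 0 < r₀)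
    {x : ℝ → ℝ} (hx : IsPullbackAttractorFrom f Λ r₀ Xm x)
    (htr : ∀ r, 0 < r → r < r₀ → TracksAt f Λ Xm Xp r) {N S : ℝ} (hN : Xp < N)
    (hsign : (∀ s ≥ S, f N (Λ s) ≤ 0) ∨ ∀ s ≥ S, 0 ≤ f N (Λ s)) (hS : x (r₀⁻¹ * S) ≤ N) :
    ∀ s ≥ S, x (r₀⁻¹ * s) ≤ N := by
  intro s hs
  rcases hsign with h | h
  · exact ((hx.pastSol hr₀ s).sol S s le_rfl).le_const hf hΛ.continuous (inv_pos.2 hr₀).le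
      (fun t ht => h t ht.1) hS s ⟨hs, le_rfl⟩
  · by_contra! hlt
    obtain ⟨r, x', hr, hx', hlim, hd⟩ :=
      exists_near_smaller_rate hf hΛ hXm hr₀ hx htr s (sub_pos.2 hlt)
    refine not_le.2 hN (ge_of_tendsto ((tendsto_rescale_iff (g := id) hr).2 hlim)
      (eventually_atTop.2 ⟨s, fun t ht => ?_⟩))
    exact ((hx'.pastSol hr t).sol s t le_rfl).const_le hf hΛ.continuous (inv_pos.2 hr).le
      (fun u hu => h u (hs.le.trans hu.1)) (by linarith [(abs_le.1 hd).1]) t ⟨ht, le_rfl⟩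

theorem le_critical (hf : ContDiff ℝ 2 (fun p : ℝ × ℝ => f p.1 p.2))
    (hΛ : IsParameterShift lm lp Λ) (hXm : (Xm, lm) ∈ stabSet f lm lp) {r₀ : ℝ} (hr₀ : 0 < r₀)
    {x : ℝ → ℝ} (hx : IsPullbackAttractorFrom f Λ r₀ Xm x)
    (htr : ∀ r, 0 < r → r < r₀ → TracksAt f Λ Xm Xp r) {N S : ℝ} (hN : N < Xp)
    (hsign : (∀ s ≥ S, f N (Λ s) ≤ 0) ∨ ∀ s ≥ S, 0 ≤ f N (Λ s)) (hS : N ≤ x (r₀⁻¹ * S)) :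
    ∀ s ≥ S, N ≤ x (r₀⁻¹ * s) := by
  intro s hs
  rcases hsign with h | h
  · by_contra! hlt
    obtain ⟨r, x', hr, hx', hlim, hd⟩ :=
      exists_near_smaller_rate hf hΛ hXm hr₀ hx htr s (sub_pos.2 hlt)
    refine not_le.2 hN (le_of_tendsto ((tendsto_rescale_iff (g := id) hr).2 hlim)
      (eventually_atTop.2 ⟨s, fun t ht => ?_⟩))
    exact ((hx'.pastSol hr t).sol s t le_rfl).le_const hf hΛ.continuous (inv_pos.2 hr).le
      (fun u hu => h u (hs.le.trans hu.1)) (by linarith [(abs_le.1 hd).2]) t ⟨ht, le_rfl⟩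
  · exact ((hx.pastSol hr₀ s).sol S s le_rfl).const_le hf hΛ.continuous (inv_pos.2 hr₀).le
      (fun t ht => h t ht.1) hS s ⟨hs, le_rfl⟩

/-- The state at `S` depends continuously on the rate over a compact interval. The bound concerns
solutions up to `S` only, so it also holds for shifts altered after `S`. -/
theorem exists_bound_of_rates (hf : ContDiff ℝ 2 (fun p : ℝ × ℝ => f p.1 p.2))
    (hcomplete : ForwardComplete f lm lp)
    (hΛ : IsParameterShift lm lp Λ) (hXm : (Xm, lm) ∈ stabSet f lm lp) {r₁ : ℝ} (hr₁ : 0 < r₁)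
    (R S : ℝ) : ∃ M, ∀ r ∈ Icc r₁ R, ∀ y, PastSol f Λ r⁻¹ Xm S y → |y S| ≤ M := by
  choose x hx using fun r : {r : ℝ // 0 < r} =>
    exists_pullbackAttractorFrom hf hcomplete hΛ hXm r.2
  set φ : ℝ → ℝ := fun r => if h : 0 < r then x ⟨r, h⟩ (r⁻¹ * S) else 0
  have hφ : ∀ r (h : 0 < r), φ r = x ⟨r, h⟩ (r⁻¹ * S) := fun r h => dif_pos h
  have hcont : ContinuousOn φ (Icc r₁ R) := by
    refine Metric.continuousOn_iff.2 fun r hr ε hε => ?_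
    have hr0 := hr₁.trans_le hr.1
    obtain ⟨η, hη, H⟩ := exists_near_rate hf hΛ hXm hr0 (hx ⟨r, hr0⟩) S (half_pos hε)
    refine ⟨η, hη, fun r' hr' hd => ?_⟩
    have hr'0 := hr₁.trans_le hr'.1
    rw [Real.dist_eq, hφ r hr0, hφ r' hr'0]
    linarith [H r' _ hr'0 (hx ⟨r', hr'0⟩) (Real.dist_eq r' r ▸ hd)]
  obtain ⟨M, hM⟩ := isCompact_Icc.exists_bound_of_continuousOn hcont
  refine ⟨M, fun r hr y hy => ?_⟩
  have hr0 := hr₁.trans_le hr.1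
  rw [hy.unique hf hΛ.continuous hΛ.tendsto_atBot hXm.1.1 hXm.2 (inv_pos.2 hr0)
    ((hx ⟨r, hr0⟩).pastSol hr0 S) S le_rfl, ← hφ r hr0]
  exact hM r hr

/-- A shift on which the trajectory escapes at some rate can be accelerated close to `lp` so that
the limit at the critical rate is finite. -/
theorem exists_finite_critical (hf : ContDiff ℝ 2 (fun p : ℝ × ℝ => f p.1 p.2))
    (hcomplete : ForwardComplete f lm lp)
    (hΛ : IsParameterShift lm lp Λ) (hXm : (Xm, lm) ∈ stabSet f lm lp)
    (hXp : (Xp, lp) ∈ stabSet f lm lp) (hb : ∀ x, f x lp = 0 → dx f x lp ≠ 0)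
    {η r₁ R S : ℝ} (hr₁ : 0 < r₁) (hR : 0 < R) (hS : ∀ s ≥ S, |Λ s - lp| ≤ η)
    (hsmall : ∀ Λ', IsParameterShift lm lp Λ' → (∀ s ≤ S, Λ' s = Λ s) →
      (∀ s ≥ S, |Λ' s - lp| ≤ η) → ∀ r, 0 < r → r < r₁ → TracksAt f Λ' Xm Xp r)
    (hnot : ∀ Λ', IsParameterShift lm lp Λ' → (∀ s ≤ S, Λ' s = Λ s) →
      (∀ s ≥ S, |Λ' s - lp| ≤ η) → ¬ TracksAt f Λ' Xm Xp R) :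
    ∃ Λ', IsParameterShift lm lp Λ' ∧ ∃ r₀, 0 < r₀ ∧
      (∀ r, 0 < r → r < r₀ → TracksAt f Λ' Xm Xp r) ∧
      ∃ x, IsPullbackAttractorFrom f Λ' r₀ Xm x ∧ ∃ Z, Z ≠ Xp ∧ Tendsto x atTop (𝓝 Z) := by
  obtain ⟨M, hM⟩ := exists_bound_of_rates hf hcomplete hΛ hXm hr₁ R S
  -- The levels `N'` and `N` lie outside `[-(M+1), M+1]` and on either side of `Xp`; nonvanishing of
  -- the field there gives a constant sign for parameters near `lp`.
  obtain ⟨N, hN, hN0⟩ := exists_ne_zero_of_hyperbolic hb (lt_add_one (max (M + 1) Xp))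
  obtain ⟨N', hN', hN'0⟩ := exists_ne_zero_of_hyperbolic hb (sub_one_lt (min (-(M + 1)) Xp))
  obtain ⟨hNM, hNX⟩ := max_lt_iff.1 hN.1
  obtain ⟨hNM', hNX'⟩ := lt_min_iff.1 hN'.2
  obtain ⟨η₁, hη₁, hs₁⟩ := exists_sign_near hf hN0
  obtain ⟨η₂, hη₂, hs₂⟩ := exists_sign_near hf hN'0
  obtain ⟨S', hS'⟩ := hΛ.exists_near_atTop (lt_min hη₁ hη₂)
  obtain ⟨F, hF0, hF⟩ := exists_bound hf (M + 1) lm lp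
  set K := max 0 (S' - S)
  have hK : 0 ≤ K := le_max_left _ _
  -- For rates at least `r₁` the speed is at most `κ` while `|y| ≤ M + 1`, so during the
  -- acceleration time `τ = κ⁻¹` the state moves by at most one. The skip `K` brings the shift by `S
  -- + τ` into the region where the signs at `N` and `N'` are constant.
  set κ := r₁⁻¹ * F
  have hκ : 0 < κ := by positivity
  set τ := κ⁻¹
  have hτ : 0 < τ := inv_pos.2 hκ
  set Λ' := fun s => Λ (timeSkip S K τ s)
  have hΛ' : IsParameterShift lm lp Λ' := hΛ.comp_timeSkip hτ
  have heq : ∀ s ≤ S, Λ' s = Λ s := fun s hs => congrArg Λ (timeSkip_of_le hτ hs)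
  have hnear : ∀ s ≥ S, |Λ' s - lp| ≤ η := fun s hs => hS _ (le_trans hs (le_timeSkip hK))
  have hlate : ∀ s ≥ S + τ, |Λ' s - lp| ≤ min η₁ η₂ := fun s hs => by
    refine hS' _ ?_
    rw [timeSkip_of_ge hτ hs]
    linarith [le_max_right 0 (S' - S)]
  obtain ⟨r₀, hr1, hrR, htr, hntr⟩ := exists_critical_rate hf hcomplete hΛ' hXm hXp hb hr₁
    (hsmall Λ' hΛ' heq hnear) hR (hnot Λ' hΛ' heq hnear)
  have hr₀ := hr₁.trans_le hr1
  obtain ⟨x, hx⟩ := exists_pullbackAttractorFrom hf hcomplete hΛ' hXm hr₀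
  refine ⟨Λ', hΛ', r₀, hr₀, htr, x, hx, ?_⟩
  have hys := hx.pastSol hr₀
  set y := fun s => x (r₀⁻¹ * s)
  have hyS : |y S| ≤ M := by
    refine hM r₀ ⟨hr1, hrR⟩ y ⟨fun a b hb => ?_, (hys S).tendsto⟩
    exact ((hys b).sol a b le_rfl).congr_param fun s hs => heq s (hs.2.le.trans hb)
  have hyτ : |y (S + τ) - 0| ≤ M + 1 := by
    refine ((hys (S + τ)).sol S (S + τ) le_rfl).drift hf hΛ'.continuous (κ := κ) hκ.le
      (fun s _ z hz => ?_) (by simpa using hyS) ?_ _ ⟨by linarith, le_rfl⟩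
    · rw [abs_mul, abs_of_pos (inv_pos.2 hr₀)]
      exact mul_le_mul (inv_anti₀ hr₁ hr1) (hF z _ (by simpa using hz) (hΛ'.mem_Icc s))
        (abs_nonneg _) (inv_pos.2 hr₁).le
    · rw [add_sub_cancel_left, mul_inv_cancel₀ hκ.ne']
  rw [sub_zero] at hyτ
  have hyτ' := abs_le.1 hyτ
  have hup := critical_le hf hΛ' hXm hr₀ hx htr hNX
    (hs₁.imp (fun h s hs => h _ ((hlate s hs).trans (min_le_left _ _)))
      (fun h s hs => h _ ((hlate s hs).trans (min_le_left _ _)))) (hyτ'.2.trans hNM.le)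
  have hlo := le_critical hf hΛ' hXm hr₀ hx htr hNX'
    (hs₂.imp (fun h s hs => h _ ((hlate s hs).trans (min_le_right _ _)))
      (fun h s hs => h _ ((hlate s hs).trans (min_le_right _ _)))) (hNM'.le.trans hyτ'.1)
  obtain ⟨Z, -, hZ, -⟩ := exists_tendsto_of_mem_Icc (a := 0) (y := y) hf hΛ'.continuous
    hΛ'.tendsto_atTop hb (inv_pos.2 hr₀) (fun b => (hys b).sol 0 b le_rfl) (α := N') (β := N)
    (eventually_atTop.2 ⟨S + τ, fun s hs => ⟨hlo s hs, hup s hs⟩⟩)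
  have hZ' : Tendsto x atTop (𝓝 Z) := (tendsto_rescale_iff (g := id) hr₀).1 hZ
  exact ⟨Z, fun h => hntr ⟨x, hx, h ▸ hZ'⟩, hZ'⟩

/-- Inside a contraction tube around `B` the field is strictly decreasing and has one zero, so
agreement of the branches persists to the right; it is also a closed condition. -/
theorem branches_eq (hf : ContDiff ℝ 2 (fun p : ℝ × ℝ => f p.1 p.2)) {p q : ℝ} (hpq : p ≤ q)
    {B Y : ℝ → ℝ} (hB : ContinuousOn B (Icc p q)) (hY : ContinuousOn Y (Icc p q))
    (hBeq : ∀ l ∈ Icc p q, f (B l) l = 0) (hYeq : ∀ l ∈ Icc p q, f (Y l) l = 0)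
    (hdx : ∀ l ∈ Icc p q, dx f (B l) l < 0) (h : B p = Y p) : B q = Y q := by
  obtain ⟨δ, c, hδ, hc, htube⟩ := exists_tube hf hB hdx
  have hcl : IsClosed ({l | B l - Y l = 0} ∩ Icc p q) := by
    rw [inter_comm]
    exact (hB.sub hY).preimage_isClosed_of_isClosed isClosed_Icc isClosed_singleton
  refine sub_eq_zero.1 (hcl.Icc_subset_of_forall_mem_nhdsWithin (sub_eq_zero.2 h) ?_
    (right_mem_Icc.2 hpq))
  rintro l ⟨hl, hlI⟩
  have hl0 : B l - Y l = 0 := hl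
  have hcont : ContinuousWithinAt (fun l => B l - Y l) (Ioi l) l :=
    ((hB.sub hY) l (Ico_subset_Icc_self hlI)).mono_of_mem_nhdsWithin (Icc_mem_nhdsGT_of_mem hlI)
  have hlim : Tendsto (fun l => B l - Y l) (𝓝[>] l) (𝓝 0) := hl0 ▸ hcont.tendsto
  filter_upwards [hlim.eventually (Metric.ball_mem_nhds 0 hδ), Icc_mem_nhdsGT_of_mem hlI]
    with v hv hvI
  have hv' := abs_lt.1 (by simpa [Real.dist_eq] using hv : |B v - Y v| < δ)
  change B v - Y v = 0
  have hz : ∀ z, B v - δ ≤ z → z ≤ B v + δ → dx f z v ≤ -c := fun z h1 h2 =>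
    htube v hvI z (abs_le.2 ⟨by linarith, by linarith⟩)
  rcases le_total (B v) (Y v) with hle | hle
  · have := sub_le_of_dx_le hf (l := v) (c := c) hle
      (fun z hz' => hz z (by linarith [hz'.1]) (by linarith [hz'.2]))
    rw [hBeq v hvI, hYeq v hvI] at this
    nlinarith
  · have := sub_le_of_dx_le hf (l := v) (c := c) hle
      (fun z hz' => hz z (by linarith [hz'.1]) (by linarith [hz'.2]))
    rw [hBeq v hvI, hYeq v hvI] at this
    nlinarith

end FiniteLimit

/-! ### Stable branches as paths, and the exclusion of tipping. -/

section Branches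

variable {f : ℝ → ℝ → ℝ} {Λ X B : ℝ → ℝ} {lm lp Xm Xp : ℝ}

theorem IsStableBranch.dx_neg_of_bif (hf : ContDiff ℝ 2 (fun p : ℝ × ℝ => f p.1 p.2)) {a b : ℝ}
    (hB : IsStableBranch f lm lp a b B) (ha : (B a, a) ∉ bifSet f lm lp)
    (hb : (B b, b) ∉ bifSet f lm lp) : ∀ l ∈ Icc a b, dx f (B l) l < 0 := by
  intro l hl
  refine hB.dx_neg hf hl ?_
  rcases hl.1.eq_or_lt with rfl | h1
  · exact ha
  rcases hl.2.eq_or_lt with rfl | h2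
  · exact hb
  exact hB.notMem_bifSet l ⟨h1, h2⟩

theorem IsParameterShift.tendsto_branch_atBot (hΛ : IsParameterShift lm lp Λ)
    (hB : ContinuousOn B (Icc lm lp)) : Tendsto (fun s => B (Λ s)) atBot (𝓝 (B lm)) :=
  (hB lm (left_mem_Icc.2 hΛ.lt.le)).tendsto.comp
    (tendsto_nhdsWithin_iff.2 ⟨hΛ.tendsto_atBot, .of_forall hΛ.mem_Icc⟩)

theorem IsParameterShift.tendsto_branch_atTop (hΛ : IsParameterShift lm lp Λ)
    (hB : ContinuousOn B (Icc lm lp)) : Tendsto (fun s => B (Λ s)) atTop (𝓝 (B lp)) :=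
  (hB lp (right_mem_Icc.2 hΛ.lt.le)).tendsto.comp
    (tendsto_nhdsWithin_iff.2 ⟨hΛ.tendsto_atTop, .of_forall hΛ.mem_Icc⟩)

theorem IsStableBranch.isStablePath (hΛ : IsParameterShift lm lp Λ)
    (hB : IsStableBranch f lm lp lm lp B) :
    IsStablePath f lm lp Λ (fun s => B (Λ s)) (B lm) (B lp) where
  continuous := hB.continuousOn.comp_continuous hΛ.continuous hΛ.mem_Icc
  tendsto_atBot := hΛ.tendsto_branch_atBot hB.continuousOn
  tendsto_atTop := hΛ.tendsto_branch_atTop hB.continuousOn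
  mem_equilibria s := hB.mem_equilibria _ (hΛ.mem_Icc s)
  mem_closure s := hB.mem_closure _ (hΛ.mem_Icc s)

theorem TraversesBranch.endpoints (hΛ : IsParameterShift lm lp Λ)
    (hX : IsStablePath f lm lp Λ X Xm Xp) (h : TraversesBranch f lm lp Λ X B) :
    B lm = Xm ∧ B lp = Xp := by
  obtain rfl : X = fun s => B (Λ s) := funext h.2
  exact ⟨tendsto_nhds_unique (hΛ.tendsto_branch_atBot h.1.continuousOn) hX.tendsto_atBot,
    tendsto_nhds_unique (hΛ.tendsto_branch_atTop h.1.continuousOn) hX.tendsto_atTop⟩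

/-- Uniqueness of the pullback trajectory at the rate `r₀ / 2` forces the tracked end point to be
`Xp`, which is then also the limit at `r₀`. -/
theorem not_irreversibleRTipping
    (h : ∀ r : ℝ, 0 < r →
      ∃ x : ℝ → ℝ, IsPullbackAttractorFrom f Λ r Xm x ∧ EndpointTracks x Xm Xp) :
    ¬ IrreversibleRTipping f lm lp Λ Xm := by
  rintro ⟨Z, r₀, hr₀, W, -, htr, hne, x, hx, hlim⟩
  have track : ∀ r, 0 < r → TracksAt f Λ Xm Xp r := fun r hr => by
    obtain ⟨x, hx, h⟩ := h r hr
    exact ⟨x, hx, h.2⟩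
  obtain ⟨y, hy, hyW⟩ := htr (r₀ / 2) (half_pos hr₀) (half_lt_self hr₀)
  have hW : W = Xp := tendsto_nhds_unique hyW.2 ((track _ (half_pos hr₀)).tendsto hy)
  refine hne (tendsto_nhds_unique hlim ?_)
  rw [hW]
  exact EReal.tendsto_coe.2 ((track r₀ hr₀).tendsto hx)

theorem endpointTracks_of_tracksAt {r : ℝ} (h : TracksAt f Λ Xm Xp r) :
    ∃ x : ℝ → ℝ, IsPullbackAttractorFrom f Λ r Xm x ∧ EndpointTracks x Xm Xp := by
  obtain ⟨x, hx, hlim⟩ := h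
  exact ⟨x, hx, hx.tendsto_atBot, hlim⟩

end Branches

/-! ### Assembly of the three claims. -/

section Main

variable {f : ℝ → ℝ → ℝ} {Λ X B : ℝ → ℝ} {lm lp Xm Xp : ℝ}

theorem tracks_of_forwardBasinStable (hf : ContDiff ℝ 2 (fun p : ℝ × ℝ => f p.1 p.2))
    (hcomplete : ForwardComplete f lm lp) (hb : ∀ x, f x lp = 0 → dx f x lp ≠ 0)
    (hΛ : IsParameterShift lm lp Λ) (hXm : (Xm, lm) ∈ stabSet f lm lp)
    (hX : IsStablePath f lm lp Λ X Xm Xp) (hfbs : ForwardBasinStable f Λ X) {r : ℝ} (hr : 0 < r) :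
    TracksAt f Λ Xm Xp r := by
  obtain ⟨x, hx⟩ := exists_pullbackAttractorFrom hf hcomplete hΛ hXm hr
  refine ⟨x, hx, (tendsto_rescale_iff (g := id) hr).1 ?_⟩
  exact tendsto_of_basinStable hf hΛ hXm.2 hb hX.continuous hX.tendsto_atBot hX.tendsto_atTop
    (fun s => (hX.mem_equilibria s).1) hfbs (inv_pos.2 hr) (hx.isPullbackAttractor.1.rescale hr)
    (hx.pastSol hr 0).tendsto

theorem exists_finite_tipping (hf : ContDiff ℝ 2 (fun p : ℝ × ℝ => f p.1 p.2))
    (hcomplete : ForwardComplete f lm lp) (hlt : lm < lp)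
    (hb : ∀ x, f x lp = 0 → dx f x lp ≠ 0) (hB : IsStableBranch f lm lp lm lp B)
    (hdx : ∀ l ∈ Icc lm lp, dx f (B l) l < 0) {p q : ℝ} (hp : p ∈ Ioo lm lp) (hq : q ∈ Ioo lm lp)
    {Y : ℝ → ℝ} (hY : ContinuousOn Y (Icc q lp)) (hYeq : ∀ l ∈ Icc q lp, f (Y l) l = 0)
    (hYdx : ∀ l ∈ Icc q lp, dx f (Y l) l < 0) (hne : Y lp ≠ B lp)
    (hbasin : B p ∈ basin f (Y q) q) :
    ∃ Λ' : ℝ → ℝ, IsParameterShift lm lp Λ' ∧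
      ∃ Z : ℝ, IrreversibleRTippingTo f lm lp Λ' (B lm) (Z : EReal) := by
  have heq : ∀ l ∈ Icc lm lp, f (B l) l = 0 := fun l hl => (hB.mem_equilibria l hl).1
  have hm := left_mem_Icc.2 hlt.le
  have hM := right_mem_Icc.2 hlt.le
  have hXm : (B lm, lm) ∈ stabSet f lm lp := ⟨hB.mem_equilibria _ hm, hdx _ hm⟩
  have hXp : (B lp, lp) ∈ stabSet f lm lp := ⟨hB.mem_equilibria _ hM, hdx _ hM⟩
  obtain ⟨τ, η, R, hτ, hη, hR, hjump⟩ := exists_jump_not_tracksAt hf hlt hB.continuousOn heq hdx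
    hp hq hY hYeq hYdx hne hbasin
  obtain ⟨η', hη', hslow⟩ :=
    exists_slow_tracking hf hcomplete hlt hXm hXp hb hB.continuousOn heq hdx
  have hΛ := isParameterShift_jumpShift hp hq hτ
  obtain ⟨K, -, hK⟩ := exists_lipschitz_of_deriv_tendsto hΛ.contDiff hΛ.deriv_atBot hΛ.deriv_atTop
  obtain ⟨r₁, hr₁, hslow₁⟩ := hslow K
  obtain ⟨S₀, hS₀⟩ := hΛ.exists_near_atTop (lt_min hη hη')
  -- Slow tracking and failure at `R` both hold for every modification after `max 2 S₀` that remains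
  -- close to `lp`, so the accelerated shift inherits them.
  obtain ⟨Λ', hΛ', r₀, hr₀, htr, x, hx, Z, hZ, hlim⟩ := exists_finite_critical hf hcomplete hΛ
    hXm hXp hb (S := max 2 S₀) hr₁ hR (fun s hs => hS₀ s ((le_max_right _ _).trans hs))
    (fun Λ' hΛ' heq' hnear => hslow₁ Λ' _ hΛ'
      (fun s hs s' hs' => by rw [heq' s hs, heq' s' hs']; exact hK s s')
      (fun s hs => (hnear s hs).trans (min_le_right _ _)))
    (fun Λ' hΛ' heq' hnear => hjump _ (le_max_left _ _) Λ' hΛ' heq'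
      (fun s hs => (hnear s hs).trans (min_le_left _ _)))
  exact ⟨Λ', hΛ', Z, r₀, hr₀, B lp, ⟨hXm, hXp, _, hB.isStablePath hΛ'⟩,
    fun r hr hrr => endpointTracks_of_tracksAt (htr r hr hrr),
    fun h => hZ (EReal.coe_eq_coe_iff.1 h), x, hx, EReal.tendsto_coe.2 hlim⟩

theorem irreversibleRTipping_of_basin (hf : ContDiff ℝ 2 (fun p : ℝ × ℝ => f p.1 p.2))
    (hcomplete : ForwardComplete f lm lp) (hb : ∀ x, f x lp = 0 → dx f x lp ≠ 0)
    (hΛ : IsParameterShift lm lp Λ) (hB : IsStableBranch f lm lp lm lp B)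
    (hdx : ∀ l ∈ Icc lm lp, dx f (B l) l < 0) {Y : ℝ} (hY : (Y, lp) ∈ stabSet f lm lp)
    (hne : Y ≠ B lp) (hbasin : B lm ∈ basin f Y lp) :
    IrreversibleRTipping f lm lp Λ (B lm) := by
  have hlt := hΛ.lt
  have heq : ∀ l ∈ Icc lm lp, f (B l) l = 0 := fun l hl => (hB.mem_equilibria l hl).1
  have hm := left_mem_Icc.2 hlt.le
  have hM := right_mem_Icc.2 hlt.le
  have hXm : (B lm, lm) ∈ stabSet f lm lp := ⟨hB.mem_equilibria _ hm, hdx _ hm⟩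
  have hXp : (B lp, lp) ∈ stabSet f lm lp := ⟨hB.mem_equilibria _ hM, hdx _ hM⟩
  obtain ⟨η, hη, hslow⟩ :=
    exists_slow_tracking hf hcomplete hlt hXm hXp hb hB.continuousOn heq hdx
  obtain ⟨K, -, hK⟩ := exists_lipschitz_of_deriv_tendsto hΛ.contDiff hΛ.deriv_atBot hΛ.deriv_atTop
  obtain ⟨r₁, hr₁, hslow₁⟩ := hslow K
  obtain ⟨S, hS⟩ := hΛ.exists_near_atTop hη
  obtain ⟨R, hR, hnot⟩ := exists_not_tracksAt hf hΛ hXm hXp.1.1 hY hne hbasin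
  obtain ⟨r₀, hr1, -, htr, hntr⟩ := exists_critical_rate hf hcomplete hΛ hXm hXp hb hr₁
    (hslow₁ Λ S hΛ (fun s _ s' _ => hK s s') hS) hR hnot
  have hr₀ := hr₁.trans_le hr1
  obtain ⟨x, hx⟩ := exists_pullbackAttractorFrom hf hcomplete hΛ hXm hr₀
  obtain ⟨Z, hZ⟩ := exists_tendsto_ereal (a := 0) hf hΛ.continuous hΛ.tendsto_atTop hb
    (inv_pos.2 hr₀).le (fun b => (hx.pastSol hr₀ b).sol 0 b le_rfl)
  have hZ' := (tendsto_rescale_iff (g := fun x : ℝ => (x : EReal)) hr₀).1 hZ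
  refine ⟨Z, r₀, hr₀, B lp, ⟨hXm, hXp, _, hB.isStablePath hΛ⟩,
    fun r hr hrr => endpointTracks_of_tracksAt (htr r hr hrr), ?_, x, hx, hZ'⟩
  rintro rfl
  exact hntr ⟨x, hx, EReal.tendsto_coe.1 hZ'⟩

end Main

end RTip

end

theorem theorem3p3
    (f : ℝ → ℝ → ℝ) (hf : ContDiff ℝ 2 (fun p : ℝ × ℝ => f p.1 p.2))
    (lm lp : ℝ) (hcomplete : ForwardComplete f lm lp)
    (hreg : IsRegular f lm lp)
    (hbif : ∀ x : ℝ, (x, lm) ∉ bifSet f lm lp ∧ (x, lp) ∉ bifSet f lm lp)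
    (Λ : ℝ → ℝ) (hΛ : IsParameterShift lm lp Λ)
    (Xm Xp : ℝ) (hXm : (Xm, lm) ∈ stabSet f lm lp) (hXp : (Xp, lp) ∈ stabSet f lm lp)
    (X : ℝ → ℝ) (hX : IsStablePath f lm lp Λ X Xm Xp) :
    -- forward basin stability gives tracking at every rate
    (ForwardBasinStable f Λ X →
      (∀ r : ℝ, 0 < r →
        ∃ x : ℝ → ℝ, IsPullbackAttractorFrom f Λ r Xm x ∧ EndpointTracks x Xm Xp) ∧
      ¬ IrreversibleRTipping f lm lp Λ Xm) ∧
    -- an earlier position in the basin of another stable branch gives tipping on some shift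
    (∀ B : ℝ → ℝ, TraversesBranch f lm lp Λ X B →
      ∀ (l₀ : ℝ) (Y : ℝ → ℝ), lm ≤ l₀ → l₀ < lp → IsStableBranch f lm lp l₀ lp Y → Y lp ≠ Xp →
      ∀ u v : ℝ, u < v → l₀ ≤ Λ v → (Y (Λ v), Λ v) ∈ stabSet f lm lp →
        X u ∈ basin f (Y (Λ v)) (Λ v) →
      ¬ ForwardBasinStable f Λ X ∧
      ∃ Λ' : ℝ → ℝ, IsParameterShift lm lp Λ' ∧
        ∃ Zp : ℝ, IrreversibleRTippingTo f lm lp Λ' Xm (Zp : EReal)) ∧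
    -- the initial state in a future basin that is not connected to it gives tipping on this shift
    (∀ B : ℝ → ℝ, TraversesBranch f lm lp Λ X B →
      ∀ Yp : ℝ, (Yp, lp) ∈ stabSet f lm lp → ¬ LambdaConnected f lm lp Λ Xm Yp →
        Xm ∈ basin f Yp lp →
      ¬ ForwardBasinStable f Λ X ∧ IrreversibleRTipping f lm lp Λ Xm) := by
  have hlt := hΛ.lt
  have hb := hyperbolic_of_not_mem_bifSet hlt.le hbif
  have part1 : ForwardBasinStable f Λ X → (∀ r : ℝ, 0 < r →
      ∃ x : ℝ → ℝ, IsPullbackAttractorFrom f Λ r Xm x ∧ EndpointTracks x Xm Xp) ∧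
      ¬ IrreversibleRTipping f lm lp Λ Xm := fun hfbs => by
    have h : ∀ r : ℝ, 0 < r →
        ∃ x : ℝ → ℝ, IsPullbackAttractorFrom f Λ r Xm x ∧ EndpointTracks x Xm Xp := fun r hr =>
      endpointTracks_of_tracksAt (tracks_of_forwardBasinStable hf hcomplete hb hΛ hXm hX hfbs hr)
    exact ⟨h, not_irreversibleRTipping h⟩
  refine ⟨part1, fun B hB l₀ Y hl₀ hl₀p hY hne u v huv hv hYv hbasin => ?_,
    fun B hB Yp hYp hnc hbasin => ?_⟩
  · obtain ⟨rfl, rfl⟩ := hB.endpoints hΛ hX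
    have hdx := hB.1.dx_neg_of_bif hf (hbif _).1 (hbif _).2
    have hsub : Icc (Λ v) lp ⊆ Icc l₀ lp := Icc_subset_Icc hv le_rfl
    have hYc := hY.continuousOn.mono hsub
    have hYeq : ∀ l ∈ Icc (Λ v) lp, f (Y l) l = 0 := fun l hl => (hY.mem_equilibria l (hsub hl)).1
    have hYdx : ∀ l ∈ Icc (Λ v) lp, dx f (Y l) l < 0 := by
      intro l hl
      -- The branch `Y` may start in a fold at `l₀`; at the left end `Λ v` stability is the
      -- hypothesis `hYv`.
      rcases hl.1.eq_or_lt with rfl | h1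
      · exact hYv.2
      refine hY.dx_neg hf (hsub hl) ?_
      rcases hl.2.eq_or_lt with rfl | h2
      · exact (hbif _).2
      · exact hY.notMem_bifSet l ⟨hv.trans_lt h1, h2⟩
    refine ⟨fun hfbs => hne ?_, exists_finite_tipping hf hcomplete hlt hb hB.1 hdx (hΛ.mem_Ioo u)
      (hΛ.mem_Ioo v) hYc hYeq hYdx hne (hB.2 u ▸ hbasin)⟩
    -- Under forward basin stability `X u` would lie in the basins of both `X v` and `Y (Λ v)`;
    -- these would coincide, and then so would the branches up to `lp`.
    have h1 := basin_unique hf (hfbs v (subset_closure ⟨u, huv, rfl⟩)) hbasin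
    have hsub' : Icc (Λ v) lp ⊆ Icc lm lp := Icc_subset_Icc (hΛ.mem_Icc v).1 le_rfl
    exact (branches_eq hf (hΛ.mem_Icc v).2 (hB.1.continuousOn.mono hsub') hYc
      (fun l hl => (hB.1.mem_equilibria l (hsub' hl)).1) hYeq (fun l hl => hdx l (hsub' hl))
      ((hB.2 v).symm.trans h1)).symm
  · obtain ⟨rfl, rfl⟩ := hB.endpoints hΛ hX
    have hdx := hB.1.dx_neg_of_bif hf (hbif _).1 (hbif _).2
    -- If `Yp` were the end point of the path, the path itself would connect `Xm` to it.
    have htip := irreversibleRTipping_of_basin hf hcomplete hb hΛ hB.1 hdx hYp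
      (fun h => hnc ⟨hXm, hYp, X, h ▸ hX⟩) hbasin
    exact ⟨fun hfbs => (part1 hfbs).2 htip, htip⟩
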